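/- **Theorem (lifted model structure on $T\text{-}\mathrm{Alg}_s$).** Let $\mathscr K$ be a locally presentable 2-category (for instance a locally finitely presentable one): $\mathscr K$ is cocomplete as a 2-category and, for some regular cardinal $\kappa$, has a small set of objects $G$ such that each $\mathscr K(G,-)\colon\mathscr K\to\mathbf{Cat}$ preserves $\kappa$-filtered colimits and every object of $\mathscr K$ is a $\kappa$-filtered colimit of such $G$'s. Let $T$ be a (strict) 2-monad on $\mathscr K$ with rank, i.e. $T$ preserves $\alpha$-filtered colimits for some regular cardinal $\alpha$. Let $T\text{-}\mathrm{Alg}_s$ be the 2-category of strict $T$-algebras, strict $T$-morphisms and $T$-transformations, with forgetful 2-functor $U_s\colon T\text{-}\mathrm{Alg}_s\to\mathscr K$ and free algebra functor $F_s\colon\mathscr K\to T\text{-}\mathrm{Alg}_s$. A morphism $f\colon A\to B$ of $\mathscr K$ is an *equivalence* if there is $g\colon B\to A$ with $gf\cong 1_A$ and $fg\cong 1_B$; it is an *isofibration* if for all $a\colon X\to A$, $b\colon X\to B$ and every invertible 2-cell $\beta\colon b\cong fa$ there are $a'\colon X\to A$ and an invertible 2-cell $\alpha\colon a'\cong a$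 with $fa'=b$ and $f\alpha=\beta$. (These are the weak equivalences and the fibrations of the trivial model structure on $\mathscr K$.) Then $T\text{-}\mathrm{Alg}_s$ is a model $\mathbf{Cat}$-category in which a strict morphism $f$ is a weak equivalence if and only if $U_sf$ is an equivalence in $\mathscr K$, and a fibration if and only if $U_sf$ is an isofibration in $\mathscr K$. That is, these two classes, together with a class of cofibrations, form a model structure on the underlying ordinary category (including finite limits and colimits); $T\text{-}\mathrm{Alg}_s$ has tensors and cotensors by the arrow category $\mathbf 2$; and for every cofibration $i\colon A\to B$ and every fibration $p\colon C\to D$ the induced functor from $T\text{-}\mathrm{Alg}_s(B,C)$ to the pullback $$T\text{-}\mathrm{Alg}_s(A,C)\times_{T\text{-}\mathrm{Alg}_s(A,D)}T\text{-}\mathrm{Alg}_s(B,D)$$ is an isofibration of categories, and is moreover an equivalence of categories if $i$ or $p$ is a weak equivalence. Moreover this model structure is generated by the (in general large) classes of free maps: the cofibrations are the morphisms with the left lifting property against all morphisms that have the right lifting property against every $F_si$, where $i$ runs over the cofibrations of the trivial model structure on $\mathscr K$ (the morphisms with the left lifting property against the isofibrations that are equivalences); and the trivial cofibrations are the morphisms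 with the left lifting property against all morphisms that have the right lifting property against every $F_sj$, where $j$ runs over the trivial cofibrations of the trivial model structure (the morphisms with the left lifting property against the isofibrations). -/

import Mathlib

open CategoryTheory Bicategory Limits HomotopicalAlgebra

universe w v u

attribute [-instance] catToReflQuiver instCategoryEndMonoidal

/-!
A 2-category is a strict bicategory (`Bicategory` with `Bicategory.Strict`); its underlying ordinary
category is `StrictBicategory.category`. Composition is written in diagrammatic order, `f ◁ α` and
`α ▷ g` are the two whiskerings of a 2-cell, and `eqToHom` mediates between 1-cells that are equal.
-/

namespace TwoCat

universe v₁ v₂ v₃ u₁ u₂ u₃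

section Functors

variable {A : Type u₁} [Category.{v₁} A] {B : Type u₂} [Category.{v₂} B]
  {C : Type u₃} [Category.{v₃} C]

/-- Isofibrations of ordinary categories: every isomorphism `β : b ≅ F e` lifts to an isomorphism
`φ : e' ≅ e` with `F e' = b` and `F φ = β`. -/
def IsIsofibration (F : A ⥤ B) : Prop :=
  ∀ (e : A) (b : B) (β : b ≅ F.obj e),
    ∃ (e' : A) (φ : e' ≅ e) (h : F.obj e' = b), F.map φ.hom = eqToHom h ≫ β.hom

/-- Isomorphisms of ordinary categories: fully faithful functors bijective on objects. -/
def IsIsoOfCategories (F : A ⥤ B) : Prop :=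
  F.Full ∧ F.Faithful ∧ Function.Bijective F.obj

/-- Objects of the (strict) pullback of categories of `F : A ⥤ C` along `G : B ⥤ C`. -/
structure StrictPullback (F : A ⥤ C) (G : B ⥤ C) where
  fst : A
  snd : B
  w : F.obj fst = G.obj snd

/-- Morphisms of the strict pullback. -/
@[ext]
structure StrictPullback.Hom {F : A ⥤ C} {G : B ⥤ C} (X Y : StrictPullback F G) where
  fst : X.fst ⟶ Y.fst
  snd : X.snd ⟶ Y.snd
  w : F.map fst ≫ eqToHom Y.w = eqToHom X.w ≫ G.map snd

instance (F : A ⥤ C) (G : B ⥤ C) : Category (StrictPullback F G) where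
  Hom := StrictPullback.Hom
  id X := ⟨𝟙 _, 𝟙 _, by simp⟩
  comp f g := ⟨f.fst ≫ g.fst, f.snd ≫ g.snd, by
    rw [F.map_comp, Category.assoc, g.w, ← Category.assoc, f.w, Category.assoc, ← G.map_comp]⟩
  id_comp f := StrictPullback.Hom.ext (Category.id_comp _) (Category.id_comp _)
  comp_id f := StrictPullback.Hom.ext (Category.comp_id _) (Category.comp_id _)
  assoc f g h := StrictPullback.Hom.ext (Category.assoc _ _ _) (Category.assoc _ _ _)

end Functors

section TwoCategories

variable {K : Type u} [Bicategory.{w, v} K]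

section Whiskering

lemma eq_whiskerLeft {A B C : K} {f f' : A ⟶ B} (e : f = f') {g h : B ⟶ C} (α : g ⟶ h) :
    f ◁ α = eqToHom (by rw [e]) ≫ f' ◁ α ≫ eqToHom (by rw [e]) := by
  subst e; simp

lemma eq_whiskerRight {A B C : K} {f g : A ⟶ B} (α : f ⟶ g) {h h' : B ⟶ C} (e : h = h') :
    α ▷ h = eqToHom (by rw [e]) ≫ α ▷ h' ≫ eqToHom (by rw [e]) := by
  subst e; simp

variable [Bicategory.Strict K]

lemma comp_whiskerLeft_strict {A B C D : K} (f : A ⟶ B) (g : B ⟶ C) {h k : C ⟶ D} (α : h ⟶ k) :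
    (f ≫ g) ◁ α = eqToHom (Category.assoc f g h) ≫ f ◁ g ◁ α ≫
      eqToHom (Category.assoc f g k).symm := by
  rw [comp_whiskerLeft, Bicategory.Strict.associator_eqToIso,
    Bicategory.Strict.associator_eqToIso]
  rfl

lemma whiskerRight_comp_strict {A B C D : K} {f g : A ⟶ B} (α : f ⟶ g) (h : B ⟶ C) (k : C ⟶ D) :
    α ▷ (h ≫ k) = eqToHom (Category.assoc f h k).symm ≫ α ▷ h ▷ k ≫
      eqToHom (Category.assoc g h k) := by
  rw [whiskerRight_comp, Bicategory.Strict.associator_eqToIso,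
    Bicategory.Strict.associator_eqToIso]
  rfl

lemma whisker_assoc_strict {A B C D : K} (f : A ⟶ B) {g h : B ⟶ C} (α : g ⟶ h) (k : C ⟶ D) :
    (f ◁ α) ▷ k = eqToHom (Category.assoc f g k) ≫ f ◁ α ▷ k ≫
      eqToHom (Category.assoc f h k).symm := by
  rw [whisker_assoc, Bicategory.Strict.associator_eqToIso,
    Bicategory.Strict.associator_eqToIso]
  rfl

lemma id_whiskerLeft_strict {A B : K} {f g : A ⟶ B} (α : f ⟶ g) :
    𝟙 A ◁ α = eqToHom (Category.id_comp f) ≫ α ≫ eqToHom (Category.id_comp g).symm := by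
  rw [id_whiskerLeft, Bicategory.Strict.leftUnitor_eqToIso,
    Bicategory.Strict.leftUnitor_eqToIso]
  rfl

lemma whiskerRight_id_strict {A B : K} {f g : A ⟶ B} (α : f ⟶ g) :
    α ▷ 𝟙 B = eqToHom (Category.comp_id f) ≫ α ≫ eqToHom (Category.comp_id g).symm := by
  rw [whiskerRight_id, Bicategory.Strict.rightUnitor_eqToIso,
    Bicategory.Strict.rightUnitor_eqToIso]
  rfl

end Whiskering

variable (K) in
/-- The equivalences of a 2-category. -/
def equivalences [Bicategory.Strict K] : MorphismProperty K := fun A B f =>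
  ∃ g : B ⟶ A, Nonempty (f ≫ g ≅ 𝟙 A) ∧ Nonempty (g ≫ f ≅ 𝟙 B)

variable (K) in
/-- The isofibrations of a 2-category: for `a : X ⟶ A`, `b : X ⟶ B` and an invertible 2-cell
`β : b ≅ a ≫ f` there are `a' : X ⟶ A` and an invertible 2-cell `α : a' ≅ a` with `a' ≫ f = b` and
`α ▷ f = β`. -/
def isofibrations [Bicategory.Strict K] : MorphismProperty K := fun _ _ f =>
  ∀ X : K, IsIsofibration (postcomp X f)

variable (K) in
/-- The cofibrations of the trivial model structure on a 2-category: the morphisms with the left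
lifting property against the trivial fibrations, i.e. against the isofibrations that are
equivalences. -/
def trivialModelCofibrations [Bicategory.Strict K] : MorphismProperty K :=
  (equivalences K ⊓ isofibrations K).llp

variable (K) in
/-- The trivial cofibrations of the trivial model structure on a 2-category: the morphisms with the
left lifting property against the isofibrations. -/
def trivialModelTrivialCofibrations [Bicategory.Strict K] : MorphismProperty K :=
  (isofibrations K).llp

/-- The comparison `K(T, B) ⥤ [J, K(A, B)]` induced by a diagram `W : J ⥤ K(A, T)`. -/
def tensorComparison {J : Type u₁} [Category.{v₁} J] {A T : K} (W : J ⥤ (A ⟶ T)) (B : K) :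
    (T ⟶ B) ⥤ (J ⥤ (A ⟶ B)) :=
  postcomposing A T B ⋙ (Functor.whiskeringLeft J (A ⟶ T) (A ⟶ B)).obj W

/-- The comparison `K(B, P) ⥤ [J, K(B, A)]` induced by a diagram `W : J ⥤ K(P, A)`. -/
def cotensorComparison {J : Type u₁} [Category.{v₁} J] {A P : K} (W : J ⥤ (P ⟶ A)) (B : K) :
    (B ⟶ P) ⥤ (J ⥤ (B ⟶ A)) :=
  precomposing B P A ⋙ (Functor.whiskeringLeft J (P ⟶ A) (B ⟶ A)).obj W

/-- The tensor `J · A` exists: an object `T` with isomorphisms of categories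
`K(T, B) ≅ [J, K(A, B)]`, 2-natural in `B` (hence induced by some `W : J ⥤ K(A, T)`). -/
def HasTensor (J : Type u₁) [Category.{v₁} J] (A : K) : Prop :=
  ∃ (T : K) (W : J ⥤ (A ⟶ T)), ∀ B : K, IsIsoOfCategories (tensorComparison W B)

/-- The cotensor `J ⋔ A` exists: an object `P` with isomorphisms of categories
`K(B, P) ≅ [J, K(B, A)]`, 2-natural in `B` (hence induced by some `W : J ⥤ K(P, A)`). -/
def HasCotensor (J : Type u₁) [Category.{v₁} J] (A : K) : Prop :=
  ∃ (P : K) (W : J ⥤ (P ⟶ A)), ∀ B : K, IsIsoOfCategories (cotensorComparison W B)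

variable [Bicategory.Strict K]

/-- A conical colimit in the 2-categorical sense: a colimit cocone `c` in the underlying ordinary
category which has the universal property for 2-cells as well, so that
`K(c.pt, B) ≅ lim_j K(F j, B)` as categories. -/
structure Is2Colimit {J : Type u₁} [Category.{v₁} J] {F : J ⥤ K} (c : Cocone F) : Prop where
  isColimit : Nonempty (IsColimit c)
  existsUnique_twoCell {B : K} (h k : c.pt ⟶ B)
    (α : ∀ j : J, c.ι.app j ≫ h ⟶ c.ι.app j ≫ k)
    (hα : ∀ {j j' : J} (f : j ⟶ j'), F.map f ◁ α j' =
      eqToHom (by rw [← Category.assoc, c.w]) ≫ α j ≫ eqToHom (by rw [← Category.assoc, c.w])) :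
    ∃! γ : h ⟶ k, ∀ j : J, c.ι.app j ◁ γ = α j

/-- The representable `K(X, -)` as a functor from the underlying ordinary category to `Cat`. -/
def homFunctor (X : K) : K ⥤ Cat.{w, v} where
  obj Y := Cat.of (X ⟶ Y)
  map f := (postcomp X f).toCatHom
  map_id Y := by
    apply Cat.Hom.ext
    exact CategoryTheory.Functor.ext (fun f => Category.comp_id f)
      (fun f g α => whiskerRight_id_strict α)
  map_comp {Y Z W} f g := by
    apply Cat.Hom.ext
    exact CategoryTheory.Functor.ext (fun h => (Category.assoc h f g).symm)
      (fun h k α => whiskerRight_comp_strict α f g)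

/-- For a morphism `i : A ⟶ B` and a morphism `p : C ⟶ D`, the functor `[i, p]` from `K(B, C)` to
the pullback of `K(A, p) : K(A, C) ⥤ K(A, D)` and `K(i, D) : K(B, D) ⥤ K(A, D)`. -/
def cornerFunctor {A B C D : K} (i : A ⟶ B) (p : C ⟶ D) :
    (B ⟶ C) ⥤ StrictPullback (postcomp A p) (precomp D i) where
  obj x := ⟨i ≫ x, x ≫ p, Category.assoc i x p⟩
  map γ := ⟨i ◁ γ, γ ▷ p, by
    have h := whisker_assoc_strict i γ p
    rw [← Category.assoc, ← comp_eqToHom_iff] at h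
    exact h⟩
  map_id x := StrictPullback.Hom.ext (whiskerLeft_id _ _) (id_whiskerRight _ _)
  map_comp γ δ := StrictPullback.Hom.ext (whiskerLeft_comp _ _ _) (comp_whiskerRight _ _ _)

end TwoCategories

/-- A locally presentable 2-category: it is cocomplete as a 2-category (small conical colimits and
tensors by small categories), and for some regular cardinal `κ` there is an essentially small class
of objects, each `κ`-presentable in the enriched sense (`K(G, -) : K ⥤ Cat` preserves `κ`-filtered
colimits), such that every object is a `κ`-filtered colimit of objects of the class. -/
class IsLocallyPresentable2Cat (K : Type u) [Bicategory.{v, v} K] [Bicategory.Strict K] : Prop where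
  exists_conicalColimit (J : Type v) [SmallCategory J] (F : J ⥤ K) :
    ∃ c : Cocone F, Is2Colimit c
  hasTensor (J : Type v) [SmallCategory J] (A : K) : HasTensor J A
  exists_generator : ∃ (κ : Cardinal.{v}) (_ : Fact κ.IsRegular) (P : ObjectProperty K),
    ObjectProperty.EssentiallySmall.{v} P ∧ P.IsCardinalFilteredGenerator κ ∧
      ∀ G : K, P G → (homFunctor G).IsCardinalAccessible κ

/-- A model structure on the underlying ordinary category of `K` makes the 2-category `K` a model
`Cat`-category if `K` has tensors and cotensors by the arrow category (so that, with the finite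
limits and colimits of the underlying category, it has all finite limits and colimits as a
2-category), and for every cofibration `i` and every fibration `p` the functor `[i, p]` is an
isofibration, and an equivalence of categories if moreover `i` or `p` is a weak equivalence. -/
structure IsModelCatCategory (K : Type u) [Bicategory.{w, v} K] [Bicategory.Strict K]
    [ModelCategory K] : Prop where
  hasTensor (A : K) : HasTensor (Fin 2) A
  hasCotensor (A : K) : HasCotensor (Fin 2) A
  isIsofibration_corner {A B C D : K} (i : A ⟶ B) (p : C ⟶ D)
    (hi : cofibrations K i) (hp : fibrations K p) : IsIsofibration (cornerFunctor i p)
  isEquivalence_corner {A B C D : K} (i : A ⟶ B) (p : C ⟶ D)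
    (hi : cofibrations K i) (hp : fibrations K p)
    (h : weakEquivalences K i ∨ weakEquivalences K p) : (cornerFunctor i p).IsEquivalence

/-- A 2-monad: an ordinary monad on the underlying category whose endofunctor is extended to 2-cells
as a (strict) 2-functor, and whose unit and multiplication are 2-natural. -/
structure TwoMonad (K : Type u) [Bicategory.{w, v} K] [Bicategory.Strict K] extends Monad K where
  map₂ {X Y : K} {f g : X ⟶ Y} (α : f ⟶ g) : toFunctor.map f ⟶ toFunctor.map g
  map₂_id {X Y : K} (f : X ⟶ Y) : map₂ (𝟙 f) = 𝟙 (toFunctor.map f)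
  map₂_comp {X Y : K} {f g h : X ⟶ Y} (α : f ⟶ g) (β : g ⟶ h) :
    map₂ (α ≫ β) = map₂ α ≫ map₂ β
  map₂_whiskerLeft {X Y Z : K} (f : X ⟶ Y) {g h : Y ⟶ Z} (α : g ⟶ h) :
    map₂ (f ◁ α) = eqToHom (toFunctor.map_comp f g) ≫ toFunctor.map f ◁ map₂ α ≫
      eqToHom (toFunctor.map_comp f h).symm
  map₂_whiskerRight {X Y Z : K} {f g : X ⟶ Y} (α : f ⟶ g) (h : Y ⟶ Z) :
    map₂ (α ▷ h) = eqToHom (toFunctor.map_comp f h) ≫ map₂ α ▷ toFunctor.map h ≫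
      eqToHom (toFunctor.map_comp g h).symm
  η_naturality₂ {X Y : K} {f g : X ⟶ Y} (α : f ⟶ g) :
    α ▷ η.app Y = eqToHom (η.naturality f) ≫ η.app X ◁ map₂ α ≫ eqToHom (η.naturality g).symm
  μ_naturality₂ {X Y : K} {f g : X ⟶ Y} (α : f ⟶ g) :
    map₂ (map₂ α) ▷ μ.app Y =
      eqToHom (μ.naturality f) ≫ μ.app X ◁ map₂ α ≫ eqToHom (μ.naturality g).symm

namespace TwoMonad

section

variable {K : Type u} [Bicategory.{w, v} K] [Bicategory.Strict K]

/-- A 2-monad has rank if it preserves `α`-filtered colimits for some regular cardinal `α`. -/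
def HasRank {K : Type u} [Bicategory.{v, v} K] [Bicategory.Strict K] (T : TwoMonad K) : Prop :=
  T.toFunctor.IsAccessible.{v}

/-- The strict algebras of a 2-monad: the objects of the 2-category `T-Alg_s`. -/
structure StrictAlg (T : TwoMonad K) where
  A : K
  a : T.toFunctor.obj A ⟶ A
  unit : T.η.app A ≫ a = 𝟙 A
  assoc : T.μ.app A ≫ a = T.toFunctor.map a ≫ a

namespace StrictAlg

variable {T : TwoMonad K}

/-- The strict `T`-morphisms: the 1-cells of `T-Alg_s`. -/
@[ext]
structure Hom (X Y : T.StrictAlg) where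
  f : X.A ⟶ Y.A
  w : T.toFunctor.map f ≫ Y.a = X.a ≫ f

instance : CategoryStruct T.StrictAlg where
  Hom := Hom
  id X := ⟨𝟙 X.A, by rw [T.toFunctor.map_id, Category.id_comp, Category.comp_id]⟩
  comp {X Y Z} p q := ⟨p.f ≫ q.f, by
    rw [T.toFunctor.map_comp, Category.assoc, q.w, ← Category.assoc, p.w, Category.assoc]⟩

@[simp] lemma id_f (X : T.StrictAlg) : Hom.f (𝟙 X) = 𝟙 X.A := rfl

@[simp] lemma comp_f {X Y Z : T.StrictAlg} (p : X ⟶ Y) (q : Y ⟶ Z) :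
    Hom.f (p ≫ q) = p.f ≫ q.f := rfl

@[ext] lemma hom_ext {X Y : T.StrictAlg} {p q : X ⟶ Y} (h : p.f = q.f) : p = q := Hom.ext h

/-- The `T`-transformations `p ⟶ q` between strict `T`-morphisms `p, q : (A, a) ⟶ (B, b)`: the
2-cells `α : p ⟶ q` of `K` such that `T α` whiskered with `b` is `a` whiskered with `α`. -/
@[ext]
structure Hom₂ {X Y : T.StrictAlg} (p q : X ⟶ Y) where
  α : p.f ⟶ q.f
  w : T.map₂ α ▷ Y.a = eqToHom p.w ≫ X.a ◁ α ≫ eqToHom q.w.symm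

instance (X Y : T.StrictAlg) : Category (X ⟶ Y) where
  Hom p q := Hom₂ p q
  id p := ⟨𝟙 _, by simp [T.map₂_id]⟩
  comp φ ψ := ⟨φ.α ≫ ψ.α, by
    rw [T.map₂_comp, comp_whiskerRight, φ.w, ψ.w, whiskerLeft_comp]
    simp⟩
  id_comp φ := Hom₂.ext (Category.id_comp _)
  comp_id φ := Hom₂.ext (Category.comp_id _)
  assoc φ ψ χ := Hom₂.ext (Category.assoc _ _ _)

@[ext] lemma hom₂_ext {X Y : T.StrictAlg} {p q : X ⟶ Y} {φ ψ : p ⟶ q} (h : φ.α = ψ.α) :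
    φ = ψ := Hom₂.ext h

@[simp] lemma id_α {X Y : T.StrictAlg} (p : X ⟶ Y) : Hom₂.α (𝟙 p) = 𝟙 p.f := rfl

@[simp] lemma comp_α {X Y : T.StrictAlg} {p q r : X ⟶ Y} (φ : p ⟶ q) (ψ : q ⟶ r) :
    Hom₂.α (φ ≫ ψ) = φ.α ≫ ψ.α := rfl

@[simp] lemma eqToHom_α {X Y : T.StrictAlg} {p q : X ⟶ Y} (h : p = q) :
    Hom₂.α (eqToHom h) = eqToHom (congrArg Hom.f h) := by
  subst h; rfl

/-- Whiskering of a `T`-transformation on the left with a strict `T`-morphism. -/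
def whiskerLeft {X Y Z : T.StrictAlg} (p : X ⟶ Y) {q r : Y ⟶ Z} (φ : q ⟶ r) : p ≫ q ⟶ p ≫ r :=
  Hom₂.mk (p := p ≫ q) (q := p ≫ r) (p.f ◁ φ.α) (by
    have h₁ := comp_whiskerLeft_strict (T.toFunctor.map p.f) Y.a φ.α
    rw [eq_whiskerLeft p.w, comp_whiskerLeft_strict] at h₁
    have h₂ : T.toFunctor.map p.f ◁ Y.a ◁ φ.α = _ :=
      ((eqToHom_comp_iff _ _ _).1 ((comp_eqToHom_iff _ _ _).1 ((Category.assoc _ _ _).trans h₁.symm)))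
    rw [T.map₂_whiskerLeft, comp_whiskerRight, comp_whiskerRight, whisker_assoc_strict, φ.w,
      Bicategory.whiskerLeft_comp, Bicategory.whiskerLeft_comp, h₂]
    simp)

/-- Whiskering of a `T`-transformation on the right with a strict `T`-morphism. -/
def whiskerRight {X Y Z : T.StrictAlg} {p q : X ⟶ Y} (φ : p ⟶ q) (r : Y ⟶ Z) : p ≫ r ⟶ q ≫ r :=
  Hom₂.mk (p := p ≫ r) (q := q ≫ r) (φ.α ▷ r.f) (by
    have h₁ := whiskerRight_comp_strict (T.map₂ φ.α) (T.toFunctor.map r.f) Z.a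
    rw [eq_whiskerRight _ r.w, whiskerRight_comp_strict, φ.w, comp_whiskerRight, comp_whiskerRight,
      whisker_assoc_strict] at h₁
    have h₂ : T.map₂ φ.α ▷ T.toFunctor.map r.f ▷ Z.a = _ :=
      ((eqToHom_comp_iff _ _ _).1 ((comp_eqToHom_iff _ _ _).1 ((Category.assoc _ _ _).trans h₁.symm)))
    rw [T.map₂_whiskerRight, comp_whiskerRight, comp_whiskerRight, h₂]
    simp)

@[simp] lemma whiskerLeft_α {X Y Z : T.StrictAlg} (p : X ⟶ Y) {q r : Y ⟶ Z} (φ : q ⟶ r) :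
    Hom₂.α (whiskerLeft p φ) = p.f ◁ φ.α := rfl

@[simp] lemma whiskerRight_α {X Y Z : T.StrictAlg} {p q : X ⟶ Y} (φ : p ⟶ q) (r : Y ⟶ Z) :
    Hom₂.α (whiskerRight φ r) = φ.α ▷ r.f := rfl

/-- The 2-category `T-Alg_s` of strict `T`-algebras, strict `T`-morphisms and
`T`-transformations. -/
instance : Bicategory T.StrictAlg where
  homCategory := inferInstance
  whiskerLeft := whiskerLeft
  whiskerRight := whiskerRight
  associator p q r := eqToIso (hom_ext (Category.assoc p.f q.f r.f))
  leftUnitor p := eqToIso (hom_ext (Category.id_comp p.f))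
  rightUnitor p := eqToIso (hom_ext (Category.comp_id p.f))
  whiskerLeft_id p q := hom₂_ext (Bicategory.whiskerLeft_id _ _)
  whiskerLeft_comp p _ _ _ φ ψ := hom₂_ext (Bicategory.whiskerLeft_comp _ _ _)
  id_whiskerLeft φ := by
    refine hom₂_ext ((id_whiskerLeft_strict φ.α).trans ?_)
    simp only [eqToIso.hom, eqToIso.inv, comp_α, eqToHom_α]
  comp_whiskerLeft p q _ _ φ := by
    refine hom₂_ext ((comp_whiskerLeft_strict p.f q.f φ.α).trans ?_)
    simp only [eqToIso.hom, eqToIso.inv, comp_α, eqToHom_α, whiskerLeft_α]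
  id_whiskerRight p q := hom₂_ext (Bicategory.id_whiskerRight _ _)
  comp_whiskerRight φ ψ r := hom₂_ext (Bicategory.comp_whiskerRight _ _ _)
  whiskerRight_id φ := by
    refine hom₂_ext ((whiskerRight_id_strict φ.α).trans ?_)
    simp only [eqToIso.hom, eqToIso.inv, comp_α, eqToHom_α]
  whiskerRight_comp φ q r := by
    refine hom₂_ext ((whiskerRight_comp_strict φ.α q.f r.f).trans ?_)
    simp only [eqToIso.hom, eqToIso.inv, comp_α, eqToHom_α, whiskerRight_α]
  whisker_assoc p _ _ φ r := by
    refine hom₂_ext ((whisker_assoc_strict p.f φ.α r.f).trans ?_)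
    simp only [eqToIso.hom, eqToIso.inv, comp_α, eqToHom_α, whiskerLeft_α, whiskerRight_α]
  whisker_exchange φ ψ := hom₂_ext (Bicategory.whisker_exchange _ _)
  pentagon p q r s := by
    apply hom₂_ext
    simp only [eqToIso.hom, comp_α, eqToHom_α, whiskerLeft_α, whiskerRight_α,
      whiskerLeft_eqToHom, eqToHom_whiskerRight, eqToHom_trans]
  triangle p q := by
    apply hom₂_ext
    simp only [eqToIso.hom, comp_α, eqToHom_α, whiskerLeft_α, whiskerRight_α,
      whiskerLeft_eqToHom, eqToHom_whiskerRight, eqToHom_trans]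

instance : Bicategory.Strict T.StrictAlg where
  id_comp p := hom_ext (Category.id_comp p.f)
  comp_id p := hom_ext (Category.comp_id p.f)
  assoc p q r := hom_ext (Category.assoc p.f q.f r.f)
  leftUnitor_eqToIso _ := rfl
  rightUnitor_eqToIso _ := rfl
  associator_eqToIso _ _ _ := rfl

end StrictAlg

/-- The forgetful functor `U_s : T-Alg_s ⥤ K` on underlying ordinary categories. -/
def forget (T : TwoMonad K) : T.StrictAlg ⥤ K where
  obj X := X.A
  map p := p.f
  map_id _ := rfl
  map_comp _ _ := rfl

/-- The free algebra functor `F_s : K ⥤ T-Alg_s`, `X ↦ (T X, μ_X)`, on underlying ordinary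
categories. -/
def free (T : TwoMonad K) : K ⥤ T.StrictAlg where
  obj X := ⟨T.toFunctor.obj X, T.μ.app X, T.left_unit X, (T.assoc X).symm⟩
  map f := ⟨T.toFunctor.map f, T.μ.naturality f⟩
  map_id X := StrictAlg.hom_ext (T.toFunctor.map_id X)
  map_comp f g := StrictAlg.hom_ext (T.toFunctor.map_comp f g)

end

end TwoMonad

end TwoCat

/-!
The model structure is lifted along the free-forgetful adjunction of the 2-monad. Write `F` and `U`
for the two functors. Equivalences and isofibrations in a 2-category are detected by the
representables `K(X, -)`, and `T-Alg_s(F X, -) ≅ K(X, U -)` as categories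
(`TwoMonad.isIsoOfCategories_freeComparison`). So the proposed weak equivalences and fibrations of
`T-Alg_s` are the strict morphisms that are sent to equivalences and to isofibrations by the
representables at the free algebras. The homotopical part of the argument works for any class `S` of
test objects in a 2-category with pullbacks and cotensors by the walking isomorphism `I`, as long as
the trivial fibrations are stable under base change.

*Trivial cofibrations.* The mapping path object `L` of `f : A ⟶ B`, the pullback of `I ⋔ B ⟶ B`
along `f`, factors `f` as a section of a trivial fibration followed by a fibration
(`exists_mappingPath`), for every `f`, since every object is fibrant. It shows that a cofibration
which is a weak equivalence is a deformation retract (`exists_deformationRetraction`), that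
cofibrations lift paths along fibrations (`exists_pathLift`), and hence that the cofibrations which
are weak equivalences are exactly the morphisms with the left lifting property against the
fibrations (`llp_isofibrationsOn`). It also derives the second factorization from the first
(`hasFactorization_isofibrationsOn`). In particular no acyclicity condition for transfinite
composites has to be checked.

*Factorization into a cofibration and a trivial fibration.* The class of maps `F i` is large, as
trivial fibrations have to be surjective on all generalized elements. But a morphism is sent to
fully faithful functors by all representables as soon as this holds for a small strong generator
(`DetectsIsos.isFullyFaithful_postcomp`), so the fully faithful morphisms of algebras are
characterized by a right lifting property against a small set of maps, to which the small object
argument applies. Surjectivity is arranged beforehand by replacing `f : A ⟶ B` with the map `A ⨿ F U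
B ⟶ B` (`TwoMonad.hasFactorization_trivialFibrationsOn`).

*Limits and colimits.* A locally presentable category has limits because its continuous presheaves
are representable (`isRepresentable_of_preservesLimits`), and the same result provides cotensors in
`K`. The category of algebras is cocomplete because it is equivalent to a small-orthogonality class
in the comma category of `T` over the identity, which is cocomplete and in which the relevant
objects are presentable (`hasColimits_algebra`). Cotensors of algebras are created by `U`, and
tensors are left adjoint to cotensors, by the adjoint lifting theorem
(`TwoMonad.hasTensor_strictAlg`).

*Enrichment.* For a cofibration `i` and a fibration `p` the functor `[i, p]` is an isofibration, by
path lifting. If `i` or `p` is a weak equivalence it is surjective on objects, by lifting, and it is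
fully faithful because the functors `- ∘ i` or `p ∘ -` are: a trivial cofibration is an equivalence
in the 2-category of algebras, and a trivial fibration is fully faithful at every algebra, as the
free algebras detect isomorphisms.

The trivial fibrations and fibrations of `T-Alg_s` are the morphisms with the right lifting property
against the free maps `F i` and `F j`, by adjunction; this gives the description of the two
cofibration classes.
-/


/-! ### Comma categories over an identity functor -/

namespace TwoCat

section Comma

universe v₁ v₂ u₁ u₂

variable {A : Type u₁} [Category.{v₁} A] {B : Type u₂} [Category.{v₂} B] (L : A ⥤ B)

/-- The comma category of a functor `L` over an identity functor is cocomplete, without any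
assumption on `L`: the second component of a colimit is the colimit of the second components,
pushed out along the comparison `colim L ⟶ L colim`. -/
lemma hasColimitsOfShape_comma_id (J : Type w) [Category.{v} J] [HasColimitsOfShape J A]
    [HasColimitsOfShape J B] [HasPushouts B] : HasColimitsOfShape J (Comma L (𝟭 B)) where
  has_colimit F := by
    let F₁ : J ⥤ A := F ⋙ Comma.fst L (𝟭 B)
    let F₂ : J ⥤ B := F ⋙ Comma.snd L (𝟭 B)
    let φ : F₁ ⋙ L ⟶ F₂ := Functor.whiskerLeft F (Comma.natTrans L (𝟭 B))
    let p : colimit (F₁ ⋙ L) ⟶ L.obj (colimit F₁) := colimit.post F₁ L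
    let q : colimit (F₁ ⋙ L) ⟶ colimit F₂ := colimMap φ
    have hp (j : J) : colimit.ι (F₁ ⋙ L) j ≫ p = L.map (colimit.ι F₁ j) := colimit.ι_post F₁ L j
    have hq (j : J) : colimit.ι (F₁ ⋙ L) j ≫ q = (F.obj j).hom ≫ colimit.ι F₂ j :=
      ι_colimMap φ j
    let c : Cocone F :=
      { pt := ⟨colimit F₁, pushout p q, pushout.inl p q⟩
        ι :=
          { app j :=
              { left := colimit.ι F₁ j
                right := colimit.ι F₂ j ≫ pushout.inr p q
                w := by
                  change L.map (colimit.ι F₁ j) ≫ pushout.inl p q =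
                    (F.obj j).hom ≫ colimit.ι F₂ j ≫ pushout.inr p q
                  rw [← hp, Category.assoc, pushout.condition, ← Category.assoc, hq,
                    Category.assoc] }
            naturality j j' f := by
              ext
              · exact (colimit.w F₁ f).trans (Category.comp_id _).symm
              · refine Eq.trans ?_ (Category.comp_id _).symm
                change F₂.map f ≫ colimit.ι F₂ j' ≫ pushout.inr p q = _
                rw [← Category.assoc, colimit.w] } }
    let d₁ (s : Cocone F) : colimit F₁ ⟶ s.pt.left :=
      colimit.desc F₁ ((Comma.fst L (𝟭 B)).mapCocone s)
    let d₂ (s : Cocone F) : colimit F₂ ⟶ s.pt.right :=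
      colimit.desc F₂ ((Comma.snd L (𝟭 B)).mapCocone s)
    have hd₁ (s : Cocone F) (j : J) : colimit.ι F₁ j ≫ d₁ s = (s.ι.app j).left :=
      colimit.ι_desc ((Comma.fst L (𝟭 B)).mapCocone s) j
    have hd₂ (s : Cocone F) (j : J) : colimit.ι F₂ j ≫ d₂ s = (s.ι.app j).right :=
      colimit.ι_desc ((Comma.snd L (𝟭 B)).mapCocone s) j
    have hd (s : Cocone F) : p ≫ L.map (d₁ s) ≫ s.pt.hom = q ≫ d₂ s := by
      refine colimit.hom_ext fun j => ?_
      rw [← Category.assoc, hp, ← Category.assoc _ q, hq, Category.assoc (F.obj j).hom, hd₂,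
        ← Category.assoc, ← L.map_comp, hd₁]
      exact (s.ι.app j).w
    refine ⟨⟨c, ⟨fun s => ⟨d₁ s, pushout.desc _ _ (hd s), ?_⟩, fun s j => ?_, fun s m hm => ?_⟩⟩⟩
    · exact (pushout.inl_desc _ _ (hd s)).symm
    · ext
      · exact hd₁ s j
      · change (colimit.ι F₂ j ≫ pushout.inr p q) ≫ pushout.desc _ _ (hd s) = _
        rw [Category.assoc, pushout.inr_desc, hd₂]
    · have h₁ : m.left = d₁ s := colimit.hom_ext fun j => by
        rw [hd₁, ← hm j]; rfl
      refine CommaMorphism.ext h₁ ?_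
      · refine pushout.hom_ext ?_ (colimit.hom_ext fun j => ?_)
        · rw [pushout.inl_desc, ← h₁]
          exact m.w.symm
        · rw [pushout.inr_desc, hd₂, ← hm j]
          exact (Category.assoc _ _ _).symm

open Opposite in
/-- An object of the comma category is `κ`-presentable if its two components and the source of its
structure map are, provided that `κ`-filtered colimits are computed componentwise. -/
lemma isCardinalPresentable_comma_id (κ : Cardinal.{w}) [Fact κ.IsRegular]
    [HasColimitsOfSize.{w, w} A] [HasColimitsOfSize.{w, w} B] [L.IsCardinalAccessible κ]
    (X : Comma L (𝟭 B)) [IsCardinalPresentable X.left κ] [IsCardinalPresentable X.right κ]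
    [IsCardinalPresentable (L.obj X.left) κ] : IsCardinalPresentable X κ where
  preservesColimitOfShape J _ _ := ⟨fun {F} => ⟨fun {c} hc => ⟨by
    have := isFiltered_of_isCardinalFiltered J κ
    have := L.preservesColimitsOfShape_of_isCardinalAccessible κ J
    have h₁ : IsColimit ((Comma.fst L (𝟭 B)).mapCocone c) := isColimitOfPreserves _ hc
    have h₂ : IsColimit ((Comma.snd L (𝟭 B)).mapCocone c) := isColimitOfPreserves _ hc
    refine Types.FilteredColimit.isColimitOf' _ _ (fun f => ?_) (fun j f g h => ?_)
    · obtain ⟨j₁, f₁, hf₁⟩ := IsCardinalPresentable.exists_hom_of_isColimit κ h₁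
        (show X.left ⟶ _ from f.left)
      obtain ⟨j₂, f₂, hf₂⟩ := IsCardinalPresentable.exists_hom_of_isColimit κ h₂
        (show X.right ⟶ _ from f.right)
      let j₀ := IsFiltered.max j₁ j₂
      let g₁ : X.left ⟶ (F.obj j₀).left := f₁ ≫ (F.map (IsFiltered.leftToMax j₁ j₂)).left
      let g₂ : X.right ⟶ (F.obj j₀).right := f₂ ≫ (F.map (IsFiltered.rightToMax j₁ j₂)).right
      have hg₁ : g₁ ≫ (c.ι.app j₀).left = f.left := by
        refine Eq.trans ?_ hf₁
        change (f₁ ≫ _) ≫ _ = f₁ ≫ (c.ι.app j₁).left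
        rw [Category.assoc, ← Comma.comp_left, c.w]
      have hg₂ : g₂ ≫ (c.ι.app j₀).right = f.right := by
        refine Eq.trans ?_ hf₂
        change (f₂ ≫ _) ≫ _ = f₂ ≫ (c.ι.app j₂).right
        rw [Category.assoc, ← Comma.comp_right, c.w]
      obtain ⟨j, u, hu⟩ := IsCardinalPresentable.exists_eq_of_isColimit' κ h₂
        (show L.obj X.left ⟶ (F.obj j₀).right from L.map g₁ ≫ (F.obj j₀).hom)
        (show L.obj X.left ⟶ (F.obj j₀).right from X.hom ≫ g₂) (by
          change (L.map g₁ ≫ (F.obj j₀).hom) ≫ (c.ι.app j₀).right =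
            (X.hom ≫ g₂) ≫ (c.ι.app j₀).right
          have e₁ : (F.obj j₀).hom ≫ (c.ι.app j₀).right = L.map (c.ι.app j₀).left ≫ c.pt.hom :=
            (c.ι.app j₀).w.symm
          have e₂ : L.map f.left ≫ c.pt.hom = X.hom ≫ f.right := f.w
          rw [Category.assoc, e₁, ← Category.assoc, ← L.map_comp, hg₁, e₂, Category.assoc, hg₂])
      refine ⟨j, ⟨g₁ ≫ (F.map u).left, g₂ ≫ (F.map u).right, ?_⟩, ?_⟩
      · have e₁ : (F.obj j₀).hom ≫ (F.map u).right = L.map (F.map u).left ≫ (F.obj j).hom :=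
          (F.map u).w.symm
        have e₂ : (L.map g₁ ≫ (F.obj j₀).hom) ≫ (F.map u).right =
          (X.hom ≫ g₂) ≫ (F.map u).right := hu
        change L.map (g₁ ≫ (F.map u).left) ≫ (F.obj j).hom = X.hom ≫ g₂ ≫ (F.map u).right
        rw [L.map_comp, Category.assoc, ← e₁, ← Category.assoc, e₂, Category.assoc]
      · refine CommaMorphism.ext ?_ ?_
        · change f.left = (g₁ ≫ (F.map u).left) ≫ (c.ι.app j).left
          rw [Category.assoc, ← Comma.comp_left, c.w, hg₁]
        · change f.right = (g₂ ≫ (F.map u).right) ≫ (c.ι.app j).right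
          rw [Category.assoc, ← Comma.comp_right, c.w, hg₂]
    · obtain ⟨j₁, u₁, hu₁⟩ := IsCardinalPresentable.exists_eq_of_isColimit' κ h₁
        (show X.left ⟶ (F.obj j).left from f.left) (show X.left ⟶ (F.obj j).left from g.left)
        (congrArg CommaMorphism.left h)
      obtain ⟨j₂, u₂, hu₂⟩ := IsCardinalPresentable.exists_eq_of_isColimit' κ h₂
        (show X.right ⟶ (F.obj j).right from f.right) (show X.right ⟶ (F.obj j).right from g.right)
        (congrArg CommaMorphism.right h)
      obtain ⟨k, w₁, w₂, hw⟩ := IsFiltered.span u₁ u₂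
      refine ⟨k, u₁ ≫ w₁, CommaMorphism.ext ?_ ?_⟩
      · change f.left ≫ (F.map (u₁ ≫ w₁)).left = g.left ≫ (F.map (u₁ ≫ w₁)).left
        have e : f.left ≫ (F.map u₁).left = g.left ≫ (F.map u₁).left := hu₁
        rw [F.map_comp, Comma.comp_left, ← Category.assoc, e, Category.assoc]
      · change f.right ≫ (F.map (u₁ ≫ w₁)).right = g.right ≫ (F.map (u₁ ≫ w₁)).right
        have e : f.right ≫ (F.map u₂).right = g.right ≫ (F.map u₂).right := hu₂
        rw [hw, F.map_comp, Comma.comp_right, ← Category.assoc, e, Category.assoc]⟩⟩⟩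

end Comma

end TwoCat

/-! ### Cocompleteness of the category of algebras -/

namespace TwoCat

section Presentable

variable {C : Type u} [Category.{v} C]

/-- In a locally presentable category a small family of objects is uniformly presentable, for
arbitrarily large regular cardinals. -/
lemma exists_isCardinalPresentable_family [IsLocallyPresentable.{w} C] {ι : Type*} [Small.{w} ι]
    (X : ι → C) (κ : Cardinal.{w}) :
    ∃ (κ' : Cardinal.{w}) (_ : Fact κ'.IsRegular), κ ≤ κ' ∧
      ∀ i, IsCardinalPresentable (X i) κ' := by
  have hX (i : ι) : ∃ (c : Cardinal.{w}) (_ : Fact c.IsRegular), IsCardinalPresentable (X i) c := by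
    have : IsPresentable.{w} (X i) := inferInstance
    exact this.exists_cardinal
  choose c hc hX using hX
  obtain ⟨κ', h₁, h₂⟩ := HasCardinalLT.exists_regular_cardinal_forall.{w}
    (Sum.elim (fun i : ι => (c i).ord.ToType) (fun _ : Unit => κ.ord.ToType))
  have : Fact κ'.IsRegular := ⟨h₁⟩
  refine ⟨κ', ⟨h₁⟩, ?_, fun i => ?_⟩
  · exact le_of_lt (by simpa [hasCardinalLT_iff_cardinal_mk_lt] using h₂ (Sum.inr ⟨⟩))
  · have h : c i ≤ κ' :=
      le_of_lt (by simpa [hasCardinalLT_iff_cardinal_mk_lt] using h₂ (Sum.inl i))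
    exact isCardinalPresentable_of_le (X i) h

end Presentable

section MonadAlgebras

variable {C : Type u} [Category.{v} C] (T : Monad C)

/-- The functor sending a `T`-algebra `a : T A ⟶ A` to the object `(A, A, a)` of the comma category
of `T` over the identity. -/
abbrev algebraToComma : T.Algebra ⥤ Comma T.toFunctor (𝟭 C) where
  obj A := ⟨A.A, A.A, A.a⟩
  map f := ⟨f.f, f.f, f.h⟩

variable {T} in
lemma algebra_right_eq_left {A B : T.Algebra} {l r : A.A ⟶ B.A}
    (w : T.toFunctor.map l ≫ B.a = A.a ≫ r) : r = l := by
  have n : l ≫ T.η.app B.A = T.η.app A.A ≫ T.toFunctor.map l := T.η.naturality l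
  rw [← Category.id_comp r, ← A.unit, Category.assoc, ← w, ← Category.assoc, ← n,
    Category.assoc, B.unit, Category.comp_id]

/-- A morphism `(A, A, a) ⟶ (B, B, b)` has equal components, by the unit axioms. -/
def algebraToCommaFullyFaithful : (algebraToComma T).FullyFaithful where
  preimage {A _} f :=
    { f := f.left
      h := f.w.trans (congrArg (A.a ≫ ·) (algebra_right_eq_left f.w)) }
  map_preimage f := CommaMorphism.ext rfl (algebra_right_eq_left f.w).symm
  preimage_map _ := rfl

variable {T} in
/-- The canonical map `A ⟶ Y` underlying an object `ψ : T A ⟶ Y` of the comma category of `T` over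
the identity. -/
def commaUnit (E : Comma T.toFunctor (𝟭 C)) : E.left ⟶ E.right :=
  T.η.app E.left ≫ E.hom

/-- The object `T G = T G` of the comma category of `T` over the identity; it corepresents
`E ↦ Hom(G, E.left)`. -/
abbrev commaFree (G : C) : Comma T.toFunctor (𝟭 C) := ⟨G, T.toFunctor.obj G, 𝟙 _⟩

variable {T} in
/-- The morphism out of `commaFree T G` corresponding to `x : G ⟶ E.left`. -/
abbrev commaFreeLift {G : C} {E : Comma T.toFunctor (𝟭 C)} (x : G ⟶ E.left) : commaFree T G ⟶ E :=
  ⟨x, T.toFunctor.map x ≫ E.hom, (Category.id_comp _).symm⟩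

lemma η_commaFreeLift_right {G : C} {E : Comma T.toFunctor (𝟭 C)} (x : G ⟶ E.left) :
    T.η.app G ≫ T.toFunctor.map x ≫ E.hom = x ≫ commaUnit E := by
  have n : x ≫ T.η.app E.left = T.η.app G ≫ T.toFunctor.map x := T.η.naturality x
  rw [commaUnit, ← Category.assoc, ← n, Category.assoc]

lemma commaUnit_algebraToComma (A : T.Algebra) :
    commaUnit ((algebraToComma T).obj A) = 𝟙 A.A := A.unit

section UnitMaps

variable [HasInitial C] [HasBinaryCoproducts C]

/-- The object of the comma category of `T` over the identity which corepresents
`E ↦ Hom(G, E.right)`. -/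
noncomputable abbrev commaCofree (G : C) : Comma T.toFunctor (𝟭 C) :=
  ⟨⊥_ C, T.toFunctor.obj (⊥_ C) ⨿ G, coprod.inl⟩

/-- The morphism which induces `commaUnit E ∘ - : Hom(G, E.left) → Hom(G, E.right)`. -/
noncomputable def commaUnitMap (G : C) : commaCofree T G ⟶ commaFree T G :=
  ⟨initial.to G, coprod.desc (T.toFunctor.map (initial.to G)) (T.η.app G),
    (Category.comp_id _).trans (coprod.inl_desc _ _).symm⟩

variable {T} in
/-- Locality with respect to `commaUnitMap T G` says that `commaUnit E` is bijective on
`G`-elements. -/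
lemma bijective_comp_commaUnit {G : C} {E : Comma T.toFunctor (𝟭 C)}
    (h : Function.Bijective (fun g : commaFree T G ⟶ E => commaUnitMap T G ≫ g)) :
    Function.Bijective (fun x : G ⟶ E.left => x ≫ commaUnit E) := by
  constructor
  · intro x y hxy
    have e : commaFreeLift x = commaFreeLift y := h.1 (by
      refine CommaMorphism.ext (Subsingleton.elim _ _) ?_
      change coprod.desc _ _ ≫ T.toFunctor.map x ≫ E.hom =
        coprod.desc _ _ ≫ T.toFunctor.map y ≫ E.hom
      refine coprod.hom_ext ?_ ?_
      · rw [← Category.assoc, ← Category.assoc, ← Category.assoc, ← Category.assoc,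
          coprod.inl_desc, ← T.toFunctor.map_comp, ← T.toFunctor.map_comp]
        congr 2
        exact Subsingleton.elim _ _
      · rw [← Category.assoc, ← Category.assoc (coprod.inr), coprod.inr_desc,
          η_commaFreeLift_right, η_commaFreeLift_right]
        exact hxy)
    exact congrArg CommaMorphism.left e
  · intro y
    let g : commaCofree T G ⟶ E :=
      ⟨initial.to _, coprod.desc (T.toFunctor.map (initial.to _) ≫ E.hom) y,
        (coprod.inl_desc _ _).symm⟩
    obtain ⟨k, hk⟩ := h.2 g
    refine ⟨k.left, ?_⟩
    have hw : T.toFunctor.map k.left ≫ E.hom = k.right := k.w.trans (Category.id_comp _)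
    have hr : (commaUnitMap T G).right ≫ k.right = g.right := congrArg CommaMorphism.right hk
    change k.left ≫ commaUnit E = y
    rw [← η_commaFreeLift_right, hw]
    have h₂ : coprod.inr ≫ (commaUnitMap T G).right = T.η.app G := coprod.inr_desc _ _
    rw [← h₂, Category.assoc, hr]
    exact coprod.inr_desc _ _

/-- Algebras are local with respect to `commaUnitMap T G`. -/
lemma bijective_commaUnitMap_comp (G : C) (A : T.Algebra) :
    Function.Bijective
      (fun g : commaFree T G ⟶ (algebraToComma T).obj A => commaUnitMap T G ≫ g) := by
  have key (k : commaFree T G ⟶ (algebraToComma T).obj A) :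
      coprod.inr ≫ (commaUnitMap T G).right ≫ k.right = k.left := by
    have hw : T.toFunctor.map k.left ≫ ((algebraToComma T).obj A).hom = k.right :=
      k.w.trans (Category.id_comp _)
    have h₂ : coprod.inr ≫ (commaUnitMap T G).right = T.η.app G := coprod.inr_desc _ _
    rw [← Category.assoc, h₂, ← hw, η_commaFreeLift_right, commaUnit_algebraToComma]
    exact Category.comp_id _
  constructor
  · intro k k' h
    have h' : (commaUnitMap T G).right ≫ k.right = (commaUnitMap T G).right ≫ k'.right :=
      congrArg CommaMorphism.right h
    have hl : k.left = k'.left := by rw [← key k, ← key k', h']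
    refine CommaMorphism.ext hl ?_
    have hw := k.w.trans (Category.id_comp _)
    have hw' := k'.w.trans (Category.id_comp _)
    exact hw.symm.trans ((by rw [hl] : _ = _).trans hw')
  · intro g
    let x : G ⟶ A.A := coprod.inr ≫ g.right
    refine ⟨commaFreeLift (E := (algebraToComma T).obj A) x,
      CommaMorphism.ext (Subsingleton.elim _ _) ?_⟩
    have hw : T.toFunctor.map g.left ≫ A.a = coprod.inl ≫ g.right := g.w
    change coprod.desc _ _ ≫ T.toFunctor.map x ≫ A.a = g.right
    refine coprod.hom_ext ?_ ?_
    · rw [← Category.assoc, coprod.inl_desc, ← Category.assoc, ← T.toFunctor.map_comp]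
      refine Eq.trans ?_ hw
      congr 2
      exact Subsingleton.elim _ _
    · rw [← Category.assoc, coprod.inr_desc]
      have := η_commaFreeLift_right T (E := (algebraToComma T).obj A) x
      rw [commaUnit_algebraToComma] at this
      exact this.trans (Category.comp_id _)

end UnitMaps

section AssocMaps

variable [HasBinaryCoproducts C] [HasCoequalizers C]

/-- The object of the comma category of `T` over the identity which corepresents the pairs of
`g : G ⟶ E.left` and `h : T G ⟶ E.left` with `h ≫ commaUnit E = T g ≫ E.hom`. -/
noncomputable abbrev commaPre (G : C) : Comma T.toFunctor (𝟭 C) :=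
  ⟨G ⨿ T.toFunctor.obj G, coequalizer (T.toFunctor.map (coprod.inl : G ⟶ G ⨿ T.toFunctor.obj G))
    (coprod.inr ≫ T.η.app (G ⨿ T.toFunctor.obj G)), coequalizer.π _ _⟩

/-- The quotient of `commaPre T G` by the associativity relation
`T h ≫ E.hom = μ_G ≫ T g ≫ E.hom`. -/
noncomputable abbrev commaAssoc (G : C) : Comma T.toFunctor (𝟭 C) :=
  ⟨G ⨿ T.toFunctor.obj G, coequalizer (T.toFunctor.map coprod.inr ≫ (commaPre T G).hom)
    (T.μ.app G ≫ T.toFunctor.map coprod.inl ≫ (commaPre T G).hom),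
    (commaPre T G).hom ≫ coequalizer.π _ _⟩

/-- The quotient map which imposes associativity. -/
noncomputable def commaAssocMap (G : C) : commaPre T G ⟶ commaAssoc T G :=
  ⟨𝟙 _, coequalizer.π _ _, by
    change T.toFunctor.map (𝟙 _) ≫ _ = _
    rw [T.toFunctor.map_id, Category.id_comp]
    rfl⟩

variable {T} in
/-- Locality with respect to `commaAssocMap T G` gives associativity on `G`-elements. -/
lemma assoc_of_bijective_comp {G : C} {E : Comma T.toFunctor (𝟭 C)}
    (hE : Function.Bijective (fun k : commaAssoc T G ⟶ E => commaAssocMap T G ≫ k))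
    (g : G ⟶ E.left) (h : T.toFunctor.obj G ⟶ E.left)
    (hgh : h ≫ commaUnit E = T.toFunctor.map g ≫ E.hom) :
    T.toFunctor.map h ≫ E.hom = T.μ.app G ≫ T.toFunctor.map g ≫ E.hom := by
  have n : coprod.desc g h ≫ T.η.app E.left = T.η.app _ ≫ T.toFunctor.map (coprod.desc g h) :=
    T.η.naturality _
  let m : commaPre T G ⟶ E :=
    ⟨coprod.desc g h, coequalizer.desc (T.toFunctor.map (coprod.desc g h) ≫ E.hom) (by
      rw [← Category.assoc, ← T.toFunctor.map_comp, coprod.inl_desc, ← hgh, Category.assoc,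
        ← Category.assoc (T.η.app _), ← n, ← Category.assoc, ← Category.assoc, coprod.inr_desc,
        Category.assoc, commaUnit]), (coequalizer.π_desc _ _).symm⟩
  obtain ⟨k, hk⟩ := hE.2 m
  have hr : coequalizer.π _ _ ≫ k.right = m.right := congrArg CommaMorphism.right hk
  have hm : (commaPre T G).hom ≫ m.right = T.toFunctor.map (coprod.desc g h) ≫ E.hom := m.w.symm
  have c := coequalizer.condition (T.toFunctor.map coprod.inr ≫ (commaPre T G).hom)
    (T.μ.app G ≫ T.toFunctor.map coprod.inl ≫ (commaPre T G).hom)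
  have c' := congrArg (· ≫ k.right) c
  simp only [Category.assoc] at c'
  rw [hr, hm, ← Category.assoc, ← T.toFunctor.map_comp, coprod.inr_desc,
    ← Category.assoc (T.toFunctor.map coprod.inl), ← T.toFunctor.map_comp, coprod.inl_desc] at c'
  exact c'

/-- Algebras are local with respect to `commaAssocMap T G`. -/
lemma bijective_commaAssocMap_comp (G : C) (A : T.Algebra) :
    Function.Bijective
      (fun k : commaAssoc T G ⟶ (algebraToComma T).obj A => commaAssocMap T G ≫ k) := by
  constructor
  · intro k k' h
    refine CommaMorphism.ext ?_ (coequalizer.hom_ext ?_)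
    · have : 𝟙 _ ≫ k.left = 𝟙 _ ≫ k'.left := congrArg CommaMorphism.left h
      rwa [Category.id_comp, Category.id_comp] at this
    · exact congrArg CommaMorphism.right h
  · intro m
    let g : G ⟶ A.A := coprod.inl ≫ m.left
    let h : T.toFunctor.obj G ⟶ A.A := coprod.inr ≫ m.left
    have hm : T.toFunctor.map m.left ≫ A.a = (commaPre T G).hom ≫ m.right := m.w
    have n : m.left ≫ T.η.app A.A =
        T.η.app (G ⨿ T.toFunctor.obj G) ≫ T.toFunctor.map m.left := T.η.naturality m.left
    have hgh : h = T.toFunctor.map g ≫ A.a := by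
      have c := congrArg (· ≫ m.right) (coequalizer.condition
        (T.toFunctor.map (coprod.inl : G ⟶ G ⨿ T.toFunctor.obj G))
        (coprod.inr ≫ T.η.app (G ⨿ T.toFunctor.obj G)))
      simp only [Category.assoc] at c
      have c' : T.toFunctor.map coprod.inl ≫ T.toFunctor.map m.left ≫ A.a =
          coprod.inr ≫ T.η.app (G ⨿ T.toFunctor.obj G) ≫ T.toFunctor.map m.left ≫ A.a := by
        rw [hm]; exact c
      rw [← Category.assoc (T.η.app _), ← n, Category.assoc, A.unit, Category.comp_id,
        ← Category.assoc, ← T.toFunctor.map_comp] at c'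
      exact c'.symm
    have hμ : T.μ.app G ≫ T.toFunctor.map g = T.toFunctor.map (T.toFunctor.map g) ≫ T.μ.app A.A :=
      (T.μ.naturality g).symm
    have key : T.toFunctor.map h ≫ A.a = T.μ.app G ≫ T.toFunctor.map g ≫ A.a := by
      rw [hgh, T.toFunctor.map_comp, Category.assoc, ← A.assoc, ← Category.assoc, ← hμ,
        Category.assoc]
    have key' : (T.toFunctor.map coprod.inr ≫ (commaPre T G).hom) ≫ m.right =
        (T.μ.app G ≫ T.toFunctor.map coprod.inl ≫ (commaPre T G).hom) ≫ m.right := by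
      simp only [Category.assoc]
      refine (congrArg (T.toFunctor.map coprod.inr ≫ ·) hm.symm).trans (Eq.trans ?_
        (congrArg (fun z => T.μ.app G ≫ T.toFunctor.map coprod.inl ≫ z) hm))
      simp only [← Category.assoc, ← T.toFunctor.map_comp] at key ⊢
      simpa only [Category.assoc, ← T.toFunctor.map_comp] using key
    refine ⟨⟨m.left, coequalizer.desc m.right key', ?_⟩, ?_⟩
    · change T.toFunctor.map m.left ≫ A.a =
        ((commaPre T G).hom ≫ coequalizer.π _ _) ≫ coequalizer.desc m.right key'
      rw [Category.assoc, coequalizer.π_desc]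
      exact hm
    · exact CommaMorphism.ext (Category.id_comp _) (coequalizer.π_desc _ _)

end AssocMaps

section Reflection

variable [HasColimits C]

/-- The morphisms of the comma category of `T` over the identity at which an object has to be local
in order to be an algebra, for elements of shape `G` in a class `P`. -/
noncomputable def algebraMaps (P : ObjectProperty C) : MorphismProperty (Comma T.toFunctor (𝟭 C)) :=
  MorphismProperty.ofHoms (fun G : Subtype P => commaUnitMap T G.1) ⊔
    MorphismProperty.ofHoms (fun G : Subtype P => commaAssocMap T G.1)

/-- Algebras are local with respect to `algebraMaps T P`. -/
lemma isLocal_algebraToComma (P : ObjectProperty C) (A : T.Algebra) :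
    (algebraMaps T P).isLocal ((algebraToComma T).obj A) := by
  rintro _ _ _ (h | h)
  · obtain ⟨G⟩ := h
    exact bijective_commaUnitMap_comp T G.1 A
  · obtain ⟨G⟩ := h
    exact bijective_commaAssocMap_comp T G.1 A

/-- If `P` generates under `κ`-filtered colimits and these are preserved by `T`, then every local
object is an algebra: locality makes the unit map invertible, and associativity can be checked on
the elements of shape `G` of the carrier. -/
lemma essImage_algebraToComma_of_isLocal {P : ObjectProperty C} {κ : Cardinal.{v}}
    [Fact κ.IsRegular] (hP : P.IsCardinalFilteredGenerator κ) [T.toFunctor.IsCardinalAccessible κ]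
    (E : Comma T.toFunctor (𝟭 C)) (hE : (algebraMaps T P).isLocal E) :
    ∃ A : T.Algebra, Nonempty ((algebraToComma T).obj A ≅ E) := by
  have hu (G : C) (hG : P G) := bijective_comp_commaUnit (hE _ (Or.inl (.mk (⟨G, hG⟩ : Subtype P))))
  have ha (G : C) (hG : P G) := assoc_of_bijective_comp (hE _ (Or.inr (.mk (⟨G, hG⟩ : Subtype P))))
  have hgen := ObjectProperty.isStrongGenerator_iff.1 hP.isStrongGenerator
  have : Mono (commaUnit E) := ⟨fun f g h => hgen.1 _ _ fun G hG k => (hu G hG).1 (by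
    simp only [Category.assoc, h])⟩
  have : IsIso (commaUnit E) := hgen.2 _ fun G hG => (hu G hG).2
  let a : T.toFunctor.obj E.left ⟶ E.left := E.hom ≫ inv (commaUnit E)
  have hau : a ≫ commaUnit E = E.hom := by simp [a]
  refine ⟨⟨E.left, a, ?_, ?_⟩, ⟨Comma.isoMk (Iso.refl _) (asIso (commaUnit E)) ?_⟩⟩
  · change T.η.app E.left ≫ E.hom ≫ _ = _
    rw [← Category.assoc]
    exact IsIso.hom_inv_id (commaUnit E)
  · obtain ⟨J, _, _, ⟨p⟩⟩ := hP.exists_colimitsOfShape E.left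
    have := T.toFunctor.preservesColimitsOfShape_of_isCardinalAccessible κ J
    refine (isColimitOfPreserves (T.toFunctor ⋙ T.toFunctor) p.isColimit).hom_ext fun j => ?_
    let g : p.diag.obj j ⟶ E.left := p.ι.app j
    change T.toFunctor.map (T.toFunctor.map g) ≫ T.μ.app _ ≫ E.hom ≫ inv (commaUnit E) =
      T.toFunctor.map (T.toFunctor.map g) ≫ T.toFunctor.map a ≫ E.hom ≫ inv (commaUnit E)
    have hμ : T.toFunctor.map (T.toFunctor.map g) ≫ T.μ.app _ = T.μ.app _ ≫ T.toFunctor.map g :=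
      T.μ.naturality g
    have key := ha _ (p.prop_diag_obj j) g (T.toFunctor.map g ≫ a) (by rw [Category.assoc, hau])
    rw [T.toFunctor.map_comp, Category.assoc] at key
    rw [← Category.assoc, hμ, Category.assoc, ← Category.assoc (T.toFunctor.map g),
      ← Category.assoc (T.μ.app _), ← key]
    simp only [Category.assoc]
  · change T.toFunctor.map (𝟙 _) ≫ E.hom = a ≫ commaUnit E
    rw [hau, T.toFunctor.map_id, Category.id_comp]

/-- The algebras of an accessible monad on a locally presentable category form a cocomplete
category: they are an orthogonality class in the comma category of the monad over the identity. -/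
theorem hasColimits_algebra [IsLocallyPresentable.{v} C] [T.toFunctor.IsAccessible.{v}] :
    HasColimits T.Algebra := by
  obtain ⟨κ₁, _, _⟩ := IsLocallyPresentable.exists_cardinal.{v} C
  obtain ⟨κ₂, _, _⟩ := Functor.IsAccessible.exists_cardinal (F := T.toFunctor)
  obtain ⟨κ, _, h₁, h₂⟩ : ∃ (κ : Cardinal.{v}) (_ : Fact κ.IsRegular), κ₁ ≤ κ ∧ κ₂ ≤ κ := by
    rcases le_total κ₁ κ₂ with h | h
    · exact ⟨κ₂, inferInstance, h, le_rfl⟩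
    · exact ⟨κ₁, inferInstance, le_rfl, h⟩
  have : IsCardinalLocallyPresentable C κ := IsCardinalLocallyPresentable.of_le C h₁
  have : T.toFunctor.IsCardinalAccessible κ := T.toFunctor.isCardinalAccessible_of_le h₂
  obtain ⟨P, _, hP⟩ := HasCardinalFilteredGenerator.exists_small_generator C κ
  have : HasColimits (Comma T.toFunctor (𝟭 C)) := ⟨fun J _ => hasColimitsOfShape_comma_id _ J⟩
  -- a regular cardinal for which the sources and targets of `algebraMaps T P` are presentable
  let D : Subtype P × Fin 4 → Comma T.toFunctor (𝟭 C) := fun i =>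
    ![commaCofree T i.1.1, commaFree T i.1.1, commaPre T i.1.1, commaAssoc T i.1.1] i.2
  obtain ⟨κ', _, h', hX⟩ := exists_isCardinalPresentable_family.{v}
    (fun k : (Subtype P × Fin 4) × Fin 3 =>
      ![(D k.1).left, (D k.1).right, T.toFunctor.obj (D k.1).left] k.2) κ
  have : T.toFunctor.IsCardinalAccessible κ' := T.toFunctor.isCardinalAccessible_of_le h'
  have hD (i) : IsCardinalPresentable (D i) κ' := by
    have : IsCardinalPresentable (D i).left κ' := hX (i, 0)
    have : IsCardinalPresentable (D i).right κ' := hX (i, 1)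
    have : IsCardinalPresentable (T.toFunctor.obj (D i).left) κ' := hX (i, 2)
    exact isCardinalPresentable_comma_id _ κ' _
  let W := algebraMaps T P
  have : MorphismProperty.IsSmall.{v} W := by
    have : MorphismProperty.IsSmall.{v} (⨆ b : Bool, cond b
        (MorphismProperty.ofHoms (fun G : Subtype P => commaUnitMap T G.1))
        (MorphismProperty.ofHoms (fun G : Subtype P => commaAssocMap T G.1))) := by
      have (b : Bool) : MorphismProperty.IsSmall.{v} (cond b
          (MorphismProperty.ofHoms (fun G : Subtype P => commaUnitMap T G.1))
          (MorphismProperty.ofHoms (fun G : Subtype P => commaAssocMap T G.1))) := by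
        cases b <;> dsimp <;> infer_instance
      infer_instance
    rwa [iSup_bool_eq] at this
  have hW : ∀ ⦃X Y : Comma T.toFunctor (𝟭 C)⦄ (f : X ⟶ Y), W f →
      IsCardinalPresentable X κ' ∧ IsCardinalPresentable Y κ' := by
    rintro _ _ _ (h | h)
    · obtain ⟨G⟩ := h
      exact ⟨hD (G, 0), hD (G, 1)⟩
    · obtain ⟨G⟩ := h
      exact ⟨hD (G, 2), hD (G, 3)⟩
  have := W.isRightAdjoint_ι_isLocal κ' hW
  let R : T.Algebra ⥤ W.isLocal.FullSubcategory :=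
    W.isLocal.lift (algebraToComma T) (isLocal_algebraToComma T P)
  have : R.EssSurj := ⟨fun E => by
    obtain ⟨A, ⟨e⟩⟩ := essImage_algebraToComma_of_isLocal T hP E.1 E.2
    exact ⟨A, ⟨W.isLocal.ι.preimageIso e⟩⟩⟩
  have : (algebraToComma T).Full := (algebraToCommaFullyFaithful T).full
  have : (algebraToComma T).Faithful := (algebraToCommaFullyFaithful T).faithful
  have : R.IsEquivalence := { }
  let : Reflective W.isLocal.ι := ⟨_, Adjunction.ofIsRightAdjoint _⟩
  have : HasColimits W.isLocal.FullSubcategory := hasColimits_of_reflective W.isLocal.ι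
  exact Adjunction.has_colimits_of_equivalence R

end Reflection

end MonadAlgebras

end TwoCat

/-! ### Representable presheaves and limits in locally presentable categories -/

namespace TwoCat

section AdjointFunctorTheorem

open Opposite

variable {C : Type u} [Category.{v} C] [IsLocallyPresentable.{v} C]

/-- On a locally presentable category every continuous presheaf is representable. Its elements over
a small dense family form a small category whose limit, in the category of all elements, is weakly
initial. -/
theorem isRepresentable_of_preservesLimits (F : Cᵒᵖ ⥤ Type v) [PreservesLimits F] :
    F.IsRepresentable := by
  obtain ⟨κ, _, _⟩ := IsLocallyPresentable.exists_cardinal.{v} C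
  obtain ⟨P, _, hP⟩ := HasCardinalFilteredGenerator.exists_small_generator C κ
  let S : ObjectProperty F.Elements := fun e => P e.1.unop
  have : Small.{v} S.FullSubcategory := by
    let f : S.FullSubcategory → Σ G : Subtype P, F.obj (op G.1) :=
      fun e => ⟨⟨e.1.1.unop, e.2⟩, e.1.2⟩
    refine small_of_injective (f := f) ?_
    rintro ⟨⟨⟨X⟩, x⟩, hX⟩ ⟨⟨⟨Y⟩, y⟩, hY⟩ h
    obtain ⟨h₁, h₂⟩ := Sigma.mk.inj h
    obtain rfl : X = Y := congrArg Subtype.val h₁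
    obtain rfl := eq_of_heq h₂
    rfl
  have := essentiallySmall_of_small_of_locallySmall.{v} S.FullSubcategory
  have : HasLimitsOfShape S.FullSubcategory F.Elements :=
    hasLimitsOfShape_of_equivalence (equivSmallModel.{v} S.FullSubcategory).symm
  let Z : F.Elements := limit S.ι
  have hZ (e : F.Elements) : Nonempty (Z ⟶ e) := by
    obtain ⟨⟨X⟩, x⟩ := e
    obtain ⟨J, _, _, ⟨p⟩⟩ := hP.exists_colimitsOfShape X
    let s (j : J) : S.FullSubcategory := ⟨⟨op (p.diag.obj j), F.map (p.ι.app j).op x⟩,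
      p.prop_diag_obj j⟩
    let t {j j' : J} (f : j ⟶ j') : s j' ⟶ s j := ObjectProperty.homMk ⟨(p.diag.map f).op, by
      have e : p.diag.map f ≫ p.ι.app j' = p.ι.app j :=
        (p.ι.naturality f).trans (Category.comp_id _)
      change F.map (p.diag.map f).op (F.map (p.ι.app j').op x) = F.map (p.ι.app j).op x
      rw [← e, op_comp, F.map_comp]
      rfl⟩
    let c : Cocone p.diag :=
      { pt := Z.1.unop
        ι :=
          { app j := (limit.π S.ι (s j)).1.unop
            naturality j j' f := by
              have h := congrArg (fun g => g.1.unop) (limit.w S.ι (t f))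
              exact h.trans (Category.comp_id _).symm } }
    refine ⟨⟨(p.isColimit.desc c).op, ?_⟩⟩
    refine Concrete.isLimit_ext _ (isLimitOfPreserves F p.isColimit.op) _ _ fun j => ?_
    change F.map (p.ι.app j.unop).op (F.map (p.isColimit.desc c).op Z.2) =
      F.map (p.ι.app j.unop).op x
    have h : F.map (c.ι.app j.unop).op Z.2 = F.map (p.ι.app j.unop).op x :=
      (limit.π S.ι (s j.unop)).2
    have hf : p.ι.app j.unop ≫ p.isColimit.desc c = c.ι.app j.unop := p.isColimit.fac c j.unop
    rw [← h, ← hf, op_comp, F.map_comp]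
    rfl
  have := hasInitial_of_weakly_initial_and_hasWideEqualizers hZ
  exact Functor.Elements.isRepresentable_of_hasInitial F

/-- The adjoint functor theorem for locally presentable categories: cocontinuous functors are left
adjoints. -/
theorem isLeftAdjoint_of_preservesColimits {D : Type w} [Category.{v} D] (F : C ⥤ D)
    [PreservesColimits F] : F.IsLeftAdjoint := by
  rw [Functor.isLeftAdjoint_iff_rightAdjointObjIsDefined_eq_top]
  ext X
  have := preservesLimitsOfSize_op.{v, v} F
  have := isRepresentable_of_preservesLimits (F.op ⋙ CategoryTheory.yoneda.obj X)
  simpa using! this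

theorem hasLimits_of_isLocallyPresentable : HasLimits C :=
  ⟨fun J _ => by
    have := isLeftAdjoint_of_preservesColimits (Functor.const J : C ⥤ J ⥤ C)
    exact hasLimitsOfShape_iff_isLeftAdjoint_const.2 this⟩

end AdjointFunctorTheorem

end TwoCat

/-! ### Functors defined by lifting properties -/

namespace TwoCat

universe v₁ v₂ v₃ v₄ u₁ u₂ u₃ u₄

section Cat

variable {A : Type u₁} [Category.{v₁} A] {B : Type u₂} [Category.{v₂} B]
  {C : Type u₃} [Category.{v₃} C] {J : Type u₄} [Category.{v₄} J]

lemma IsIsoOfCategories.of_inverse {F : A ⥤ B} (G : B ⥤ A) (h : F ⋙ G = 𝟭 A) (h' : G ⋙ F = 𝟭 B) :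
    IsIsoOfCategories F := by
  have : F.IsEquivalence :=
    (CategoryTheory.Equivalence.mk F G (eqToIso h.symm) (eqToIso h')).isEquivalence_functor
  refine ⟨inferInstance, inferInstance, ?_⟩
  exact Function.bijective_iff_has_inverse.2
    ⟨G.obj, Functor.congr_obj h, Functor.congr_obj h'⟩

lemma IsIsoOfCategories.comp {F : A ⥤ B} {G : B ⥤ C} (hF : IsIsoOfCategories F)
    (hG : IsIsoOfCategories G) : IsIsoOfCategories (F ⋙ G) := by
  obtain ⟨_, _, h⟩ := hF
  obtain ⟨_, _, h'⟩ := hG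
  exact ⟨inferInstance, inferInstance, h'.comp h⟩

lemma IsIsoOfCategories.bijective_comp {F : A ⥤ B} (hF : IsIsoOfCategories F)
    (J : Type u₄) [Category.{v₄} J] : Function.Bijective (fun W : J ⥤ A => W ⋙ F) := by
  obtain ⟨_, _, hinj, hsurj⟩ := hF
  refine ⟨fun W W' h => ?_, fun V => ?_⟩
  · refine Functor.hext (fun j => hinj (Functor.congr_obj h j)) (fun i j f => ?_)
    have e (j : J) : W.obj j = W'.obj j := hinj (Functor.congr_obj h j)
    rw [← conj_eqToHom_iff_heq _ _ (e i) (e j)]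
    apply F.map_injective
    have := Functor.congr_hom h f
    simpa [eqToHom_map] using this
  · choose g hg using fun b => hsurj b
    refine ⟨{ obj := fun j => g (V.obj j)
              map := fun {i j} f => F.preimage (eqToHom (hg _) ≫ V.map f ≫ eqToHom (hg _).symm)
              map_id := fun j => F.map_injective (by simp)
              map_comp := fun f f' => F.map_injective (by simp) }, ?_⟩
    exact CategoryTheory.Functor.ext (fun j => hg _) (fun i j f => by simp)

/-- Two functors out of the arrow category agree if they agree on the arrow. -/
lemma arrowFunctor_hext {F G : Fin 2 ⥤ C} (h₀ : F.obj 0 = G.obj 0) (h₁ : F.obj 1 = G.obj 1)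
    (h : HEq (F.map (homOfLE (Fin.zero_le (1 : Fin 2)))) (G.map (homOfLE (Fin.zero_le 1)))) :
    F = G :=
  ComposableArrows.ext₁ (F := F) (G := G) h₀ h₁ ((conj_eqToHom_iff_heq _ _ h₀ h₁).2 h)

/-- A morphism, as a functor out of the arrow category. -/
abbrev arrowFunctor {x y : C} (f : x ⟶ y) : Fin 2 ⥤ C := ComposableArrows.mk₁ f

lemma arrowFunctor_comp {x y : C} (f : x ⟶ y) (F : C ⥤ B) :
    arrowFunctor f ⋙ F = arrowFunctor (F.map f) :=
  arrowFunctor_hext rfl rfl HEq.rfl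

lemma arrowFunctor_congr {x y x' y' : C} {f : x ⟶ y} {f' : x' ⟶ y'} (hx : x = x') (hy : y = y')
    (h : HEq f f') : arrowFunctor f = arrowFunctor f' := by
  subst hx hy h; rfl

lemma arrowFunctor_eq_iff {x y : C} {f : x ⟶ y} {x' y' : C} {f' : x' ⟶ y'} :
    arrowFunctor f = arrowFunctor f' ↔ x = x' ∧ y = y' ∧ HEq f f' := by
  refine ⟨fun h => ⟨Functor.congr_obj h 0, Functor.congr_obj h 1, ?_⟩,
    fun ⟨h, h', h''⟩ => arrowFunctor_congr h h' h''⟩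
  have e := Functor.congr_hom h (homOfLE (Fin.zero_le (1 : Fin 2)))
  exact (conj_eqToHom_iff_heq _ _ (Functor.congr_obj h 0) (Functor.congr_obj h 1)).1 e

lemma eq_arrowFunctor (F : Fin 2 ⥤ C) :
    F = arrowFunctor (F.map (homOfLE (Fin.zero_le (1 : Fin 2)))) :=
  arrowFunctor_hext rfl rfl HEq.rfl

/-- A functor is an isomorphism of categories as soon as it induces bijections on objects and on
arrows. -/
lemma isIsoOfCategories_of_bijective {F : A ⥤ B} (h₀ : Function.Bijective F.obj)
    (h₁ : Function.Bijective (fun W : Fin 2 ⥤ A => W ⋙ F)) : IsIsoOfCategories F := by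
  refine ⟨⟨fun {x y} f => ?_⟩, ⟨fun {x y} f f' h => ?_⟩, h₀⟩
  · obtain ⟨W, hW⟩ := h₁.2 (arrowFunctor f)
    rw [eq_arrowFunctor W] at hW
    obtain ⟨h, h', h''⟩ := arrowFunctor_eq_iff.1 ((arrowFunctor_comp _ _).symm.trans hW)
    have key : ∀ {x' y' : A} (g : x' ⟶ y'), F.obj x' = F.obj x → F.obj y' = F.obj y →
        HEq (F.map g) f → ∃ g : x ⟶ y, F.map g = f := by
      intro x' y' g h h'
      obtain rfl := h₀.1 h
      obtain rfl := h₀.1 h'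
      exact fun h => ⟨g, eq_of_heq h⟩
    exact key _ h h' h''
  · have := h₁.1 (a₁ := arrowFunctor f) (a₂ := arrowFunctor f')
      (by simp only [arrowFunctor_comp, h])
    exact eq_of_heq (arrowFunctor_eq_iff.1 this).2.2

lemma walkingIso_hext {F G : WalkingIso.{0} ⥤ C} (h₀ : F.obj .zero = G.obj .zero)
    (h₁ : F.obj .one = G.obj .one)
    (h : HEq (F.map WalkingIso.iso.hom) (G.map WalkingIso.iso.hom)) : F = G := by
  apply WalkingIso.equiv.injective
  have key : ∀ {a b a' b' : C} (e : a ≅ b) (e' : a' ≅ b'), a = a' → b = b' → HEq e.hom e'.hom →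
      (⟨a, b, e⟩ : Σ (X : C) (Y : C), (X ≅ Y)) = ⟨a', b', e'⟩ := by
    intro a b a' b' e e' ha hb he
    subst ha hb
    obtain rfl := Iso.ext (eq_of_heq he)
    rfl
  exact key _ _ h₀ h₁ h

/-- The strict (one-categorical) right lifting property of a functor `G` against a functor `φ`. -/
def HasStrictLifts {J' : Type*} [Category J'] (φ : J ⥤ J') (G : A ⥤ B) : Prop :=
  ∀ (a : J ⥤ A) (b : J' ⥤ B), a ⋙ G = φ ⋙ b → ∃ l : J' ⥤ A, φ ⋙ l = a ∧ l ⋙ G = b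

/-- Isofibrations, in terms of functors out of the walking isomorphism. -/
lemma isIsofibration_iff_walkingIso {G : A ⥤ B} :
    IsIsofibration G ↔ ∀ (e : A) (δ : WalkingIso.{0} ⥤ B), δ.obj .one = G.obj e →
      ∃ ζ : WalkingIso.{0} ⥤ A, ζ.obj .one = e ∧ ζ ⋙ G = δ := by
  constructor
  · intro h e δ hδ
    obtain ⟨e', φ, h', hφ⟩ := h e (δ.obj .zero) (WalkingIso.toIso δ ≪≫ eqToIso hδ)
    refine ⟨WalkingIso.fromIso φ, rfl, walkingIso_hext h' hδ.symm ?_⟩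
    refine (conj_eqToHom_iff_heq _ _ h' hδ.symm).1 ?_
    simpa using! hφ
  · intro h e b β
    obtain ⟨ζ, hζ, hζ'⟩ := h e (WalkingIso.fromIso β) rfl
    subst hζ
    refine ⟨ζ.obj .zero, WalkingIso.toIso ζ, Functor.congr_obj hζ' .zero, ?_⟩
    have := Functor.congr_hom hζ' WalkingIso.iso.hom
    simpa using! this

/-- The inclusion of the codomain in the walking isomorphism. -/
abbrev codInclusion : Discrete PUnit.{1} ⥤ WalkingIso.{0} := (Functor.const _).obj .one

/-- The inclusion of the two objects in the arrow category. -/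
abbrev endsInclusion : Discrete (Fin 2) ⥤ Fin 2 := Discrete.functor id

/-- The functor from the parallel pair to the arrow category identifying the two arrows. -/
abbrev parallelCollapse : WalkingParallelPair ⥤ Fin 2 :=
  parallelPair (homOfLE (Fin.zero_le (1 : Fin 2))) (homOfLE (Fin.zero_le (1 : Fin 2)))

lemma discrete_functor_ext {ι : Type*} {F G : Discrete ι ⥤ C}
    (h : ∀ i, F.obj ⟨i⟩ = G.obj ⟨i⟩) : F = G :=
  Functor.hext (fun i => h i.as) (by
    rintro ⟨i⟩ ⟨j⟩ f
    obtain rfl := Discrete.eq_of_hom f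
    obtain rfl : f = 𝟙 _ := Subsingleton.elim _ _
    rw [F.map_id, G.map_id, h])

lemma parallelPair_hext {F G : WalkingParallelPair ⥤ C} (h₀ : F.obj .zero = G.obj .zero)
    (h₁ : F.obj .one = G.obj .one)
    (h : HEq (F.map WalkingParallelPairHom.left) (G.map WalkingParallelPairHom.left))
    (h' : HEq (F.map WalkingParallelPairHom.right) (G.map WalkingParallelPairHom.right)) :
    F = G := by
  have h₂ : ∀ j, F.obj j = G.obj j := by rintro (_ | _) <;> assumption
  refine Functor.hext h₂ ?_
  rintro _ _ (_ | _ | _)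
  · exact h
  · exact h'
  · rw [walkingParallelPairHom_id, F.map_id, G.map_id, h₂]

/-! Isofibrations and the full, the faithful and the surjective functors are characterized by strict
lifts against single functors between small categories. -/

lemma hasStrictLifts_codInclusion_iff {G : A ⥤ B} :
    HasStrictLifts codInclusion G ↔ IsIsofibration G := by
  rw [isIsofibration_iff_walkingIso]
  constructor
  · intro h e δ hδ
    obtain ⟨l, hl, hl'⟩ := h ((Functor.const _).obj e) δ (discrete_functor_ext fun i => hδ.symm)
    exact ⟨l, Functor.congr_obj hl ⟨⟨⟩⟩, hl'⟩
  · intro h a b hab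
    obtain ⟨l, hl, hl'⟩ := h (a.obj ⟨⟨⟩⟩) b (Functor.congr_obj hab ⟨⟨⟩⟩).symm
    exact ⟨l, discrete_functor_ext fun i => hl, hl'⟩

lemma hasStrictLifts_endsInclusion_iff {G : A ⥤ B} :
    HasStrictLifts endsInclusion G ↔ G.Full := by
  constructor
  · refine fun h => ⟨fun {x y} f => ?_⟩
    obtain ⟨l, hl, hl'⟩ := h (Discrete.functor ![x, y]) (arrowFunctor f)
      (discrete_functor_ext fun i => by fin_cases i <;> rfl)
    have h₀ : l.obj 0 = x := Functor.congr_obj hl ⟨0⟩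
    have h₁ : l.obj 1 = y := Functor.congr_obj hl ⟨1⟩
    subst h₀ h₁
    refine ⟨l.map (homOfLE (Fin.zero_le (1 : Fin 2))), ?_⟩
    have hl'' := (congrArg (· ⋙ G) (eq_arrowFunctor l)).symm.trans hl'
    exact eq_of_heq (arrowFunctor_eq_iff.1 ((arrowFunctor_comp _ _).symm.trans hl'')).2.2
  · intro _ a b hab
    have h₀ : G.obj (a.obj ⟨0⟩) = b.obj 0 := Functor.congr_obj hab ⟨0⟩
    have h₁ : G.obj (a.obj ⟨1⟩) = b.obj 1 := Functor.congr_obj hab ⟨1⟩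
    refine ⟨arrowFunctor (G.preimage (eqToHom h₀ ≫ b.map (homOfLE (Fin.zero_le (1 : Fin 2))) ≫
      eqToHom h₁.symm)), discrete_functor_ext fun i => by fin_cases i <;> rfl, ?_⟩
    refine (arrowFunctor_comp _ _).trans (arrowFunctor_hext h₀ h₁ ?_)
    refine (conj_eqToHom_iff_heq _ _ h₀ h₁).1 ?_
    exact G.map_preimage _

lemma hasStrictLifts_parallelCollapse_iff {G : A ⥤ B} :
    HasStrictLifts parallelCollapse G ↔ G.Faithful := by
  constructor
  · refine fun h => ⟨fun {x y} f f' hf => ?_⟩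
    obtain ⟨l, hl, -⟩ := h (parallelPair f f') (arrowFunctor (G.map f)) (by
      exact parallelPair_hext rfl rfl HEq.rfl (heq_of_eq hf.symm))
    have h₁ := Functor.congr_hom hl WalkingParallelPairHom.left
    have h₂ := Functor.congr_hom hl WalkingParallelPairHom.right
    exact (cancel_epi _).1 ((cancel_mono _).1
      (by simpa only [Category.assoc] using! (h₁.symm.trans h₂)))
  · intro _ a b hab
    have h₀ : G.obj (a.obj .zero) = b.obj 0 := Functor.congr_obj hab .zero
    have h₁ : G.obj (a.obj .one) = b.obj 1 := Functor.congr_obj hab .one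
    have hl := Functor.congr_hom hab WalkingParallelPairHom.left
    have hr := Functor.congr_hom hab WalkingParallelPairHom.right
    have e : a.map WalkingParallelPairHom.left = a.map WalkingParallelPairHom.right :=
      G.map_injective (hl.trans hr.symm)
    refine ⟨arrowFunctor (a.map WalkingParallelPairHom.left), ?_, ?_⟩
    · exact parallelPair_hext rfl rfl HEq.rfl (heq_of_eq e)
    · refine (arrowFunctor_comp _ _).trans (arrowFunctor_hext h₀ h₁ ?_)
      exact (conj_eqToHom_iff_heq _ _ h₀ h₁).1 hl

lemma hasStrictLifts_empty_iff {G : A ⥤ B} :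
    HasStrictLifts (Functor.empty.{0} (Discrete PUnit.{1})) G ↔ Function.Surjective G.obj := by
  constructor
  · intro h b
    obtain ⟨l, -, hl⟩ := h (Functor.empty _) ((Functor.const _).obj b)
      (discrete_functor_ext (by rintro ⟨⟩))
    exact ⟨l.obj ⟨⟨⟩⟩, Functor.congr_obj hl ⟨⟨⟩⟩⟩
  · intro h a b _
    obtain ⟨x, hx⟩ := h (b.obj ⟨⟨⟩⟩)
    exact ⟨(Functor.const _).obj x, discrete_functor_ext (by rintro ⟨⟩),
      discrete_functor_ext fun _ => hx⟩

lemma faithful_iff_arrowFunctor {G : A ⥤ B} :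
    G.Faithful ↔ ∀ γ γ' : Fin 2 ⥤ A, γ.obj 0 = γ'.obj 0 → γ.obj 1 = γ'.obj 1 →
      γ ⋙ G = γ' ⋙ G → γ = γ' := by
  constructor
  · intro _ γ γ' h₀ h₁ h
    refine arrowFunctor_hext h₀ h₁ ?_
    rw [← conj_eqToHom_iff_heq _ _ h₀ h₁]
    apply G.map_injective
    have := Functor.congr_hom h (homOfLE (Fin.zero_le (1 : Fin 2)))
    simpa [eqToHom_map] using this
  · refine fun h => ⟨fun {x y} f f' hf => ?_⟩
    have := h (arrowFunctor f) (arrowFunctor f') rfl rfl (by simp only [arrowFunctor_comp, hf])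
    exact eq_of_heq (arrowFunctor_eq_iff.1 this).2.2

lemma full_iff_arrowFunctor {G : A ⥤ B} :
    G.Full ↔ ∀ (x y : A) (δ : Fin 2 ⥤ B), δ.obj 0 = G.obj x → δ.obj 1 = G.obj y →
      ∃ γ : Fin 2 ⥤ A, γ.obj 0 = x ∧ γ.obj 1 = y ∧ γ ⋙ G = δ := by
  rw [← hasStrictLifts_endsInclusion_iff]
  constructor
  · intro h x y δ h₀ h₁
    obtain ⟨l, hl, hl'⟩ := h (Discrete.functor ![x, y]) δ
      (discrete_functor_ext fun i => by fin_cases i; exacts [h₀.symm, h₁.symm])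
    exact ⟨l, Functor.congr_obj hl ⟨0⟩, Functor.congr_obj hl ⟨1⟩, hl'⟩
  · intro h a b hab
    obtain ⟨l, h₀, h₁, hl⟩ := h (a.obj ⟨0⟩) (a.obj ⟨1⟩) b (Functor.congr_obj hab ⟨0⟩).symm
      (Functor.congr_obj hab ⟨1⟩).symm
    exact ⟨l, discrete_functor_ext fun i => by fin_cases i; exacts [h₀, h₁], hl⟩

end Cat

end TwoCat

/-! ### Tensors and cotensors -/

namespace TwoCat

universe v₁ v₂ v₃ v₄ u₁ u₂ u₃ u₄

lemma natTrans_hext {A : Type u₁} [Category.{v₁} A] {B : Type u₂} [Category.{v₂} B]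
    {F F' G G' : A ⥤ B} (hF : F = F') (hG : G = G') {α : F ⟶ G} {β : F' ⟶ G'}
    (h : ∀ j, HEq (α.app j) (β.app j)) : HEq α β := by
  subst hF hG
  exact heq_of_eq (NatTrans.ext (funext fun j => eq_of_heq (h j)))

section TwoCategories

variable {K : Type u} [Bicategory.{w, v} K]

lemma whiskerRight_heq {A B C : K} {f g f' g' : A ⟶ B} (ef : f = f') (eg : g = g') {α : f ⟶ g}
    {α' : f' ⟶ g'} (hα : HEq α α') {h h' : B ⟶ C} (e : h = h') : HEq (α ▷ h) (α' ▷ h') := by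
  subst e ef eg hα; rfl

variable [Bicategory.Strict K]

lemma comp_whiskerLeft_heq {A B C D : K} (f : A ⟶ B) (g : B ⟶ C) {h k : C ⟶ D} (α : h ⟶ k) :
    HEq ((f ≫ g) ◁ α) (f ◁ g ◁ α) :=
  (conj_eqToHom_iff_heq _ _ (Category.assoc f g h) (Category.assoc f g k)).1
    (comp_whiskerLeft_strict f g α)

lemma whiskerRight_comp_heq {A B C D : K} {f g : A ⟶ B} (α : f ⟶ g) (h : B ⟶ C) (k : C ⟶ D) :
    HEq (α ▷ (h ≫ k)) (α ▷ h ▷ k) :=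
  (conj_eqToHom_iff_heq _ _ (Category.assoc f h k).symm (Category.assoc g h k).symm).1
    (whiskerRight_comp_strict α h k)

lemma whisker_assoc_heq {A B C D : K} (f : A ⟶ B) {g h : B ⟶ C} (α : g ⟶ h) (k : C ⟶ D) :
    HEq ((f ◁ α) ▷ k) (f ◁ α ▷ k) :=
  (conj_eqToHom_iff_heq _ _ (Category.assoc f g k) (Category.assoc f h k)).1
    (whisker_assoc_strict f α k)

lemma id_whiskerLeft_heq {A B : K} {f g : A ⟶ B} (α : f ⟶ g) : HEq (𝟙 A ◁ α) α :=
  (conj_eqToHom_iff_heq _ _ (Category.id_comp f) (Category.id_comp g)).1 (id_whiskerLeft_strict α)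

lemma whiskerRight_id_heq {A B : K} {f g : A ⟶ B} (α : f ⟶ g) : HEq (α ▷ 𝟙 B) α :=
  (conj_eqToHom_iff_heq _ _ (Category.comp_id f) (Category.comp_id g)).1 (whiskerRight_id_strict α)

lemma postcomp_comp (X : K) {A B C : K} (f : A ⟶ B) (g : B ⟶ C) :
    postcomp X (f ≫ g) = postcomp X f ⋙ postcomp X g :=
  Functor.hext (fun h => (Category.assoc h f g).symm) (fun _ _ α => whiskerRight_comp_heq α f g)

lemma postcomp_id (X A : K) : postcomp X (𝟙 A) = 𝟭 _ :=
  Functor.hext Category.comp_id (fun _ _ α => whiskerRight_id_heq α)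

lemma precomp_comp {A B C : K} (Z : K) (f : A ⟶ B) (g : B ⟶ C) :
    precomp Z (f ≫ g) = precomp Z g ⋙ precomp Z f :=
  Functor.hext (Category.assoc f g) (fun _ _ α => comp_whiskerLeft_heq f g α)

lemma precomp_id (A Z : K) : precomp Z (𝟙 A) = 𝟭 _ :=
  Functor.hext Category.id_comp (fun _ _ α => id_whiskerLeft_heq α)

lemma precomp_comp_postcomp {A B C D : K} (f : A ⟶ B) (g : C ⟶ D) :
    precomp C f ⋙ postcomp A g = postcomp B g ⋙ precomp D f :=
  Functor.hext (fun h => Category.assoc f h g) (fun _ _ α => whisker_assoc_heq f α g)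

section Comparison

variable {I : Type u₁} [Category.{v₁} I] {J : Type u₂} [Category.{v₂} J]

/-- A diagram `W : J ⥤ K(A, T)` exhibiting `T` as the tensor `J · A`. -/
def IsTensor {A T : K} (W : J ⥤ (A ⟶ T)) : Prop :=
  ∀ B : K, IsIsoOfCategories (tensorComparison W B)

/-- A diagram `W : J ⥤ K(P, A)` exhibiting `P` as the cotensor `J ⋔ A`. -/
def IsCotensor {A P : K} (W : J ⥤ (P ⟶ A)) : Prop :=
  ∀ B : K, IsIsoOfCategories (cotensorComparison W B)

/-- The two comparisons of a morphism `c : I · X ⟶ J ⋔ A` with a diagram `I ⥤ J ⥤ K(X, A)`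
agree. -/
lemma postcomp_cotensorComparison {X Y P A : K} (V : I ⥤ (X ⟶ Y)) (W : J ⥤ (P ⟶ A)) (c : Y ⟶ P) :
    (V ⋙ postcomp X c) ⋙ cotensorComparison W X =
      ((W ⋙ precomp A c) ⋙ tensorComparison V A).flip := by
  have h (i : I) : ((V ⋙ postcomp X c) ⋙ cotensorComparison W X).obj i =
      ((W ⋙ precomp A c) ⋙ tensorComparison V A).flip.obj i :=
    Functor.hext (fun j => Category.assoc (V.obj i) c (W.obj j))
      (fun j j' f => comp_whiskerLeft_heq (V.obj i) c (W.map f))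
  refine Functor.hext h (fun i i' f => ?_)
  exact natTrans_hext (h i) (h i') fun j => (whiskerRight_comp_heq (V.map f) c (W.obj j)).symm

/-- Diagrams of shape `I` in `K(X, P)` are diagrams of shape `J` of morphisms `I · X ⟶ A`, by the
universal property of `P` at the object `I · X`. -/
lemma IsTensor.bijective_comp_cotensorComparison {X Y : K} {V : I ⥤ (X ⟶ Y)} (hV : IsTensor V)
    {P A : K} {W : J ⥤ (P ⟶ A)}
    (hW : ∀ B : K, Function.Bijective (cotensorComparison W B).obj) :
    Function.Bijective (fun G : I ⥤ (X ⟶ P) => G ⋙ cotensorComparison W X) := by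
  rw [← Function.Bijective.of_comp_iff _ (hV P).2.2]
  have hflip : Function.Bijective (fun G : J ⥤ I ⥤ (X ⟶ A) => G.flip) :=
    Function.bijective_iff_has_inverse.2 ⟨fun G => G.flip, fun _ => rfl, fun _ => rfl⟩
  have := hflip.comp (((hV A).bijective_comp J).comp (hW Y))
  convert this using 1
  funext c
  exact postcomp_cotensorComparison V W c

lemma IsCotensor.bijective_comp_tensorComparison {P A : K} {W : J ⥤ (P ⟶ A)} (hW : IsCotensor W)
    {X Y : K} {V : I ⥤ (X ⟶ Y)} (hV : ∀ B : K, Function.Bijective (tensorComparison V B).obj) :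
    Function.Bijective (fun G : J ⥤ (Y ⟶ A) => G ⋙ tensorComparison V A) := by
  rw [← Function.Bijective.of_comp_iff _ (hW Y).2.2]
  have hflip : Function.Bijective (fun G : I ⥤ J ⥤ (X ⟶ A) => G.flip) :=
    Function.bijective_iff_has_inverse.2 ⟨fun G => G.flip, fun _ => rfl, fun _ => rfl⟩
  have := hflip.comp (((hW X).bijective_comp I).comp (hV P))
  convert this using 1
  funext c
  exact congrArg Functor.flip (postcomp_cotensorComparison V W c).symm

/-- If the tensors `2 · X` exist, the two-dimensional part of the universal property of a cotensor
follows from the one-dimensional part. -/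
lemma isCotensor_of_bijective (h₂ : ∀ X : K, HasTensor (Fin 2) X) {P A : K} {W : J ⥤ (P ⟶ A)}
    (hW : ∀ B : K, Function.Bijective (cotensorComparison W B).obj) : IsCotensor W := by
  intro X
  obtain ⟨Y, V, hV⟩ := h₂ X
  exact isIsoOfCategories_of_bijective (hW X)
    (IsTensor.bijective_comp_cotensorComparison (V := V) hV hW)

/-- If the cotensors `2 ⋔ A` exist, the two-dimensional part of the universal property of a tensor
follows from the one-dimensional part. -/
lemma isTensor_of_bijective (h₂ : ∀ A : K, HasCotensor (Fin 2) A) {X Y : K} {V : I ⥤ (X ⟶ Y)}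
    (hV : ∀ B : K, Function.Bijective (tensorComparison V B).obj) : IsTensor V := by
  intro A
  obtain ⟨P, W, hW⟩ := h₂ A
  exact isIsoOfCategories_of_bijective (hV A)
    (IsCotensor.bijective_comp_tensorComparison (W := W) hW hV)

omit [Bicategory.Strict K] in
lemma HasTensor.of_inverse (φ : I ⥤ J) (ψ : J ⥤ I) (h : φ ⋙ ψ = 𝟭 I) (h' : ψ ⋙ φ = 𝟭 J) {A : K}
    (hA : HasTensor I A) : HasTensor J A := by
  obtain ⟨T, W, hW⟩ := hA
  refine ⟨T, ψ ⋙ W, fun B => ?_⟩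
  have : IsIsoOfCategories ((Functor.whiskeringLeft J I (A ⟶ B)).obj ψ) :=
    IsIsoOfCategories.of_inverse ((Functor.whiskeringLeft I J (A ⟶ B)).obj φ)
      (congrArg (Functor.whiskeringLeft I I (A ⟶ B)).obj h)
      (congrArg (Functor.whiskeringLeft J J (A ⟶ B)).obj h')
  exact (hW B).comp this

/-- A functor between index categories induces a morphism of tensors, against which a morphism `p`
has the right lifting property exactly when `K(X, p)` has strict lifts against the functor. -/
lemma exists_hasLiftingProperty_iff (φ : I ⥤ J) {X : K} (hI : HasTensor I X)
    (hJ : HasTensor J X) : ∃ (Y Y' : K) (m : Y ⟶ Y'), ∀ {A B : K} (p : A ⟶ B),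
      HasLiftingProperty m p ↔ HasStrictLifts φ (postcomp X p) := by
  obtain ⟨Y, V, hV⟩ := hI
  obtain ⟨Y', V', hV'⟩ := hJ
  obtain ⟨m, hm⟩ := (hV Y').2.2.2 (φ ⋙ V')
  have hm' {A : K} (x : Y' ⟶ A) : V ⋙ postcomp X (m ≫ x) = φ ⋙ V' ⋙ postcomp X x := by
    rw [postcomp_comp]
    exact congrArg (· ⋙ postcomp X x) hm
  refine ⟨Y, Y', m, fun {A B} p => ⟨fun h a b hab => ?_, fun h => ⟨fun {f g} sq => ?_⟩⟩⟩
  · obtain ⟨f, rfl⟩ := (hV A).2.2.2 a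
    obtain ⟨g, rfl⟩ := (hV' B).2.2.2 b
    have sq : CommSq f m p g := ⟨by
      apply (hV B).2.2.1
      change V ⋙ postcomp X (f ≫ p) = V ⋙ postcomp X (m ≫ g)
      rw [hm', postcomp_comp]
      exact hab⟩
    refine ⟨V' ⋙ postcomp X sq.lift, ?_, ?_⟩
    · rw [← hm', sq.fac_left]
      rfl
    · rw [Functor.assoc, ← postcomp_comp, sq.fac_right]
      rfl
  · obtain ⟨l, hl, hl'⟩ := h (V ⋙ postcomp X f) (V' ⋙ postcomp X g) (by
      rw [← hm', ← sq.w, postcomp_comp]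
      rfl)
    obtain ⟨x, rfl⟩ := (hV' A).2.2.2 l
    refine ⟨⟨⟨x, (hV A).2.2.1 ?_, (hV' B).2.2.1 ?_⟩⟩⟩
    · exact (hm' x).trans hl
    · change V' ⋙ postcomp X (x ≫ p) = _
      rw [postcomp_comp]
      exact hl'

end Comparison

end TwoCategories

lemma IsLocallyPresentable2Cat.hasTensor_of_small {K : Type u} [Bicategory.{v, v} K]
    [Bicategory.Strict K] [IsLocallyPresentable2Cat K] (J : Type) [SmallCategory J] (A : K) :
    HasTensor J A :=
  HasTensor.of_inverse (I := AsSmall.{v} J) AsSmall.down AsSmall.up rfl rfl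
    (IsLocallyPresentable2Cat.hasTensor _ A)

end TwoCat

/-! ### Locally presentable 2-categories -/

namespace TwoCat

universe v₁ u₁ v₂ u₂

lemma eq_conj_iff_heq {C : Type u₁} [Category.{v₁} C] {W X Y Z : C} (f : W ⟶ X) (g : Y ⟶ Z)
    (h : W = Y) (h' : Z = X) : f = eqToHom h ≫ g ≫ eqToHom h' ↔ HEq f g :=
  conj_eqToHom_iff_heq f g h h'.symm

section TwoColimits

variable {K : Type u} [Bicategory.{w, v} K] [Bicategory.Strict K] {J : Type u₁} [Category.{v₁} J]
  {F : J ⥤ K} {c : Cocone F}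

namespace Is2Colimit

variable (hc : Is2Colimit c)
include hc

lemma twoCell_heq {B : K} {h k h' k' : c.pt ⟶ B} (eh : h = h') (ek : k = k') {γ : h ⟶ k}
    {γ' : h' ⟶ k'} (H : ∀ j, HEq (c.ι.app j ◁ γ) (c.ι.app j ◁ γ')) : HEq γ γ' := by
  subst eh ek
  refine heq_of_eq ((hc.existsUnique_twoCell h k (fun j => c.ι.app j ◁ γ) ?_).unique
    (fun _ => rfl) (fun j => (eq_of_heq (H j)).symm))
  intro j j' f
  refine (eq_conj_iff_heq _ _ _ _).2 ((comp_whiskerLeft_heq _ _ _).symm.trans ?_)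
  rw [c.w]

lemma existsUnique_twoCell_heq {B : K} (h k : c.pt ⟶ B) {s t : ∀ j, F.obj j ⟶ B}
    (hs : ∀ j, c.ι.app j ≫ h = s j) (ht : ∀ j, c.ι.app j ≫ k = t j) (β : ∀ j, s j ⟶ t j)
    (hβ : ∀ {j j' : J} (f : j ⟶ j'), HEq (F.map f ◁ β j') (β j)) :
    ∃ γ : h ⟶ k, ∀ j, HEq (c.ι.app j ◁ γ) (β j) := by
  obtain rfl : (fun j => c.ι.app j ≫ h) = s := funext hs
  obtain rfl : (fun j => c.ι.app j ≫ k) = t := funext ht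
  obtain ⟨γ, hγ, -⟩ := hc.existsUnique_twoCell h k β
    (fun f => (eq_conj_iff_heq _ _ _ _).2 (hβ f))
  exact ⟨γ, fun j => heq_of_eq (hγ j)⟩

/-- A conical colimit represents compatible families of diagrams of any shape `I`. -/
lemma existsUnique_functor {I : Type u₂} [Category.{v₂} I] {A : K} (s : ∀ j, I ⥤ (F.obj j ⟶ A))
    (hs : ∀ {j j' : J} (f : j ⟶ j'), s j' ⋙ precomp A (F.map f) = s j) :
    ∃! W : I ⥤ (c.pt ⟶ A), ∀ j, W ⋙ precomp A (c.ι.app j) = s j := by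
  have hcol := hc.isColimit.some
  let o (x : I) : c.pt ⟶ A := hcol.desc
    { pt := A
      ι := { app := fun j => (s j).obj x
             naturality := fun j j' f => by
              simpa using! Functor.congr_obj (hs f) x } }
  have ho (x : I) (j : J) : c.ι.app j ≫ o x = (s j).obj x := hcol.fac _ j
  have hex {x y : I} (f : x ⟶ y) :
      ∃ γ : o x ⟶ o y, ∀ j, HEq (c.ι.app j ◁ γ) ((s j).map f) :=
    hc.existsUnique_twoCell_heq (o x) (o y) (ho x) (ho y) (fun j => (s j).map f)
      (fun {j j'} g => (conj_eqToHom_iff_heq _ _ (Functor.congr_obj (hs g) x)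
        (Functor.congr_obj (hs g) y)).1 (Functor.congr_hom (hs g) f))
  choose m hm using @hex
  let W : I ⥤ (c.pt ⟶ A) :=
    { obj := o
      map := m
      map_id := fun x => eq_of_heq (hc.twoCell_heq rfl rfl fun j => (hm _ j).trans (by
        rw [CategoryTheory.Functor.map_id, Bicategory.whiskerLeft_id, ho]))
      map_comp := fun {x y z} f g => eq_of_heq (hc.twoCell_heq rfl rfl fun j => (hm _ j).trans (by
        have h₁ := (conj_eqToHom_iff_heq _ _ (ho x j) (ho y j)).2 (hm f j)
        have h₂ := (conj_eqToHom_iff_heq _ _ (ho y j) (ho z j)).2 (hm g j)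
        rw [Functor.map_comp, Bicategory.whiskerLeft_comp, h₁, h₂]
        refine ((conj_eqToHom_iff_heq _ _ (ho x j) (ho z j)).1 ?_).symm
        simp)) }
  refine ⟨W, fun j => Functor.hext (fun x => ho x j) (fun x y f => hm f j), fun W' hW' => ?_⟩
  have e (x : I) : W'.obj x = o x :=
    hcol.hom_ext fun j => (Functor.congr_obj (hW' j) x).trans (ho x j).symm
  refine Functor.hext e (fun x y f => hc.twoCell_heq (e x) (e y) fun j => ?_)
  exact ((conj_eqToHom_iff_heq _ _ (Functor.congr_obj (hW' j) x)
    (Functor.congr_obj (hW' j) y)).1 (Functor.congr_hom (hW' j) f)).trans (hm f j).symm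

end Is2Colimit

end TwoColimits

section LocallyPresentable

variable (K : Type u) [Bicategory.{v, v} K] [Bicategory.Strict K] [IsLocallyPresentable2Cat K]

lemma hasColimits_of_isLocallyPresentable2Cat : HasColimits K where
  has_colimits_of_shape J _ := ⟨fun F => by
    obtain ⟨c, hc⟩ := IsLocallyPresentable2Cat.exists_conicalColimit J F
    exact ⟨⟨c, hc.isColimit.some⟩⟩⟩

/-- The generator of a locally presentable 2-category also generates its underlying category. -/
lemma exists_generator_of_isLocallyPresentable2Cat :
    ∃ (κ : Cardinal.{v}) (_ : Fact κ.IsRegular) (P : ObjectProperty K),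
      ObjectProperty.EssentiallySmall.{v} P ∧ P.IsCardinalFilteredGenerator κ ∧
        IsCardinalLocallyPresentable K κ := by
  have := hasColimits_of_isLocallyPresentable2Cat K
  obtain ⟨κ, hκ, P, hP, hP', -⟩ := IsLocallyPresentable2Cat.exists_generator (K := K)
  have := hP'.hasCardinalFilteredGenerator
  exact ⟨κ, hκ, P, hP, hP', {}⟩

lemma isLocallyPresentable_of_isLocallyPresentable2Cat : IsLocallyPresentable.{v} K := by
  obtain ⟨κ, hκ, -, -, -, h⟩ := exists_generator_of_isLocallyPresentable2Cat K
  exact ⟨κ, hκ, h⟩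

variable {K}

/-- The presheaf `X ↦ Fun(J, K(X, A))`, which the cotensor `J ⋔ A` represents. -/
abbrev diagramPresheaf (J : Type) [SmallCategory J] (A : K) : Kᵒᵖ ⥤ Type v where
  obj X := J ⥤ (X.unop ⟶ A)
  map f := ↾(fun W : J ⥤ (_ ⟶ A) => W ⋙ precomp A f.unop)
  map_id X := by
    ext W
    exact congrArg (W ⋙ ·) (precomp_id X.unop A)
  map_comp f g := by
    ext W
    exact congrArg (W ⋙ ·) (precomp_comp A g.unop f.unop)

lemma preservesLimits_diagramPresheaf (J : Type) [SmallCategory J] (A : K) :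
    PreservesLimits (diagramPresheaf J A) where
  preservesLimitsOfShape {J'} _ := ⟨fun {F} => by
    obtain ⟨c, hc⟩ := IsLocallyPresentable2Cat.exists_conicalColimit _ F.leftOp
    refine preservesLimit_of_preserves_limit_cone
      (isLimitConeOfCoconeLeftOp F hc.isColimit.some) ?_
    refine ((Types.isLimit_iff _).2 fun s hs => ?_).some
    obtain ⟨W, hW, hW'⟩ := hc.existsUnique_functor (A := A) (fun j => s j.unop)
      (fun {j j'} f => hs f.unop)
    exact ⟨W, fun j => hW (.op j), fun W' h => hW' W' fun j => h j.unop⟩⟩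

/-- A locally presentable 2-category has cotensors. -/
lemma hasCotensor_of_isLocallyPresentable2Cat (J : Type) [SmallCategory J] (A : K) :
    HasCotensor J A := by
  have := isLocallyPresentable_of_isLocallyPresentable2Cat K
  have := preservesLimits_diagramPresheaf J A
  have := isRepresentable_of_preservesLimits (diagramPresheaf J A)
  obtain ⟨P, ⟨r⟩⟩ := this.has_representation
  let W : J ⥤ (P ⟶ A) := r.homEquiv (𝟙 P)
  refine ⟨P, W, isCotensor_of_bijective (IsLocallyPresentable2Cat.hasTensor_of_small (Fin 2))
    fun B => ?_⟩
  have : (cotensorComparison W B).obj = r.homEquiv (X := B) := by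
    funext h
    have := r.homEquiv_comp h (𝟙 P)
    rw [Category.comp_id] at this
    exact this.symm
  rw [this]
  exact r.homEquiv.bijective

end LocallyPresentable

end TwoCat

/-! ### Fully faithful morphisms, equivalences and isofibrations -/

namespace TwoCat

universe v₁ u₁ v₂ u₂

/-- Fully faithful functors, as a property. -/
def IsFullyFaithful {A : Type u₁} [Category.{v₁} A] {B : Type u₂} [Category.{v₂} B]
    (G : A ⥤ B) : Prop :=
  G.Full ∧ G.Faithful

lemma isFullyFaithful_iff_existsUnique {A : Type u₁} [Category.{v₁} A] {B : Type u₂}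
    [Category.{v₂} B] {G : A ⥤ B} :
    IsFullyFaithful G ↔ ∀ (x y : A) (δ : Fin 2 ⥤ B), δ.obj 0 = G.obj x → δ.obj 1 = G.obj y →
      ∃! γ : Fin 2 ⥤ A, γ.obj 0 = x ∧ γ.obj 1 = y ∧ γ ⋙ G = δ := by
  unfold IsFullyFaithful
  rw [full_iff_arrowFunctor, faithful_iff_arrowFunctor]
  constructor
  · rintro ⟨h, h'⟩ x y δ h₀ h₁
    obtain ⟨γ, e₀, e₁, e⟩ := h x y δ h₀ h₁
    exact ⟨γ, ⟨e₀, e₁, e⟩, fun γ' ⟨e₀', e₁', e'⟩ =>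
      h' _ _ (e₀'.trans e₀.symm) (e₁'.trans e₁.symm) (e'.trans e.symm)⟩
  · intro h
    exact ⟨fun x y δ h₀ h₁ => (h x y δ h₀ h₁).exists, fun γ γ' h₀ h₁ e =>
      (h _ _ (γ' ⋙ G) (congrArg G.obj h₀).symm (congrArg G.obj h₁).symm).unique
      ⟨rfl, rfl, e⟩ ⟨h₀.symm, h₁.symm, rfl⟩⟩

/-- A class of objects `P` detects isomorphisms if a morphism that induces bijections on the
morphisms out of the objects of `P` is an isomorphism. -/
def DetectsIsos {C : Type u} [Category.{v} C] (P : ObjectProperty C) : Prop :=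
  ∀ ⦃X Y : C⦄ (m : X ⟶ Y), (∀ G : C, P G → Function.Bijective (fun f : G ⟶ X => f ≫ m)) → IsIso m

lemma detectsIsos_of_isStrongGenerator {C : Type u} [Category.{v} C] {P : ObjectProperty C}
    (hP : P.IsStrongGenerator) : DetectsIsos P := by
  intro X Y m hm
  have : Mono m := ⟨fun {Z} f g h => hP.isSeparating _ _ fun G hG k =>
    (hm G hG).1 (by simp only [Category.assoc, h])⟩
  exact hP.isIso_of_mono m fun G hG => (hm G hG).2

variable {K : Type u} [Bicategory.{w, v} K] [Bicategory.Strict K]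

lemma exists_isPullback [HasPullbacks K] {A B C : K} (f : A ⟶ C) (g : B ⟶ C) :
    ∃ (P : K) (fst : P ⟶ A) (snd : P ⟶ B), IsPullback fst snd f g :=
  ⟨_, _, _, IsPullback.of_hasPullback f g⟩

section

variable {P A B C : K} {fst : P ⟶ A} {snd : P ⟶ B} {f : A ⟶ C} {g : B ⟶ C}
  (h : IsPullback fst snd f g)
include h

lemma comp_eq_of_isPullback : fst ≫ f = snd ≫ g := h.w

lemma exists_lift_of_isPullback {X : K} (x : X ⟶ A) (y : X ⟶ B) (e : x ≫ f = y ≫ g) :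
    ∃ z : X ⟶ P, z ≫ fst = x ∧ z ≫ snd = y :=
  ⟨h.lift x y e, h.lift_fst _ _ _, h.lift_snd _ _ _⟩

lemma hom_ext_of_isPullback {X : K} {z z' : X ⟶ P} (e : z ≫ fst = z' ≫ fst)
    (e' : z ≫ snd = z' ≫ snd) : z = z' :=
  h.hom_ext e e'

end

/-- Full faithfulness of `K(X, p)` means that precomposition with `X` inverts the comparison of
`2 ⋔ A` with the object of 2-cells `x ≫ p ⟶ y ≫ p`; so it may be checked on objects `X` that detect
isomorphisms. -/
lemma DetectsIsos.isFullyFaithful_postcomp [HasPullbacks K] (h₂ : ∀ A : K, HasCotensor (Fin 2) A)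
    {P : ObjectProperty K} (hP : DetectsIsos P) {A B : K} (p : A ⟶ B)
    (h : ∀ G, P G → IsFullyFaithful (postcomp G p)) (X : K) : IsFullyFaithful (postcomp X p) := by
  obtain ⟨PA, WA, hA⟩ := h₂ A
  obtain ⟨PB, WB, hB⟩ := h₂ B
  obtain ⟨p₂, hp₂⟩ := (hB PA).2.2.2 (WA ⋙ postcomp PA p)
  have hp₂' {X : K} (x : X ⟶ PA) :
      WB ⋙ precomp B (x ≫ p₂) = (WA ⋙ precomp A x) ⋙ postcomp X p := by
    rw [precomp_comp, Functor.assoc, precomp_comp_postcomp]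
    exact congrArg (· ⋙ precomp B x) hp₂
  -- `Q` represents the pairs of a morphism `x` and a 2-cell with source `x ≫ p`, and `R` the
  -- triples of morphisms `x`, `y` and a 2-cell `x ≫ p ⟶ y ≫ p`.
  obtain ⟨Q, x₀, q, hQ⟩ := exists_isPullback p (WB.obj 0)
  obtain ⟨R, y₀, r, hR⟩ := exists_isPullback p (q ≫ WB.obj 1)
  obtain ⟨m', hm₀', hm₂'⟩ := exists_lift_of_isPullback hQ (WA.obj 0) p₂
    (Functor.congr_obj hp₂ 0).symm
  obtain ⟨m, hm₁, hm'⟩ := exists_lift_of_isPullback hR (WA.obj 1) m' (by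
    rw [← Category.assoc, hm₂']
    exact (Functor.congr_obj hp₂ 1).symm)
  have hm₀ : m ≫ r ≫ x₀ = WA.obj 0 := by rw [← Category.assoc, hm', hm₀']
  have hm₂ : m ≫ r ≫ q = p₂ := by rw [← Category.assoc, hm', hm₂']
  have hm : IsIso m := by
    refine hP m fun G hG => ?_
    have hff := isFullyFaithful_iff_existsUnique.1 (h G hG)
    constructor
    · intro x x' hx
      replace hx : x ≫ m = x' ≫ m := hx
      apply (hA G).2.2.1
      change WA ⋙ precomp A x = WA ⋙ precomp A x'
      refine (hff (x ≫ WA.obj 0) (x ≫ WA.obj 1) ((WA ⋙ precomp A x) ⋙ postcomp G p)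
        rfl rfl).unique ⟨rfl, rfl, rfl⟩ ⟨?_, ?_, ?_⟩
      · change x' ≫ WA.obj 0 = x ≫ WA.obj 0
        rw [← hm₀, ← Category.assoc, ← Category.assoc x m, hx]
      · change x' ≫ WA.obj 1 = x ≫ WA.obj 1
        rw [← hm₁, ← Category.assoc, ← Category.assoc x m, hx]
      · rw [← hp₂', ← hp₂']
        rw [← hm₂, ← Category.assoc, ← Category.assoc x m, hx]
    · intro y
      obtain ⟨γ, ⟨h₀, h₁, e⟩, -⟩ := hff (y ≫ r ≫ x₀) (y ≫ y₀) (WB ⋙ precomp B (y ≫ r ≫ q))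
        (by
          change (y ≫ r ≫ q) ≫ WB.obj 0 = (y ≫ r ≫ x₀) ≫ p
          simp only [Category.assoc, comp_eq_of_isPullback hQ])
        (by
          change (y ≫ r ≫ q) ≫ WB.obj 1 = (y ≫ y₀) ≫ p
          simp only [Category.assoc, comp_eq_of_isPullback hR])
      obtain ⟨x, rfl⟩ := (hA G).2.2.2 γ
      have e' : x ≫ p₂ = y ≫ r ≫ q := (hB G).2.2.1 ((hp₂' x).trans e)
      refine ⟨x, hom_ext_of_isPullback hR ?_ (hom_ext_of_isPullback hQ ?_ ?_)⟩
      · exact (Category.assoc _ _ _).trans ((congrArg (x ≫ ·) hm₁).trans h₁)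
      · simp only [Category.assoc, hm₀]
        exact h₀
      · simp only [Category.assoc, hm₂]
        exact e'
  refine isFullyFaithful_iff_existsUnique.2 fun x y δ h₀ h₁ => ?_
  obtain ⟨d, rfl⟩ := (hB X).2.2.2 δ
  replace h₀ : d ≫ WB.obj 0 = x ≫ p := h₀
  replace h₁ : d ≫ WB.obj 1 = y ≫ p := h₁
  obtain ⟨z', hz₀', hz₂'⟩ := exists_lift_of_isPullback hQ x d h₀.symm
  obtain ⟨z, hz₁, hz'⟩ := exists_lift_of_isPullback hR y z' (by
    rw [← Category.assoc, hz₂', h₁])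
  have hz₀ : z ≫ r ≫ x₀ = x := by rw [← Category.assoc, hz', hz₀']
  have hz₂ : z ≫ r ≫ q = d := by rw [← Category.assoc, hz', hz₂']
  have hzm : (z ≫ inv m) ≫ m = z := (Category.assoc _ _ _).trans (by
    rw [IsIso.inv_hom_id]
    exact Category.comp_id _)
  refine ⟨WA ⋙ precomp A (z ≫ inv m), ⟨?_, ?_, ?_⟩, ?_⟩
  · change (z ≫ inv m) ≫ WA.obj 0 = x
    rw [← hm₀, ← Category.assoc, hzm, hz₀]
  · change (z ≫ inv m) ≫ WA.obj 1 = y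
    rw [← hm₁, ← Category.assoc, hzm, hz₁]
  · rw [← hp₂', ← hm₂, ← Category.assoc, hzm, hz₂]
    rfl
  · rintro γ ⟨e₀, e₁, e⟩
    obtain ⟨x', rfl⟩ := (hA X).2.2.2 γ
    replace e₀ : x' ≫ WA.obj 0 = x := e₀
    replace e₁ : x' ≫ WA.obj 1 = y := e₁
    have e' : x' ≫ p₂ = d := (hB X).2.2.1 ((hp₂' x').trans e)
    have hx' : x' ≫ m = z := by
      refine hom_ext_of_isPullback hR ?_ (hom_ext_of_isPullback hQ ?_ ?_)
      · rw [Category.assoc, hm₁, e₁, hz₁]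
      · simp only [Category.assoc, hm₀, hz₀, e₀]
      · simp only [Category.assoc, hm₂, hz₂, e']
    change WA ⋙ precomp A x' = WA ⋙ precomp A (z ≫ inv m)
    congr 2
    exact (IsIso.eq_comp_inv m).2 hx'

section Representable

/-- Equivalences are the morphisms that are sent to equivalences by every representable. -/
lemma equivalences_iff {A B : K} (f : A ⟶ B) :
    equivalences K f ↔ ∀ X : K, (postcomp X f).IsEquivalence := by
  constructor
  · rintro ⟨g, ⟨α⟩, ⟨β⟩⟩ X
    exact (CategoryTheory.Equivalence.mk (postcomp X f) (postcomp X g)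
      ((eqToIso (postcomp_id X A)).symm ≪≫ (postcomposing X A A).mapIso α.symm ≪≫
        eqToIso (postcomp_comp X f g))
      ((eqToIso (postcomp_comp X g f)).symm ≪≫ (postcomposing X B B).mapIso β ≪≫
        eqToIso (postcomp_id X B))).isEquivalence_functor
  · intro h
    obtain ⟨g, ⟨β⟩⟩ := (h B).essSurj.mem_essImage (𝟙 B)
    have := h A
    exact ⟨g, ⟨(postcomp A f).preimageIso (eqToIso (Category.assoc f g f) ≪≫
      (precomp B f).mapIso β ≪≫ eqToIso ((Category.comp_id f).trans (Category.id_comp f).symm))⟩,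
      ⟨β⟩⟩

lemma IsFullyFaithful.comp {A B C : Type*} [Category A] [Category B] [Category C] {F : A ⥤ B}
    {G : B ⥤ C} (hF : IsFullyFaithful F) (hG : IsFullyFaithful G) : IsFullyFaithful (F ⋙ G) := by
  obtain ⟨_, _⟩ := hF
  obtain ⟨_, _⟩ := hG
  exact ⟨inferInstance, inferInstance⟩

lemma IsFullyFaithful.of_comp {A B C : Type*} [Category A] [Category B] [Category C] {F : A ⥤ B}
    {G : B ⥤ C} (hG : IsFullyFaithful G) (hFG : IsFullyFaithful (F ⋙ G)) : IsFullyFaithful F := by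
  obtain ⟨_, _⟩ := hG
  obtain ⟨_, _⟩ := hFG
  exact ⟨Functor.Full.of_comp_faithful F G, Functor.Faithful.of_comp F G⟩

/-- The functors that are isofibrations and equivalences are those that are fully faithful and
surjective on objects. -/
lemma isEquivalence_and_isIsofibration_iff {A B : Type*} [Category A] [Category B] {F : A ⥤ B} :
    F.IsEquivalence ∧ IsIsofibration F ↔ IsFullyFaithful F ∧ Function.Surjective F.obj := by
  constructor
  · rintro ⟨h, h'⟩
    refine ⟨⟨inferInstance, inferInstance⟩, fun b => ?_⟩
    obtain ⟨e', -, h, -⟩ := h' _ b (F.objObjPreimageIso b).symm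
    exact ⟨e', h⟩
  · rintro ⟨⟨_, _⟩, h⟩
    refine ⟨{ essSurj := ⟨fun b => ?_⟩ }, fun e b β => ?_⟩
    · obtain ⟨a, rfl⟩ := h b
      exact ⟨a, ⟨Iso.refl _⟩⟩
    · obtain ⟨a, rfl⟩ := h b
      exact ⟨a, F.preimageIso β, rfl, by simp⟩

/-- The trivial fibrations of the trivial model structure. -/
lemma equivalences_inf_isofibrations_iff {A B : K} (f : A ⟶ B) :
    (equivalences K ⊓ isofibrations K) f ↔
      ∀ X : K, IsFullyFaithful (postcomp X f) ∧ Function.Surjective (postcomp X f).obj := by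
  simp only [← isEquivalence_and_isIsofibration_iff, forall_and]
  exact and_congr (equivalences_iff f) Iff.rfl

end Representable

end TwoCat

/-! ### The category underlying the 2-category of strict algebras -/

namespace TwoCat

universe v₁ u₁ v₂ u₂

namespace TwoMonad

section

variable {K : Type u} [Bicategory.{w, v} K] [Bicategory.Strict K] (T : TwoMonad K)

/-- Strict algebras, as algebras of the underlying ordinary monad. -/
def toAlgebra : T.StrictAlg ⥤ T.toMonad.Algebra where
  obj X := ⟨X.A, X.a, X.unit, X.assoc⟩
  map p := ⟨p.f, p.w⟩

/-- Algebras of the underlying ordinary monad, as strict algebras. -/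
def ofAlgebra : T.toMonad.Algebra ⥤ T.StrictAlg where
  obj X := ⟨X.A, X.a, X.unit, X.assoc⟩
  map p := ⟨p.f, p.h⟩

/-- The category underlying `T-Alg_s` is the category of algebras of the underlying monad. -/
def algebraEquivalence : T.StrictAlg ≌ T.toMonad.Algebra where
  functor := T.toAlgebra
  inverse := T.ofAlgebra
  unitIso := Iso.refl _
  counitIso := Iso.refl _
  functor_unitIso_comp X := (Category.id_comp _ : 𝟙 (T.toAlgebra.obj X) ≫ 𝟙 _ = 𝟙 _)

instance : T.ofAlgebra.IsEquivalence := T.algebraEquivalence.isEquivalence_inverse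

instance : T.toAlgebra.IsEquivalence := T.algebraEquivalence.isEquivalence_functor

lemma hasLimitsOfShape_strictAlg (J : Type u₁) [Category.{v₁} J] [HasLimitsOfShape J K] :
    HasLimitsOfShape J T.StrictAlg := by
  have : HasLimitsOfShape J T.toMonad.Algebra :=
    ⟨fun D => Monad.hasLimit_of_comp_forget_hasLimit D⟩
  exact Adjunction.hasLimitsOfShape_of_equivalence T.toAlgebra

lemma isIso_of_isIso_forget {X Y : T.StrictAlg} (p : X ⟶ Y) [IsIso (T.forget.map p)] : IsIso p := by
  have : IsIso (T.toMonad.forget.map (T.toAlgebra.map p)) := ‹IsIso (T.forget.map p)›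
  have := isIso_of_reflects_iso (T.toAlgebra.map p) T.toMonad.forget
  exact isIso_of_reflects_iso p T.toAlgebra

/-- Free algebras are left adjoint to the forgetful functor. -/
def freeAdj : T.free ⊣ T.forget :=
  T.toMonad.adj.comp T.algebraEquivalence.symm.toAdjunction

lemma freeAdj_homEquiv {X : K} {Y : T.StrictAlg} (p : T.free.obj X ⟶ Y) :
    T.freeAdj.homEquiv X Y p = T.η.app X ≫ p.f := by
  rw [Adjunction.homEquiv_unit]
  refine congrArg (· ≫ p.f) ?_
  simp only [freeAdj, algebraEquivalence, Monad.adj, Adjunction.comp_unit_app]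
  exact (congrArg (· ≫ 𝟙 _) (Category.comp_id (T.η.app X))).trans (Category.comp_id _)

lemma bijective_free {X : K} {Y : T.StrictAlg} :
    Function.Bijective (fun p : T.free.obj X ⟶ Y => (T.η.app X ≫ p.f : X ⟶ Y.A)) := by
  have h : (fun p : T.free.obj X ⟶ Y => (T.η.app X ≫ p.f : X ⟶ Y.A)) = T.freeAdj.homEquiv X Y :=
    funext fun p => (T.freeAdj_homEquiv p).symm
  rw [h]
  exact (T.freeAdj.homEquiv X Y).bijective

end

section

variable {K : Type u} [Bicategory.{v, v} K] [Bicategory.Strict K] (T : TwoMonad K)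

lemma hasColimits_strictAlg [HasColimits K] [IsLocallyPresentable.{v} K] (hT : T.HasRank) :
    HasColimits T.StrictAlg := by
  have : T.toMonad.toFunctor.IsAccessible.{v} := hT
  have := hasColimits_algebra T.toMonad
  exact Adjunction.has_colimits_of_equivalence T.toAlgebra

lemma isAccessible_forget [HasColimits K] (hT : T.HasRank) : T.forget.IsAccessible.{v} := by
  obtain ⟨κ, hκ, h⟩ := hT
  refine ⟨κ, hκ, ⟨fun J _ _ => ?_⟩⟩
  have : PreservesColimitsOfShape J T.toMonad.toFunctor :=
    Functor.preservesColimitsOfShape_of_isCardinalAccessible _ κ J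
  have : PreservesColimitsOfShape J (T.toAlgebra ⋙ T.toMonad.forget) := inferInstance
  exact this

end

end TwoMonad
end TwoCat

/-! ### Cotensors of algebras and the two-dimensional adjunction -/

namespace TwoCat

universe v₁ u₁ v₂ u₂ v₃ u₃ v₄ u₄

lemma functor_comp_injective {A : Type u₁} [Category.{v₁} A] {B : Type u₂} [Category.{v₂} B]
    {F : A ⥤ B} [F.Faithful] (hF : Function.Injective F.obj) {J : Type u₃} [Category.{v₃} J] :
    Function.Injective (fun W : J ⥤ A => W ⋙ F) := by
  intro W W' h
  refine Functor.hext (fun j => hF (Functor.congr_obj h j)) (fun i j f => ?_)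
  have e (j : J) : W.obj j = W'.obj j := hF (Functor.congr_obj h j)
  rw [← conj_eqToHom_iff_heq _ _ (e i) (e j)]
  apply F.map_injective
  have := Functor.congr_hom h f
  simpa [eqToHom_map] using this

namespace TwoMonad

variable {K : Type u} [Bicategory.{w, v} K] [Bicategory.Strict K] (T : TwoMonad K)

/-- The action of a 2-monad on hom-categories. -/
abbrev mapT (X Y : K) : (X ⟶ Y) ⥤ (T.toFunctor.obj X ⟶ T.toFunctor.obj Y) where
  obj f := T.toFunctor.map f
  map α := T.map₂ α
  map_id f := T.map₂_id f
  map_comp α β := T.map₂_comp α β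

/-- The action of the forgetful 2-functor on hom-categories. -/
abbrev mapU (X Y : T.StrictAlg) : (X ⟶ Y) ⥤ (X.A ⟶ Y.A) where
  obj p := p.f
  map φ := φ.α

instance (X Y : T.StrictAlg) : (T.mapU X Y).Faithful := ⟨fun h => StrictAlg.hom₂_ext h⟩

lemma mapU_obj_injective (X Y : T.StrictAlg) : Function.Injective (T.mapU X Y).obj :=
  fun _ _ h => StrictAlg.hom_ext h

lemma map₂_whiskerRight_heq {X Y Z : K} {f g : X ⟶ Y} (α : f ⟶ g) (h : Y ⟶ Z) :
    HEq (T.map₂ (α ▷ h)) (T.map₂ α ▷ T.toFunctor.map h) :=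
  (eq_conj_iff_heq _ _ _ _).1 (T.map₂_whiskerRight α h)

lemma precomp_comp_mapT {X Y : K} (f : X ⟶ Y) (Z : K) :
    precomp Z f ⋙ T.mapT X Z = T.mapT Y Z ⋙ precomp _ (T.toFunctor.map f) :=
  Functor.hext (fun h => T.toFunctor.map_comp f h)
    (fun _ _ α => (eq_conj_iff_heq _ _ _ _).1 (T.map₂_whiskerLeft f α))

lemma mapT_comp_precomp_η (X Y : K) :
    T.mapT X Y ⋙ precomp _ (T.η.app X) = postcomp X (T.η.app Y) :=
  Functor.hext (fun f => (T.η.naturality f).symm)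
    (fun _ _ α => ((eq_conj_iff_heq _ _ _ _).1 (T.η_naturality₂ α)).symm)

lemma mapT_comp_precomp_μ (X Y : K) :
    T.mapT X Y ⋙ precomp _ (T.μ.app X) =
      T.mapT X Y ⋙ T.mapT _ _ ⋙ postcomp _ (T.μ.app Y) :=
  Functor.hext (fun f => (T.μ.naturality f).symm)
    (fun _ _ α => ((eq_conj_iff_heq _ _ _ _).1 (T.μ_naturality₂ α)).symm)

lemma postcomp_comp_mapT (X : K) {Y Z : K} (f : Y ⟶ Z) :
    postcomp X f ⋙ T.mapT X Z = T.mapT X Y ⋙ postcomp _ (T.toFunctor.map f) :=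
  Functor.hext (fun h => T.toFunctor.map_comp h f) (fun _ _ α => T.map₂_whiskerRight_heq α f)

lemma mapU_comp_mapT (X Y : T.StrictAlg) :
    T.mapU X Y ⋙ T.mapT _ _ ⋙ postcomp _ Y.a = T.mapU X Y ⋙ precomp _ X.a :=
  Functor.hext (fun p => p.w) (fun _ _ φ => (eq_conj_iff_heq _ _ _ _).1 φ.w)

/-! The 2-naturality of the unit and of the multiplication, the whiskering axioms and the algebra
structures enter below only through the preceding equations between functors. -/

section

variable {T} {J : Type u₁} [Category.{v₁} J]

/-- A diagram of morphisms and 2-cells of the base lifts to algebras if it is compatible with the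
structure maps. -/
lemma exists_comp_mapU_eq {X Y : T.StrictAlg} (G : J ⥤ (X.A ⟶ Y.A))
    (h : G ⋙ T.mapT _ _ ⋙ postcomp _ Y.a = G ⋙ precomp _ X.a) :
    ∃ G' : J ⥤ (X ⟶ Y), G' ⋙ T.mapU X Y = G :=
  ⟨{ obj := fun j => ⟨G.obj j, Functor.congr_obj h j⟩
     map := fun f => ⟨G.map f, Functor.congr_hom h f⟩
     map_id := fun j => StrictAlg.hom₂_ext (G.map_id j)
     map_comp := fun f g => StrictAlg.hom₂_ext (G.map_comp f g) }, rfl⟩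

/-- If the structure map `p` of a cotensor `P` is defined from `a`, then the diagram classified by
`T h ≫ p` is obtained by applying `T` and `a` to the diagram classified by `h`. -/
lemma comp_precomp_map_comp {A P : K} {W : J ⥤ (P ⟶ A)} {p : T.toFunctor.obj P ⟶ P}
    {a : T.toFunctor.obj A ⟶ A} (hp : W ⋙ precomp A p = W ⋙ T.mapT P A ⋙ postcomp _ a) {X : K}
    (h : X ⟶ P) :
    W ⋙ precomp A (T.toFunctor.map h ≫ p) = (W ⋙ precomp A h) ⋙ T.mapT X A ⋙ postcomp _ a :=
  calc W ⋙ precomp A (T.toFunctor.map h ≫ p)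
      = (W ⋙ precomp A p) ⋙ precomp A (T.toFunctor.map h) := by rw [precomp_comp]; rfl
    _ = (W ⋙ T.mapT P A) ⋙ postcomp _ a ⋙ precomp A (T.toFunctor.map h) := by rw [hp]; rfl
    _ = W ⋙ (T.mapT P A ⋙ precomp _ (T.toFunctor.map h)) ⋙ postcomp _ a := by
      rw [← precomp_comp_postcomp]; rfl
    _ = (W ⋙ precomp A h) ⋙ T.mapT X A ⋙ postcomp _ a := by rw [← precomp_comp_mapT]; rfl

/-- The cotensor of an algebra, formed in the base 2-category, is an algebra. -/
lemma exists_cotensor_lift {B : T.StrictAlg} {P : K} {W : J ⥤ (P ⟶ B.A)} (hW : IsCotensor W) :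
    ∃ (P' : T.StrictAlg) (W' : J ⥤ (P' ⟶ B)), IsCotensor (W' ⋙ T.mapU P' B) := by
  obtain ⟨p, hp⟩ := (hW _).2.2.2 (W ⋙ T.mapT _ _ ⋙ postcomp _ B.a)
  replace hp : W ⋙ precomp B.A p = W ⋙ T.mapT P B.A ⋙ postcomp _ B.a := hp
  -- restriction along `x` of the equation defining `p`
  have hp' {X : K} (x : X ⟶ T.toFunctor.obj P) : W ⋙ precomp B.A (x ≫ p) =
      W ⋙ (T.mapT P B.A ⋙ precomp _ x) ⋙ postcomp _ B.a :=
    calc W ⋙ precomp B.A (x ≫ p) = (W ⋙ precomp B.A p) ⋙ precomp B.A x := by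
          rw [precomp_comp]; rfl
      _ = (W ⋙ T.mapT P B.A) ⋙ postcomp _ B.a ⋙ precomp B.A x := by rw [hp]; rfl
      _ = _ := by rw [← precomp_comp_postcomp]; rfl
  let P' : T.StrictAlg :=
    { A := P
      a := p
      unit := (hW P).2.2.1 <|
        calc W ⋙ precomp B.A (T.η.app P ≫ p)
            = W ⋙ postcomp P (T.η.app B.A) ⋙ postcomp _ B.a :=
              (hp' _).trans (congrArg (fun F => W ⋙ F ⋙ postcomp _ B.a)
                (T.mapT_comp_precomp_η P B.A))
          _ = W ⋙ postcomp P (T.η.app B.A ≫ B.a) :=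
              congrArg (W ⋙ ·) (postcomp_comp P (T.η.app B.A) B.a).symm
          _ = W ⋙ postcomp P (𝟙 B.A) := congrArg (fun f => W ⋙ postcomp P f) B.unit
          _ = W ⋙ precomp B.A (𝟙 P) :=
              congrArg (W ⋙ ·) ((postcomp_id P B.A).trans (precomp_id P B.A).symm)
      assoc := (hW _).2.2.1 <|
        calc W ⋙ precomp B.A (T.μ.app P ≫ p)
            = W ⋙ T.mapT P B.A ⋙ T.mapT _ _ ⋙ postcomp _ (T.μ.app B.A) ⋙ postcomp _ B.a :=
              (hp' _).trans (congrArg (fun F => W ⋙ F ⋙ postcomp _ B.a)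
                (T.mapT_comp_precomp_μ P B.A))
          _ = W ⋙ T.mapT P B.A ⋙ T.mapT _ _ ⋙ postcomp _ (T.μ.app B.A ≫ B.a) :=
              congrArg (fun F => W ⋙ T.mapT P B.A ⋙ T.mapT _ _ ⋙ F)
                (postcomp_comp _ (T.μ.app B.A) B.a).symm
          _ = W ⋙ T.mapT P B.A ⋙ T.mapT _ _ ⋙ postcomp _ (T.toFunctor.map B.a ≫ B.a) :=
              congrArg (fun f => W ⋙ T.mapT P B.A ⋙ T.mapT _ _ ⋙ postcomp _ f) B.assoc
          _ = W ⋙ T.mapT P B.A ⋙ (T.mapT _ _ ⋙ postcomp _ (T.toFunctor.map B.a)) ⋙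
                postcomp _ B.a :=
              congrArg (fun F => W ⋙ T.mapT P B.A ⋙ T.mapT _ _ ⋙ F)
                (postcomp_comp _ (T.toFunctor.map B.a) B.a)
          _ = (W ⋙ T.mapT P B.A ⋙ postcomp _ B.a) ⋙ T.mapT _ _ ⋙ postcomp _ B.a :=
              congrArg (fun F => W ⋙ T.mapT P B.A ⋙ F ⋙ postcomp _ B.a)
                (T.postcomp_comp_mapT _ B.a).symm
          _ = W ⋙ precomp B.A (T.toFunctor.map p ≫ p) := by
              rw [comp_precomp_map_comp hp, hp] }
  obtain ⟨W', hW'⟩ := exists_comp_mapU_eq (X := P') (Y := B) W hp.symm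
  exact ⟨P', W', by rw [hW']; exact hW⟩

variable {B P : T.StrictAlg}

lemma comp_precomp_structure (W : J ⥤ (P ⟶ B)) {X : K} (h : X ⟶ P.A) :
    (W ⋙ T.mapU P B) ⋙ precomp _ (T.toFunctor.map h ≫ P.a) =
      ((W ⋙ T.mapU P B) ⋙ precomp _ h) ⋙ T.mapT _ _ ⋙ postcomp _ B.a :=
  comp_precomp_map_comp (congrArg (W ⋙ ·) (T.mapU_comp_mapT P B)).symm h

/-- The 2-dimensional form of `comp_precomp_structure`. -/
lemma cotensorComparison_structure (W : J ⥤ (P ⟶ B)) (X : K) :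
    (T.mapT X P.A ⋙ postcomp _ P.a) ⋙ cotensorComparison (W ⋙ T.mapU P B) _ =
      cotensorComparison (W ⋙ T.mapU P B) X ⋙
        (Functor.whiskeringRight J _ _).obj (T.mapT X B.A ⋙ postcomp _ B.a) := by
  have h (f : X ⟶ P.A) := comp_precomp_structure W f
  refine Functor.hext h fun f g γ => natTrans_hext (h f) (h g) fun j => ?_
  have h₁ := whiskerRight_comp_heq (T.map₂ γ) P.a (W.obj j).f
  have h₂ := whiskerRight_comp_heq (T.map₂ γ) (T.toFunctor.map (W.obj j).f) B.a
  have h₃ := T.map₂_whiskerRight_heq γ (W.obj j).f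
  refine h₁.symm.trans (((whiskerRight_heq rfl rfl HEq.rfl (W.obj j).w.symm).trans h₂).trans ?_)
  exact (whiskerRight_heq (T.toFunctor.map_comp _ _) (T.toFunctor.map_comp _ _) h₃ rfl).symm

lemma precomp_comp_cotensorComparison {A P : K} (W : J ⥤ (P ⟶ A)) {X Y : K} (x : X ⟶ Y) :
    precomp P x ⋙ cotensorComparison W X =
      cotensorComparison W Y ⋙ (Functor.whiskeringRight J _ _).obj (precomp A x) := by
  have h (f : Y ⟶ P) : W ⋙ precomp A (x ≫ f) = (W ⋙ precomp A f) ⋙ precomp A x := by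
    rw [precomp_comp]; rfl
  exact Functor.hext h fun f g γ => natTrans_hext (h f) (h g) fun j => whisker_assoc_heq _ _ _

lemma bijective_cotensorComparison_of_mapU {W : J ⥤ (P ⟶ B)}
    (hW : IsCotensor (W ⋙ T.mapU P B)) (X : T.StrictAlg) :
    Function.Bijective (cotensorComparison W X).obj := by
  constructor
  · intro h k hk
    exact StrictAlg.hom_ext ((hW X.A).2.2.1 (congrArg (· ⋙ T.mapU X B) hk))
  · intro G
    obtain ⟨h, hh⟩ := (hW X.A).2.2.2 (G ⋙ T.mapU X B)
    replace hh : (W ⋙ T.mapU P B) ⋙ precomp _ h = G ⋙ T.mapU X B := hh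
    refine ⟨⟨h, (hW _).2.2.1 ?_⟩, functor_comp_injective (T.mapU_obj_injective X B) hh⟩
    change (W ⋙ T.mapU P B) ⋙ precomp _ _ = (W ⋙ T.mapU P B) ⋙ precomp _ _
    rw [comp_precomp_structure, hh, Functor.assoc, mapU_comp_mapT, precomp_comp,
      ← Functor.assoc _ (precomp _ h), hh]
    rfl

/-- Cotensors of algebras are created by the forgetful 2-functor. -/
lemma isCotensor_of_mapU {W : J ⥤ (P ⟶ B)} (hW : IsCotensor (W ⋙ T.mapU P B)) : IsCotensor W := by
  intro X
  refine isIsoOfCategories_of_bijective (bijective_cotensorComparison_of_mapU hW X) ⟨?_, ?_⟩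
  · intro G G' h
    refine functor_comp_injective (T.mapU_obj_injective X P) (((hW X.A).bijective_comp _).1 ?_)
    exact congrArg (· ⋙ (Functor.whiskeringRight J _ _).obj (T.mapU X B)) h
  · intro H
    obtain ⟨G, hG⟩ := ((hW X.A).bijective_comp (Fin 2)).2
      (H ⋙ (Functor.whiskeringRight J _ _).obj (T.mapU X B))
    replace hG : G ⋙ cotensorComparison (W ⋙ T.mapU P B) X.A = _ := hG
    obtain ⟨G', rfl⟩ := exists_comp_mapU_eq (X := X) (Y := P) G (by
      apply ((hW _).bijective_comp (Fin 2)).1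
      change G ⋙ (T.mapT X.A P.A ⋙ postcomp _ P.a) ⋙ cotensorComparison _ _ =
        G ⋙ precomp _ X.a ⋙ cotensorComparison _ _
      rw [cotensorComparison_structure, precomp_comp_cotensorComparison, ← Functor.assoc,
        ← Functor.assoc, hG]
      exact congrArg (fun F => H ⋙ (Functor.whiskeringRight J _ _).obj F) (T.mapU_comp_mapT X B))
    refine ⟨G', functor_comp_injective (F := (Functor.whiskeringRight J _ _).obj (T.mapU X B))
      (functor_comp_injective (T.mapU_obj_injective X B)) hG⟩

lemma hasCotensor_strictAlg (h : ∀ A : K, HasCotensor J A) (B : T.StrictAlg) :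
    HasCotensor J B := by
  obtain ⟨P, W, hW⟩ := h B.A
  obtain ⟨P', W', hW'⟩ := exists_cotensor_lift (W := W) hW
  exact ⟨P', W', isCotensor_of_mapU hW'⟩

end

/-- The functor `T-Alg_s(F Y, B) ⥤ K(Y, U B)` given by the unit. -/
abbrev freeComparison (Y : K) (B : T.StrictAlg) : (T.free.obj Y ⟶ B) ⥤ (Y ⟶ B.A) :=
  T.mapU (T.free.obj Y) B ⋙ precomp B.A (T.η.app Y)

/-- The free-forgetful adjunction is two-dimensional: cotensors by the arrow category reduce the
bijection on 2-cells to the bijection on 1-cells. -/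
lemma isIsoOfCategories_freeComparison (h₂ : ∀ A : K, HasCotensor (Fin 2) A) (Y : K)
    (B : T.StrictAlg) : IsIsoOfCategories (T.freeComparison Y B) := by
  refine isIsoOfCategories_of_bijective T.bijective_free ?_
  obtain ⟨P, W, hW⟩ := h₂ B.A
  obtain ⟨P', W', hW'⟩ := exists_cotensor_lift (W := W) hW
  rw [← Function.Bijective.of_comp_iff _ (bijective_cotensorComparison_of_mapU hW' (T.free.obj Y))]
  convert (hW' Y).2.2.comp (T.bijective_free (X := Y) (Y := P')) using 1
  funext c
  exact (congrArg ((W' ⋙ T.mapU P' B) ⋙ ·) (precomp_comp B.A (T.η.app Y) c.f)).symm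

/-- Naturality of `T-Alg_s(F Y, B) ≅ K(Y, U B)` in `B`. -/
lemma postcomp_comp_freeComparison (Y : K) {B C : T.StrictAlg} (p : B ⟶ C) :
    postcomp (T.free.obj Y) p ⋙ T.freeComparison Y C = T.freeComparison Y B ⋙ postcomp Y p.f := by
  exact congrArg (T.mapU (T.free.obj Y) B ⋙ ·) (precomp_comp_postcomp (T.η.app Y) p.f).symm

end TwoMonad
end TwoCat

/-! ### Tensors of algebras -/

namespace TwoCat

universe v₁ u₁ v₂ u₂ v₃ u₃ v₄ u₄

section CotensorFunctor

variable {K : Type u} [Bicategory.{w, v} K] [Bicategory.Strict K] {J : Type u₁} [Category.{v₁} J]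
  {P : K → K} (W : ∀ A, J ⥤ (P A ⟶ A)) (hW : ∀ A, IsCotensor (W A))

/-- The functor sending `A` to a chosen cotensor `J ⋔ A`. -/
noncomputable def cotensorFunctor : K ⥤ K where
  obj := P
  map {A B} f := ((hW B (P A)).2.2.2 (W A ⋙ postcomp (P A) f)).choose
  map_id A := (hW A (P A)).2.2.1 <|
    ((hW A (P A)).2.2.2 (W A ⋙ postcomp (P A) (𝟙 A))).choose_spec.trans
      (congrArg (W A ⋙ ·) ((postcomp_id (P A) A).trans (precomp_id (P A) A).symm))
  map_comp {A B C} f g := (hW C (P A)).2.2.1 <| by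
    have hf := ((hW B (P A)).2.2.2 (W A ⋙ postcomp (P A) f)).choose_spec
    have hg := ((hW C (P B)).2.2.2 (W B ⋙ postcomp (P B) g)).choose_spec
    have hfg := ((hW C (P A)).2.2.2 (W A ⋙ postcomp (P A) (f ≫ g))).choose_spec
    generalize ((hW B (P A)).2.2.2 (W A ⋙ postcomp (P A) f)).choose = f' at *
    generalize ((hW C (P B)).2.2.2 (W B ⋙ postcomp (P B) g)).choose = g' at *
    calc _ = W A ⋙ postcomp (P A) (f ≫ g) := hfg
      _ = (W A ⋙ postcomp (P A) f) ⋙ postcomp (P A) g :=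
          congrArg (W A ⋙ ·) (postcomp_comp (P A) f g)
      _ = W B ⋙ precomp B f' ⋙ postcomp (P A) g := congrArg (· ⋙ postcomp (P A) g) hf.symm
      _ = (W B ⋙ postcomp (P B) g) ⋙ precomp C f' :=
          congrArg (W B ⋙ ·) (precomp_comp_postcomp f' g)
      _ = W C ⋙ precomp C g' ⋙ precomp C f' := congrArg (· ⋙ precomp C f') hg.symm
      _ = W C ⋙ precomp C (f' ≫ g') := congrArg (W C ⋙ ·) (precomp_comp C f' g').symm

lemma comp_precomp_cotensorFunctor_map {A B : K} (f : A ⟶ B) :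
    W B ⋙ precomp B ((cotensorFunctor W hW).map f) = W A ⋙ postcomp (P A) f :=
  ((hW B (P A)).2.2.2 (W A ⋙ postcomp (P A) f)).choose_spec

/-- If the cotensor functor `J ⋔ -` has a left adjoint, its values have the one-dimensional
universal property of the tensors `J · -`. -/
lemma exists_bijective_tensorComparison [(cotensorFunctor W hW).IsRightAdjoint] (A : K) :
    ∃ (Y : K) (V : J ⥤ (A ⟶ Y)), ∀ B : K, Function.Bijective (tensorComparison V B).obj := by
  obtain ⟨L, ⟨adj⟩⟩ : ∃ L, Nonempty (L ⊣ cotensorFunctor W hW) :=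
    Functor.IsRightAdjoint.exists_leftAdjoint
  let η : A ⟶ P (L.obj A) := adj.unit.app A
  refine ⟨L.obj A, W (L.obj A) ⋙ precomp (L.obj A) η, fun B => ?_⟩
  convert (hW B A).2.2.comp (adj.homEquiv A B).bijective using 1
  funext x
  have hx : adj.homEquiv A B x = η ≫ (cotensorFunctor W hW).map x :=
    adj.homEquiv_unit A B x
  change (W (L.obj A) ⋙ precomp (L.obj A) η) ⋙ postcomp A x =
    W B ⋙ precomp B (adj.homEquiv A B x)
  rw [hx]
  calc (W (L.obj A) ⋙ precomp (L.obj A) η) ⋙ postcomp A x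
      = (W (L.obj A) ⋙ postcomp _ x) ⋙ precomp B η :=
        congrArg (W (L.obj A) ⋙ ·) (precomp_comp_postcomp η x)
    _ = (W B ⋙ precomp B ((cotensorFunctor W hW).map x)) ⋙ precomp B η :=
        congrArg (· ⋙ precomp B η) (comp_precomp_cotensorFunctor_map W hW x).symm
    _ = W B ⋙ precomp B (η ≫ (cotensorFunctor W hW).map x) :=
        congrArg (W B ⋙ ·) (precomp_comp B η _).symm

end CotensorFunctor

namespace TwoMonad

variable {K : Type u} [Bicategory.{w, v} K] [Bicategory.Strict K] {T : TwoMonad K}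

section

variable {J : Type u₁} [Category.{v₁} J] {P : T.StrictAlg → T.StrictAlg}
  (W : ∀ B, J ⥤ (P B ⟶ B)) (hW : ∀ B, IsCotensor (W B ⋙ T.mapU (P B) B))

/-- Underlying objects of cotensors of algebras have a left adjoint: `X ↦ F (J · X)`. -/
lemma isRightAdjoint_cotensorFunctor_comp_forget (hJ : ∀ X : K, HasTensor J X) :
    (cotensorFunctor W (fun B => isCotensor_of_mapU (hW B)) ⋙ T.forget).IsRightAdjoint := by
  choose Y V hV using hJ
  let R := cotensorFunctor W (fun B => isCotensor_of_mapU (hW B))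
  let e (X : K) (B : T.StrictAlg) : (T.free.obj (Y X) ⟶ B) ≃ (X ⟶ (R ⋙ T.forget).obj B) :=
    (Equiv.ofBijective _ (T.bijective_free (X := Y X) (Y := B))).trans
      ((Equiv.ofBijective _ (hV X B.A).2.2).trans (Equiv.ofBijective _ (hW B X).2.2).symm)
  have he (X : K) (B : T.StrictAlg) (p : T.free.obj (Y X) ⟶ B) :
      (W B ⋙ T.mapU (P B) B) ⋙ precomp B.A (e X B p) =
        V X ⋙ postcomp X (T.η.app (Y X) ≫ p.f) :=
    (Equiv.ofBijective _ (hW B X).2.2).apply_symm_apply _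
  refine (Adjunction.adjunctionOfEquivLeft (G := R ⋙ T.forget) e ?_).isRightAdjoint
  intro X B C g p
  apply (hW C X).2.2.1
  calc (W C ⋙ T.mapU (P C) C) ⋙ precomp C.A (e X C (p ≫ g))
      = V X ⋙ postcomp X (T.η.app (Y X) ≫ p.f ≫ g.f) := he X C (p ≫ g)
    _ = V X ⋙ postcomp X ((T.η.app (Y X) ≫ p.f) ≫ g.f) :=
        congrArg (fun f => V X ⋙ postcomp X f) (Category.assoc _ _ _).symm
    _ = (V X ⋙ postcomp X (T.η.app (Y X) ≫ p.f)) ⋙ postcomp X g.f :=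
        congrArg (V X ⋙ ·) (postcomp_comp X _ g.f)
    _ = (W B ⋙ T.mapU (P B) B) ⋙ precomp B.A (e X B p) ⋙ postcomp X g.f :=
        congrArg (· ⋙ postcomp X g.f) (he X B p).symm
    _ = (W B ⋙ T.mapU (P B) B) ⋙ postcomp _ g.f ⋙ precomp C.A (e X B p) :=
        congrArg ((W B ⋙ T.mapU (P B) B) ⋙ ·) (precomp_comp_postcomp (e X B p) g.f)
    _ = (W C ⋙ precomp C (R.map g)) ⋙ T.mapU _ _ ⋙ precomp C.A (e X B p) :=
        congrArg (· ⋙ T.mapU (P B) C ⋙ precomp C.A (e X B p))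
          (comp_precomp_cotensorFunctor_map W (fun B => isCotensor_of_mapU (hW B)) g).symm
    _ = (W C ⋙ T.mapU (P C) C) ⋙ precomp C.A (e X B p ≫ (R.map g).f) :=
        congrArg ((W C ⋙ T.mapU (P C) C) ⋙ ·) (precomp_comp C.A (e X B p) (R.map g).f).symm

end

/-- Tensors by the arrow category in `T-Alg_s`: the cotensor functor has a left adjoint by the
adjoint lifting theorem, since its composite with the monadic forgetful functor has one. -/
lemma hasTensor_strictAlg [HasReflexiveCoequalizers T.StrictAlg]
    (hc : ∀ A : K, HasCotensor (Fin 2) A) (ht : ∀ A : K, HasTensor (Fin 2) A) (A : T.StrictAlg) :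
    HasTensor (Fin 2) A := by
  have h (B : T.StrictAlg) :
      ∃ (P' : T.StrictAlg) (W' : Fin 2 ⥤ (P' ⟶ B)), IsCotensor (W' ⋙ T.mapU P' B) := by
    obtain ⟨P, W, hW⟩ := hc B.A
    exact exists_cotensor_lift (W := W) hW
  choose P W hW using h
  let R := cotensorFunctor W (fun B => isCotensor_of_mapU (hW B))
  have : ((R ⋙ T.toAlgebra) ⋙ T.toMonad.forget).IsRightAdjoint :=
    isRightAdjoint_cotensorFunctor_comp_forget W hW ht
  have : (R ⋙ T.toAlgebra).IsRightAdjoint := isRightAdjoint_triangle_lift_monadic T.toMonad.forget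
  have : ((R ⋙ T.toAlgebra) ⋙ T.ofAlgebra).IsRightAdjoint := inferInstance
  have : (cotensorFunctor W (fun B => isCotensor_of_mapU (hW B))).IsRightAdjoint := this
  obtain ⟨Y, V, hV⟩ := exists_bijective_tensorComparison W (fun B => isCotensor_of_mapU (hW B)) A
  exact ⟨Y, V, isTensor_of_bijective (fun B => ⟨P B, W B, isCotensor_of_mapU (hW B)⟩) hV⟩

end TwoMonad
end TwoCat

/-! ### Homotopy theory relative to a class of test objects -/

namespace TwoCat

universe v₁ u₁ v₂ u₂ v₃ u₃ v₄ u₄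

section Cat

variable {A : Type u₁} [Category.{v₁} A] {B : Type u₂} [Category.{v₂} B]
  {C : Type u₃} [Category.{v₃} C]

lemma const_comp (J : Type u₄) [Category.{v₄} J] (x : A) (F : A ⥤ B) :
    (Functor.const J).obj x ⋙ F = (Functor.const J).obj (F.obj x) :=
  Functor.hext (fun _ => rfl) (fun _ _ _ => heq_of_eq (F.map_id x))

/-- Evaluation at the codomain of an isomorphism is fully faithful and surjective on objects. -/
lemma isFullyFaithful_evaluation_one :
    IsFullyFaithful ((evaluation WalkingIso.{0} C).obj .one) ∧
      Function.Surjective ((evaluation WalkingIso.{0} C).obj .one).obj := by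
  refine ⟨⟨⟨fun {F G} g => ?_⟩, ⟨fun {F G} α β h => ?_⟩⟩,
    fun c => ⟨(Functor.const _).obj c, rfl⟩⟩
  · let k (x y : WalkingIso.{0}) : x ⟶ y := (Codiscrete.iso x y).hom
    have hk {x y z : WalkingIso.{0}} (f : x ⟶ y) : f ≫ k y z = k x z := rfl
    have hk' {x y z : WalkingIso.{0}} (f : y ⟶ z) : k x y ≫ f = k x z := rfl
    refine ⟨{ app := fun j => F.map (k j WalkingIso.one) ≫ g ≫ G.map (k WalkingIso.one j)
              naturality := fun j j' f => ?_ }, ?_⟩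
    · rw [← Category.assoc, ← F.map_comp, hk, Category.assoc, Category.assoc, ← G.map_comp, hk']
    · change F.map (𝟙 _) ≫ g ≫ G.map (𝟙 _) = g
      simp
  · ext j
    have h₁ := α.naturality (Codiscrete.iso j WalkingIso.one).hom
    have h₂ := β.naturality (Codiscrete.iso j WalkingIso.one).hom
    have h' : α.app .one = β.app .one := h
    rw [h'] at h₁
    exact (cancel_mono (G.map (Codiscrete.iso j WalkingIso.one).hom)).1 (h₁.symm.trans h₂)

/-- Let `P` be the (strict) pullback of `A` and of the category of isomorphisms of `B`, over `B`. If
its projection to `A` is fully faithful, sending an element of `P` to the domain of its isomorphism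
is an isofibration. -/
lemma isIsofibration_comp_evaluation_zero {P : Type u₃} [Category.{v₃} P] {R : P ⥤ A}
    {Λ : P ⥤ WalkingIso.{0} ⥤ B} {F : A ⥤ B} (hR : IsFullyFaithful R)
    (e : R ⋙ F = Λ ⋙ (evaluation _ _).obj .one)
    (h : ∀ (a : A) (y : WalkingIso.{0} ⥤ B), F.obj a = y.obj .one →
      ∃ x : P, R.obj x = a ∧ Λ.obj x = y) :
    IsIsofibration (Λ ⋙ (evaluation _ _).obj .zero) := by
  intro x b β
  obtain ⟨_, _⟩ := hR
  have ex := Functor.congr_obj e x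
  obtain ⟨x', h₁, h₂⟩ := h (R.obj x) (WalkingIso.fromIso (β ≪≫ WalkingIso.toIso (Λ.obj x))) ex
  let φ : x' ≅ x := R.preimageIso (eqToIso h₁)
  have h₀ : (Λ.obj x').obj .zero = b := Functor.congr_obj h₂ .zero
  have h₀' : (Λ.obj x').obj .one = (Λ.obj x).obj .one := Functor.congr_obj h₂ .one
  refine ⟨x', φ, h₀, ?_⟩
  have e₁ : (Λ.map φ.hom).app .one = eqToHom h₀' := by
    have := Functor.congr_hom e.symm φ.hom
    simpa [φ, eqToHom_map] using! this
  have e₂ := (Λ.map φ.hom).naturality WalkingIso.iso.hom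
  have e₃ := Functor.congr_hom h₂ WalkingIso.iso.hom
  rw [e₁, e₃] at e₂
  rw [← cancel_mono ((Λ.obj x).map WalkingIso.iso.hom)]
  refine e₂.symm.trans ?_
  simp only [WalkingIso.fromIso_hom, Iso.trans_hom, WalkingIso.toIso_hom, Category.assoc]
  refine congrArg (fun t => eqToHom h₀ ≫ t) ((Category.assoc _ _ _).trans ?_)
  exact (congrArg (fun t => (β.hom ≫ (Λ.obj x).map WalkingIso.iso.hom) ≫ t)
    (eqToHom_trans _ h₀')).trans (Category.comp_id _)

lemma IsIsofibration.comp {F : A ⥤ B} {G : B ⥤ C} (hF : IsIsofibration F)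
    (hG : IsIsofibration G) : IsIsofibration (F ⋙ G) := by
  rw [isIsofibration_iff_walkingIso] at *
  intro e δ hδ
  obtain ⟨ζ, h₁, h₂⟩ := hG _ δ hδ
  obtain ⟨ξ, h₃, h₄⟩ := hF e ζ h₁
  exact ⟨ξ, h₃, by rw [← Functor.assoc, h₄, h₂]⟩

end Cat

section Test

variable {K : Type u} [Bicategory.{w, v} K] [Bicategory.Strict K] (S : ObjectProperty K)

/-- The morphisms that are sent to isofibrations by the representables at the objects in `S`. -/
def isofibrationsOn : MorphismProperty K := fun _ _ f => ∀ X, S X → IsIsofibration (postcomp X f)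

/-- The morphisms that are sent to equivalences by the representables at the objects in `S`. -/
def equivalencesOn : MorphismProperty K := fun _ _ f => ∀ X, S X → (postcomp X f).IsEquivalence

instance : (equivalencesOn S).HasTwoOutOfThreeProperty where
  comp_mem f g hf hg X hX := by
    have := hf X hX
    have := hg X hX
    rw [postcomp_comp]
    infer_instance
  of_postcomp f g hg hfg X hX := by
    have := hg X hX
    have := hfg X hX
    rw [postcomp_comp] at this
    exact Functor.isEquivalence_of_comp_right _ (postcomp X g)
  of_precomp f g hf hfg X hX := by
    have := hf X hX
    have := hfg X hX
    rw [postcomp_comp] at this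
    exact Functor.isEquivalence_of_comp_left (postcomp X f) _

/-- The trivial fibrations tested at the objects in `S`. -/
abbrev trivialFibrationsOn : MorphismProperty K := equivalencesOn S ⊓ isofibrationsOn S

variable {S}

omit [Bicategory.Strict K] in
lemma trivialFibrationsOn_iff {A B : K} (f : A ⟶ B) :
    trivialFibrationsOn S f ↔ ∀ X, S X →
      IsFullyFaithful (postcomp X f) ∧ Function.Surjective (postcomp X f).obj := by
  simp only [← isEquivalence_and_isIsofibration_iff, forall_and]
  exact Iff.rfl

lemma equivalencesOn_id (A : K) : equivalencesOn S (𝟙 A) := fun X _ => by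
  rw [postcomp_id]; infer_instance

omit [Bicategory.Strict K] in
/-- The codomain projection of a path object. -/
lemma trivialFibrationsOn_cotensor_one {A P : K} {W : WalkingIso.{0} ⥤ (P ⟶ A)}
    (hW : IsCotensor W) : trivialFibrationsOn S (W.obj .one) := by
  rw [trivialFibrationsOn_iff]
  intro X _
  have e : postcomp X (W.obj .one) = cotensorComparison W X ⋙ (evaluation _ _).obj .one := rfl
  obtain ⟨h, h'⟩ := isFullyFaithful_evaluation_one (C := X ⟶ A)
  rw [e]
  exact ⟨IsFullyFaithful.comp ⟨(hW X).1, (hW X).2.1⟩ h, h'.comp (hW X).2.2.2⟩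

omit [Bicategory.Strict K] in
lemma exists_of_isCotensor {J : Type u₁} [Category.{v₁} J] {A P : K} {W : J ⥤ (P ⟶ A)}
    (hW : IsCotensor W) {X : K} (G : J ⥤ (X ⟶ A)) : ∃ x : X ⟶ P, W ⋙ precomp A x = G :=
  (hW X).2.2.2 G

omit [Bicategory.Strict K] in
lemma hom_ext_of_isCotensor {J : Type u₁} [Category.{v₁} J] {A P : K} {W : J ⥤ (P ⟶ A)}
    (hW : IsCotensor W) {X : K} {x y : X ⟶ P} (h : W ⋙ precomp A x = W ⋙ precomp A y) : x = y :=
  (hW X).2.2.1 h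

variable [HasPullbacks K] (hI : ∀ A : K, HasCotensor WalkingIso.{0} A)
  [(trivialFibrationsOn S).IsStableUnderBaseChange]
include hI

/-- The mapping path object: `f` factors as a section `d` of a trivial fibration `r`, followed by a
fibration `v`, and there is an isomorphism `Θ` from `v` to `r ≫ f` whose restriction along `d` is an
identity. -/
lemma exists_mappingPath {A B : K} (f : A ⟶ B) :
    ∃ (L : K) (d : A ⟶ L) (r : L ⟶ A) (v : L ⟶ B) (Θ : WalkingIso.{0} ⥤ (L ⟶ B)),
      d ≫ r = 𝟙 A ∧ d ≫ v = f ∧ trivialFibrationsOn S r ∧ isofibrationsOn S v ∧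
        Θ.obj .zero = v ∧ Θ.obj .one = r ≫ f ∧ Θ ⋙ precomp B d = (Functor.const _).obj f := by
  obtain ⟨P, W, hW⟩ := hI B
  obtain ⟨L, r, l, hL⟩ := exists_isPullback f (W.obj .one)
  obtain ⟨c, hc⟩ := exists_of_isCotensor hW ((Functor.const _).obj f)
  obtain ⟨d, hd, hd'⟩ := exists_lift_of_isPullback hL (𝟙 A) c
    ((Category.id_comp f).trans (Functor.congr_obj hc .one).symm)
  have hr : trivialFibrationsOn S r :=
    MorphismProperty.of_isPullback hL.flip (trivialFibrationsOn_cotensor_one hW)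
  have hΘ : (W ⋙ precomp B l) ⋙ precomp B d = (Functor.const _).obj f :=
    calc W ⋙ precomp B l ⋙ precomp B d = W ⋙ precomp B (d ≫ l) :=
          congrArg (W ⋙ ·) (precomp_comp B d l).symm
      _ = (Functor.const _).obj f := by rw [hd', hc]
  refine ⟨L, d, r, l ≫ W.obj .zero, W ⋙ precomp B l, hd, ?_, hr, fun X hX => ?_, rfl,
    (comp_eq_of_isPullback hL).symm, hΘ⟩
  · exact Functor.congr_obj hΘ .zero
  · have e : postcomp X (l ≫ W.obj .zero) =
        (postcomp X l ⋙ cotensorComparison W X) ⋙ (evaluation _ _).obj .zero :=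
      postcomp_comp X l (W.obj .zero)
    rw [e]
    refine isIsofibration_comp_evaluation_zero (F := postcomp X f)
      (((trivialFibrationsOn_iff r).1 hr) X hX).1 ?_ fun a y hay => ?_
    · rw [← postcomp_comp, comp_eq_of_isPullback hL, postcomp_comp]
      rfl
    · obtain ⟨y, rfl⟩ := exists_of_isCotensor hW y
      obtain ⟨z, hz, hz'⟩ := exists_lift_of_isPullback hL a y hay
      exact ⟨z, hz, congrArg (cotensorComparison W X).obj hz'⟩

/-- A cofibration that is a weak equivalence is the inclusion of a deformation retract. -/
lemma exists_deformationRetraction {A B : K} {i : A ⟶ B} (hi : (trivialFibrationsOn S).llp i)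
    (hi' : equivalencesOn S i) :
    ∃ (ρ : B ⟶ A) (Θ : WalkingIso.{0} ⥤ (B ⟶ B)), i ≫ ρ = 𝟙 A ∧ Θ.obj .zero = 𝟙 B ∧
      Θ.obj .one = ρ ≫ i ∧ Θ ⋙ precomp B i = (Functor.const _).obj i := by
  obtain ⟨L, d, r, v, Θ, hdr, hdv, hr, hv, h₀, h₁, hΘ⟩ := exists_mappingPath (S := S) hI i
  have hd : equivalencesOn S d :=
    (equivalencesOn S).of_postcomp d r hr.1 (by rw [hdr]; exact equivalencesOn_id A)
  have hv' : equivalencesOn S v := (equivalencesOn S).of_precomp d v hd (by rwa [hdv])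
  have := hi v ⟨hv', hv⟩
  have sq : CommSq d i v (𝟙 B) := ⟨hdv.trans (Category.comp_id i).symm⟩
  have e₁ : i ≫ sq.lift = d := sq.fac_left
  have e₂ : sq.lift ≫ v = 𝟙 B := sq.fac_right
  generalize sq.lift = l at e₁ e₂
  refine ⟨l ≫ r, Θ ⋙ precomp B l, ?_, ?_, ?_, ?_⟩
  · rw [← Category.assoc, e₁, hdr]
  · exact (congrArg (l ≫ ·) h₀).trans e₂
  · exact (congrArg (l ≫ ·) h₁).trans (Category.assoc _ _ _).symm
  · rw [Functor.assoc, ← precomp_comp, e₁, hΘ]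

/-- Cofibrations lift paths along fibrations: the comparison of the path object of `E` with the
mapping path object of a fibration `p : E ⟶ D` is a trivial fibration. -/
lemma exists_pathLift {A B E D : K} {i : A ⟶ B} (hi : (trivialFibrationsOn S).llp i) {p : E ⟶ D}
    (hp : isofibrationsOn S p) (x : B ⟶ E) (α : WalkingIso.{0} ⥤ (A ⟶ E))
    (δ : WalkingIso.{0} ⥤ (B ⟶ D)) (h : α ⋙ postcomp A p = δ ⋙ precomp D i)
    (hα : α.obj .one = i ≫ x) (hδ : δ.obj .one = x ≫ p) :
    ∃ κ : WalkingIso.{0} ⥤ (B ⟶ E), κ.obj .one = x ∧ κ ⋙ precomp E i = α ∧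
      κ ⋙ postcomp B p = δ := by
  obtain ⟨PE, WE, hE⟩ := hI E
  obtain ⟨PD, WD, hD⟩ := hI D
  -- `N` is the mapping path object of `p`, and `n` the comparison of `PE` with it.
  obtain ⟨N, a, b, hN⟩ := exists_isPullback p (WD.obj .one)
  obtain ⟨q, hq⟩ := exists_of_isCotensor hD (WE ⋙ postcomp PE p)
  have hq' {X : K} (y : X ⟶ PE) :
      WD ⋙ precomp D (y ≫ q) = (WE ⋙ precomp E y) ⋙ postcomp X p :=
    calc WD ⋙ precomp D (y ≫ q) = (WD ⋙ precomp D q) ⋙ precomp D y :=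
          congrArg (WD ⋙ ·) (precomp_comp D y q)
      _ = (WE ⋙ postcomp PE p) ⋙ precomp D y := by rw [hq]
      _ = (WE ⋙ precomp E y) ⋙ postcomp X p :=
          congrArg (WE ⋙ ·) (precomp_comp_postcomp y p).symm
  obtain ⟨n, hn, hn'⟩ := exists_lift_of_isPullback hN (WE.obj .one) q
    (Functor.congr_obj hq .one).symm
  have ha : trivialFibrationsOn S a :=
    MorphismProperty.of_isPullback hN.flip (trivialFibrationsOn_cotensor_one hD)
  have hn_tf : trivialFibrationsOn S n := by
    rw [trivialFibrationsOn_iff] at ha ⊢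
    have ht := (trivialFibrationsOn_iff _).1 (trivialFibrationsOn_cotensor_one (S := S) hE)
    intro X hX
    refine ⟨(ha X hX).1.of_comp ?_, fun z => ?_⟩
    · rw [← postcomp_comp, hn]
      exact (ht X hX).1
    · obtain ⟨ζ, hζ, hζ'⟩ := isIsofibration_iff_walkingIso.1 (hp X hX) (z ≫ a)
        (WD ⋙ precomp D (z ≫ b)) (by
          change (z ≫ b) ≫ WD.obj .one = (z ≫ a) ≫ p
          rw [Category.assoc, Category.assoc, comp_eq_of_isPullback hN])
      obtain ⟨y, rfl⟩ := exists_of_isCotensor hE ζ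
      refine ⟨y, hom_ext_of_isPullback hN ?_ (hom_ext_of_isCotensor hD ?_)⟩
      · exact (Category.assoc y n a).trans ((congrArg (y ≫ ·) hn).trans hζ)
      · refine Eq.trans ?_ ((hq' y).trans hζ')
        exact congrArg (fun k => WD ⋙ precomp D k) ((Category.assoc y n b).trans (by rw [hn']))
  obtain ⟨α, rfl⟩ := exists_of_isCotensor hE α
  obtain ⟨δ, rfl⟩ := exists_of_isCotensor hD δ
  obtain ⟨y, hy, hy'⟩ := exists_lift_of_isPullback hN x δ hδ.symm
  have sq : CommSq α i n y := by
    refine ⟨hom_ext_of_isPullback hN ?_ (hom_ext_of_isCotensor hD ?_)⟩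
    · rw [Category.assoc, Category.assoc, hn, hy]
      exact hα
    · rw [Category.assoc, Category.assoc, hn', hy', hq', precomp_comp]
      exact h
  have := hi n hn_tf
  have e₁ : i ≫ sq.lift = α := sq.fac_left
  have e₂ : sq.lift ≫ n = y := sq.fac_right
  generalize sq.lift = k at e₁ e₂
  refine ⟨WE ⋙ precomp E k, ?_, ?_, ?_⟩
  · change k ≫ WE.obj .one = x
    rw [← hn, ← Category.assoc, e₂, hy]
  · rw [Functor.assoc, ← precomp_comp, e₁]
  · rw [← hq', ← hn', ← Category.assoc, e₂, hy']

/-- Cofibrations that are weak equivalences lift against fibrations: the retraction gives a lift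
that is strict on `A` and correct on `D` up to a path, and the path can be lifted relative to `A`.
-/
lemma hasLiftingProperty_of_equivalencesOn {A B E D : K} {i : A ⟶ B}
    (hi : (trivialFibrationsOn S).llp i) (hi' : equivalencesOn S i) {p : E ⟶ D}
    (hp : isofibrationsOn S p) : HasLiftingProperty i p where
  sq_hasLift {u w} sq := by
    obtain ⟨ρ, Θ, hρ, h₀, h₁, hΘ⟩ := exists_deformationRetraction hI hi hi'
    have hw : u ≫ p = i ≫ w := sq.w
    obtain ⟨κ, -, hκ, hκ'⟩ := exists_pathLift hI hi hp (ρ ≫ u) ((Functor.const _).obj u)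
      (Θ ⋙ postcomp B w) (by
        rw [Functor.assoc, ← precomp_comp_postcomp, ← Functor.assoc, hΘ, const_comp, const_comp]
        exact congrArg (Functor.const _).obj hw)
      (by rw [← Category.assoc, hρ]; exact (Category.id_comp u).symm)
      (by
        change Θ.obj .one ≫ w = _
        rw [h₁, Category.assoc, Category.assoc, hw])
    exact ⟨⟨⟨κ.obj .zero, Functor.congr_obj hκ .zero, (Functor.congr_obj hκ' .zero).trans
      ((congrArg (· ≫ w) h₀).trans (Category.id_comp w))⟩⟩⟩

/-- The cofibrations that are weak equivalences are the morphisms with the left lifting property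
against the fibrations. -/
lemma llp_isofibrationsOn :
    (isofibrationsOn S).llp = (trivialFibrationsOn S).llp ⊓ equivalencesOn S := by
  apply le_antisymm
  · intro A B f hf
    refine ⟨fun _ _ p hp => hf p hp.2, ?_⟩
    obtain ⟨L, d, r, v, Θ, hdr, hdv, hr, hv, h₀, h₁, hΘ⟩ := exists_mappingPath (S := S) hI f
    have := hf v hv
    have sq : CommSq d f v (𝟙 B) := ⟨hdv.trans (Category.comp_id f).symm⟩
    have e₁ : f ≫ sq.lift = d := sq.fac_left
    have e₂ : sq.lift ≫ v = 𝟙 B := sq.fac_right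
    generalize sq.lift = l at e₁ e₂
    have : equivalences K f := ⟨l ≫ r, ⟨eqToIso (by rw [← Category.assoc, e₁, hdr])⟩,
      ⟨eqToIso (by rw [Category.assoc, ← h₁]; rfl) ≪≫
        (WalkingIso.toIso (Θ ⋙ precomp B l)).symm ≪≫
        eqToIso ((congrArg (l ≫ ·) h₀).trans e₂)⟩⟩
    exact fun X _ => (equivalences_iff f).1 this X
  · exact fun A B f hf _ _ p hp => hasLiftingProperty_of_equivalencesOn hI hf.1 hf.2 hp

/-- If every morphism factors as a cofibration followed by a trivial fibration, then every morphism
factors as a cofibration that is a weak equivalence, followed by a fibration. -/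
lemma hasFactorization_isofibrationsOn
    [MorphismProperty.HasFactorization (trivialFibrationsOn S).llp (trivialFibrationsOn S)] :
    MorphismProperty.HasFactorization
      ((trivialFibrationsOn S).llp ⊓ equivalencesOn S) (isofibrationsOn S) where
  nonempty_mapFactorizationData {A B} f := by
    obtain ⟨L, d, r, v, Θ, hdr, hdv, hr, hv, -⟩ := exists_mappingPath (S := S) hI f
    let D := MorphismProperty.factorizationData (trivialFibrationsOn S).llp
      (trivialFibrationsOn S) d
    have hd : equivalencesOn S d :=
      (equivalencesOn S).of_postcomp d r hr.1 (by rw [hdr]; exact equivalencesOn_id A)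
    have hDi : equivalencesOn S D.i :=
      (equivalencesOn S).of_postcomp D.i D.p D.hp.1 (by rwa [D.fac])
    exact ⟨{
      Z := D.Z
      i := D.i
      p := D.p ≫ v
      fac := by
        have h : (D.i ≫ D.p) ≫ v = f := (congrArg (· ≫ v) D.fac).trans hdv
        exact (Category.assoc _ _ _).symm.trans h
      hi := ⟨D.hi, hDi⟩
      hp := fun X hX => by
        rw [postcomp_comp]
        exact (D.hp.2 X hX).comp (hv X hX) }⟩

end Test

end TwoCat

/-! ### Strict pullbacks of categories and the corner functor -/

namespace TwoCat

universe v₁ u₁ v₂ u₂ v₃ u₃ v₄ u₄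

section StrictPullback

variable {A : Type u₁} [Category.{v₁} A] {B : Type u₂} [Category.{v₂} B]
  {C : Type u₃} [Category.{v₃} C] {F : A ⥤ C} {G : B ⥤ C}

namespace StrictPullback

variable (F G) in
/-- The first projection of a strict pullback of categories. -/
abbrev fstFunctor : StrictPullback F G ⥤ A where
  obj X := X.fst
  map f := f.fst
  map_id _ := rfl
  map_comp _ _ := rfl

variable (F G) in
/-- The second projection of a strict pullback of categories. -/
abbrev sndFunctor : StrictPullback F G ⥤ B where
  obj X := X.snd
  map f := f.snd
  map_id _ := rfl
  map_comp _ _ := rfl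

variable (F G) in
lemma fstFunctor_comp : fstFunctor F G ⋙ F = sndFunctor F G ⋙ G :=
  CategoryTheory.Functor.ext (fun X => X.w) (fun X Y f => by
    have := f.w
    rw [comp_eqToHom_iff, Category.assoc] at this
    exact this)

lemma obj_ext {X Y : StrictPullback F G} (h : X.fst = Y.fst) (h' : X.snd = Y.snd) : X = Y := by
  cases X; cases Y; cases h; cases h'; rfl

lemma hom_hext {X X' Y Y' : StrictPullback F G} (hX : X = X') (hY : Y = Y') {f : X ⟶ Y}
    {f' : X' ⟶ Y'} (h : HEq f.fst f'.fst) (h' : HEq f.snd f'.snd) : HEq f f' := by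
  subst hX hY
  exact heq_of_eq (StrictPullback.Hom.ext (eq_of_heq h) (eq_of_heq h'))

lemma functor_ext {J : Type u₄} [Category.{v₄} J] {X Y : J ⥤ StrictPullback F G}
    (h : X ⋙ fstFunctor F G = Y ⋙ fstFunctor F G) (h' : X ⋙ sndFunctor F G = Y ⋙ sndFunctor F G) :
    X = Y := by
  have e (j : J) : X.obj j = Y.obj j :=
    obj_ext (Functor.congr_obj h j) (Functor.congr_obj h' j)
  refine Functor.hext e fun i j f => hom_hext (e i) (e j) ?_ ?_
  · exact (conj_eqToHom_iff_heq _ _ (Functor.congr_obj h i) (Functor.congr_obj h j)).1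
      (Functor.congr_hom h f)
  · exact (conj_eqToHom_iff_heq _ _ (Functor.congr_obj h' i) (Functor.congr_obj h' j)).1
      (Functor.congr_hom h' f)

variable {D : Type u₄} [Category.{v₄} D]

lemma isFullyFaithful_of_snd {H : D ⥤ StrictPullback F G}
    (h : IsFullyFaithful (H ⋙ sndFunctor F G)) [F.Faithful] : IsFullyFaithful H := by
  obtain ⟨_, _⟩ := h
  refine ⟨⟨fun {x y} f => ?_⟩, Functor.Faithful.of_comp H (sndFunctor F G)⟩
  refine ⟨(H ⋙ sndFunctor F G).preimage f.snd, ?_⟩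
  have e : (H.map ((H ⋙ sndFunctor F G).preimage f.snd)).snd = f.snd :=
    (H ⋙ sndFunctor F G).map_preimage f.snd
  refine StrictPullback.Hom.ext (F.map_injective ?_) e
  have h₁ := (H.map ((H ⋙ sndFunctor F G).preimage f.snd)).w
  rw [e, ← f.w] at h₁
  exact (cancel_mono _).1 h₁

lemma isFullyFaithful_of_fst {H : D ⥤ StrictPullback F G}
    (h : IsFullyFaithful (H ⋙ fstFunctor F G)) [G.Faithful] : IsFullyFaithful H := by
  obtain ⟨_, _⟩ := h
  refine ⟨⟨fun {x y} f => ?_⟩, Functor.Faithful.of_comp H (fstFunctor F G)⟩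
  refine ⟨(H ⋙ fstFunctor F G).preimage f.fst, ?_⟩
  have e : (H.map ((H ⋙ fstFunctor F G).preimage f.fst)).fst = f.fst :=
    (H ⋙ fstFunctor F G).map_preimage f.fst
  refine StrictPullback.Hom.ext e (G.map_injective ?_)
  have h₁ := (H.map ((H ⋙ fstFunctor F G).preimage f.fst)).w
  rw [e, f.w] at h₁
  exact ((cancel_epi _).1 h₁).symm

end StrictPullback

end StrictPullback

section Corner

variable {K : Type u} [Bicategory.{w, v} K] [Bicategory.Strict K] {S : ObjectProperty K}

/-- Strict lifts make `[i, p]` surjective on objects. -/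
lemma essSurj_cornerFunctor {A B C D : K} (i : A ⟶ B) (p : C ⟶ D) [HasLiftingProperty i p] :
    (cornerFunctor i p).EssSurj where
  mem_essImage X := by
    have sq : CommSq X.fst i p X.snd := ⟨X.w⟩
    exact ⟨sq.lift, ⟨eqToIso (StrictPullback.obj_ext sq.fac_left sq.fac_right)⟩⟩

/-- If `p` is fully faithful at every object, then so is the projection of the strict pullback to
`K(B, D)`, and the composite of `[i, p]` with it is `K(B, p)`. -/
lemma isEquivalence_cornerFunctor_of_postcomp {A B C D : K} (i : A ⟶ B) (p : C ⟶ D)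
    [HasLiftingProperty i p] (h : ∀ X, IsFullyFaithful (postcomp X p)) :
    (cornerFunctor i p).IsEquivalence := by
  have := essSurj_cornerFunctor i p
  have := (h A).2
  obtain ⟨_, _⟩ := StrictPullback.isFullyFaithful_of_snd (H := cornerFunctor i p) (h B)
  exact {}

/-- If precomposition with `i` is fully faithful, then so is the projection of the strict pullback
to `K(A, C)`, and the composite of `[i, p]` with it is `K(i, C)`. -/
lemma isEquivalence_cornerFunctor_of_precomp {A B C D : K} (i : A ⟶ B) (p : C ⟶ D)
    [HasLiftingProperty i p] (h : ∀ X, IsFullyFaithful (precomp X i)) :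
    (cornerFunctor i p).IsEquivalence := by
  have := essSurj_cornerFunctor i p
  have := (h D).2
  obtain ⟨_, _⟩ := StrictPullback.isFullyFaithful_of_fst (H := cornerFunctor i p) (h C)
  exact {}

lemma isFullyFaithful_precomp_of_equivalences {A B : K} {f : A ⟶ B} (hf : equivalences K f)
    (X : K) : IsFullyFaithful (precomp X f) := by
  obtain ⟨g, ⟨α⟩, ⟨β⟩⟩ := hf
  have := (CategoryTheory.Equivalence.mk (precomp X f) (precomp X g)
      ((eqToIso (precomp_id B X)).symm ≪≫ (precomposing B B X).mapIso β.symm ≪≫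
        eqToIso (precomp_comp X g f))
      ((eqToIso (precomp_comp X f g)).symm ≪≫ (precomposing A A X).mapIso α ≪≫
        eqToIso (precomp_id A X))).isEquivalence_functor
  exact ⟨this.full, this.faithful⟩

variable [HasPullbacks K] (hI : ∀ A : K, HasCotensor WalkingIso.{0} A)
  [(trivialFibrationsOn S).IsStableUnderBaseChange]
include hI

/-- An isomorphism in the strict pullback is a compatible pair of paths; lifting it along `[i, p]`
is the path lifting property of `i` against `p`. -/
lemma isIsofibration_cornerFunctor {A B C D : K} {i : A ⟶ B}
    (hi : (trivialFibrationsOn S).llp i) {p : C ⟶ D} (hp : isofibrationsOn S p) :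
    IsIsofibration (cornerFunctor i p) := by
  rw [isIsofibration_iff_walkingIso]
  intro x δ hδ
  obtain ⟨κ, h₁, h₂, h₃⟩ := exists_pathLift hI hi hp x (δ ⋙ StrictPullback.fstFunctor _ _)
    (δ ⋙ StrictPullback.sndFunctor _ _)
    (congrArg (δ ⋙ ·) (StrictPullback.fstFunctor_comp _ _))
    (congrArg StrictPullback.fst hδ) (congrArg StrictPullback.snd hδ)
  exact ⟨κ, h₁, StrictPullback.functor_ext h₂ h₃⟩

/-- A cofibration that is a weak equivalence is an equivalence of the 2-category, even though weak
equivalences are only tested at the objects in `S`. -/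
lemma equivalences_of_llp {A B : K} {i : A ⟶ B} (hi : (trivialFibrationsOn S).llp i)
    (hi' : equivalencesOn S i) : equivalences K i := by
  obtain ⟨ρ, Θ, hρ, h₀, h₁, -⟩ := exists_deformationRetraction hI hi hi'
  exact ⟨ρ, ⟨eqToIso hρ⟩, ⟨eqToIso h₁.symm ≪≫ (WalkingIso.toIso Θ).symm ≪≫ eqToIso h₀⟩⟩

end Corner

/-! ### Fibrations characterized by lifting properties -/

section Base

variable {K : Type u} [Bicategory.{v, v} K] [Bicategory.Strict K] [IsLocallyPresentable2Cat K]

lemma exists_hasLiftingProperty_iff_hasStrictLifts {I J : Type} [SmallCategory I]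
    [SmallCategory J] (φ : I ⥤ J) (X : K) : ∃ (Y Y' : K) (m : Y ⟶ Y'), ∀ {A B : K} (p : A ⟶ B),
      HasLiftingProperty m p ↔ HasStrictLifts φ (postcomp X p) :=
  exists_hasLiftingProperty_iff φ (IsLocallyPresentable2Cat.hasTensor_of_small I X)
    (IsLocallyPresentable2Cat.hasTensor_of_small J X)

variable (K)

/-- The isofibrations are the morphisms with the right lifting property against the morphisms
`1 · X ⟶ I · X`, where `I` is the walking isomorphism. -/
lemma rlp_llp_isofibrations : (isofibrations K).llp.rlp = isofibrations K := by
  apply le_antisymm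
  · intro A B p hp X
    obtain ⟨Y, Y', m, hm⟩ := exists_hasLiftingProperty_iff_hasStrictLifts codInclusion X
    rw [← hasStrictLifts_codInclusion_iff, ← hm]
    exact hp m fun _ _ q hq => by
      rw [hm, hasStrictLifts_codInclusion_iff]
      exact hq X
  · exact (MorphismProperty.le_llp_iff_le_rlp _ _).1 le_rfl

/-- The trivial fibrations are the morphisms `p` such that every `K(X, p)` is full, faithful and
surjective on objects, which are lifting properties against morphisms of tensors. -/
lemma rlp_llp_equivalences_inf_isofibrations :
    (equivalences K ⊓ isofibrations K).llp.rlp = equivalences K ⊓ isofibrations K := by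
  apply le_antisymm
  · intro A B p hp
    rw [equivalences_inf_isofibrations_iff]
    intro X
    refine ⟨⟨?_, ?_⟩, ?_⟩
    · obtain ⟨Y, Y', m, hm⟩ := exists_hasLiftingProperty_iff_hasStrictLifts endsInclusion X
      rw [← hasStrictLifts_endsInclusion_iff, ← hm]
      exact hp m fun _ _ q hq => by
        rw [hm, hasStrictLifts_endsInclusion_iff]
        exact (((equivalences_inf_isofibrations_iff q).1 hq) X).1.1
    · obtain ⟨Y, Y', m, hm⟩ := exists_hasLiftingProperty_iff_hasStrictLifts parallelCollapse X
      rw [← hasStrictLifts_parallelCollapse_iff, ← hm]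
      exact hp m fun _ _ q hq => by
        rw [hm, hasStrictLifts_parallelCollapse_iff]
        exact (((equivalences_inf_isofibrations_iff q).1 hq) X).1.2
    · obtain ⟨Y, Y', m, hm⟩ := exists_hasLiftingProperty_iff_hasStrictLifts
        (Functor.empty.{0} (Discrete PUnit.{1})) X
      rw [← hasStrictLifts_empty_iff, ← hm]
      exact hp m fun _ _ q hq => by
        rw [hm, hasStrictLifts_empty_iff]
        exact (((equivalences_inf_isofibrations_iff q).1 hq) X).2
  · exact (MorphismProperty.le_llp_iff_le_rlp _ _).1 le_rfl

end Base

lemma rlp_map_of_adjunction {C : Type u₁} [Category.{v₁} C] {D : Type u₂} [Category.{v₂} D]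
    {F : C ⥤ D} {G : D ⥤ C} (adj : F ⊣ G) (P : MorphismProperty C) :
    (P.map F).rlp = P.rlp.inverseImage G := by
  ext X Y f
  constructor
  · intro hf A B i hi
    rw [← adj.hasLiftingProperty_iff]
    exact hf _ (P.map_mem_map F i hi)
  · rintro hf _ _ _ ⟨A, B, i, hi, ⟨e⟩⟩
    rw [← HasLiftingProperty.iff_of_arrow_iso_left e, adj.hasLiftingProperty_iff]
    exact hf i hi

/-! ### Free algebras as test objects -/

namespace TwoMonad

variable {K : Type u} [Bicategory.{w, v} K] [Bicategory.Strict K] (T : TwoMonad K)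

/-- The free algebras, as a class of objects. -/
def freeAlgebras : ObjectProperty T.StrictAlg := fun X => ∃ Y : K, X = T.free.obj Y

/-- A strict morphism inducing bijections on maps out of the free algebras is invertible in the
base, by the Yoneda lemma, hence invertible. -/
lemma detectsIsos_freeAlgebras : DetectsIsos T.freeAlgebras := by
  intro X Y m hm
  have : IsIso (T.forget.map m) := by
    have h (Z : K) : Function.Bijective (fun f : Z ⟶ X.A => f ≫ m.f) := by
      rw [← Function.Bijective.of_comp_iff _ (T.bijective_free (X := Z) (Y := X))]
      convert (T.bijective_free (X := Z) (Y := Y)).comp (hm (T.free.obj Z) ⟨Z, rfl⟩) using 1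
      funext p
      exact Category.assoc _ _ _
    obtain ⟨g, hg⟩ := (h Y.A).2 (𝟙 Y.A)
    replace hg : g ≫ m.f = 𝟙 Y.A := hg
    exact ⟨g, (h X.A).1 ((Category.assoc _ _ _).trans ((congrArg (m.f ≫ ·) hg).trans
      ((Category.comp_id m.f).trans (Category.id_comp m.f).symm))), hg⟩
  exact T.isIso_of_isIso_forget m

variable (h₂ : ∀ A : K, HasCotensor (Fin 2) A)
include h₂

lemma equivalencesOn_freeAlgebras :
    equivalencesOn T.freeAlgebras = (equivalences K).inverseImage T.forget := by
  ext A B f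
  change _ ↔ equivalences K f.f
  rw [equivalences_iff]
  have key (Y : K) :
      (postcomp (T.free.obj Y) f).IsEquivalence ↔ (postcomp Y f.f).IsEquivalence := by
    obtain ⟨_, _, hA⟩ := T.isIsoOfCategories_freeComparison h₂ Y A
    obtain ⟨_, _, hB⟩ := T.isIsoOfCategories_freeComparison h₂ Y B
    have e {C D : Type _} [Category C] [Category D] (F : C ⥤ D) [F.Full] [F.Faithful]
        (h : Function.Bijective F.obj) : F.IsEquivalence :=
      { essSurj := ⟨fun d => by obtain ⟨c, rfl⟩ := h.2 d; exact ⟨c, ⟨Iso.refl _⟩⟩⟩ }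
    have := e _ hA
    have := e _ hB
    have sq := T.postcomp_comp_freeComparison Y f
    constructor
    · intro h
      have : (T.freeComparison Y A ⋙ postcomp Y f.f).IsEquivalence := by
        rw [← sq]; infer_instance
      exact Functor.isEquivalence_of_comp_left (T.freeComparison Y A) _
    · intro h
      have : (postcomp (T.free.obj Y) f ⋙ T.freeComparison Y B).IsEquivalence := by
        rw [sq]; infer_instance
      exact Functor.isEquivalence_of_comp_right _ (T.freeComparison Y B)
  exact ⟨fun h Y => (key Y).1 (h _ ⟨Y, rfl⟩), by rintro h _ ⟨Y, rfl⟩; exact (key Y).2 (h Y)⟩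

lemma isofibrationsOn_freeAlgebras :
    isofibrationsOn T.freeAlgebras = (isofibrations K).inverseImage T.forget := by
  ext A B f
  have key (Y : K) : IsIsofibration (postcomp (T.free.obj Y) f) ↔
      IsIsofibration (postcomp Y f.f) := by
    have hA := T.isIsoOfCategories_freeComparison h₂ Y A
    have hB := T.isIsoOfCategories_freeComparison h₂ Y B
    have sq := T.postcomp_comp_freeComparison Y f
    rw [isIsofibration_iff_walkingIso, isIsofibration_iff_walkingIso]
    constructor
    · intro h e δ hδ
      obtain ⟨e, rfl⟩ := hA.2.2.2 e
      obtain ⟨δ, rfl⟩ := (hB.bijective_comp _).2 δ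
      obtain ⟨ζ, h₁, h₂⟩ := h e δ (hB.2.2.1 (hδ.trans (Functor.congr_obj sq e).symm))
      refine ⟨ζ ⋙ T.freeComparison Y A, congrArg (T.freeComparison Y A).obj h₁, ?_⟩
      rw [Functor.assoc, ← sq, ← Functor.assoc, h₂]
    · intro h e δ hδ
      obtain ⟨ζ, h₁, h₂⟩ := h ((T.freeComparison Y A).obj e) (δ ⋙ T.freeComparison Y B)
        ((congrArg (T.freeComparison Y B).obj hδ).trans (Functor.congr_obj sq e))
      obtain ⟨ζ, rfl⟩ := (hA.bijective_comp _).2 ζ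
      refine ⟨ζ, hA.2.2.1 h₁, (hB.bijective_comp _).1 ?_⟩
      refine Eq.trans ?_ h₂
      change ζ ⋙ postcomp _ f ⋙ T.freeComparison Y B = ζ ⋙ T.freeComparison Y A ⋙ postcomp _ _
      rw [sq]
  exact ⟨fun h Y => (key Y).1 (h _ ⟨Y, rfl⟩), by rintro h _ ⟨Y, rfl⟩; exact (key Y).2 (h Y)⟩

end TwoMonad

end TwoCat

/-! ### Cofibrations and trivial fibrations of algebras -/

namespace TwoCat

universe v₁ u₁

/-- The small object argument for a small set of morphisms with presentable domains in a cocomplete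
category. -/
lemma hasFactorization_of_isCardinalPresentable {C : Type u} [Category.{v} C] [HasColimits C]
    (I : MorphismProperty C) [MorphismProperty.IsSmall.{v} I] (κ : Cardinal.{v}) [Fact κ.IsRegular]
    (hI : ∀ ⦃A B : C⦄ (i : A ⟶ B), I i → IsCardinalPresentable A κ) :
    I.rlp.llp.HasFactorization I.rlp := by
  have : Nonempty κ.ord.ToType := by
    simpa using Cardinal.IsRegular.ne_zero (Fact.out : κ.IsRegular)
  have := WellFoundedLT.toOrderBot κ.ord.ToType
  have : I.IsCardinalForSmallObjectArgument κ :=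
    { preservesColimit {A _ _ _} i hi f hf := by
        have := hI i hi
        have := preservesColimitsOfShape_of_isCardinalPresentable A κ κ.ord.ToType
        infer_instance }
  have := SmallObject.hasFunctorialFactorization I κ
  infer_instance

lemma IsFullyFaithful.of_comp_left {A B C : Type*} [Category A] [Category B] [Category C]
    {F : A ⥤ B} [F.IsEquivalence] {G : B ⥤ C} (h : IsFullyFaithful (F ⋙ G)) :
    IsFullyFaithful G := by
  obtain ⟨_, _⟩ := h
  have e : G ≅ F.inv ⋙ (F ⋙ G) := (Functor.leftUnitor G).symm ≪≫
    Functor.isoWhiskerRight F.asEquivalence.counitIso.symm G ≪≫ Functor.associator _ _ _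
  exact ⟨Functor.Full.of_iso e.symm, Functor.Faithful.of_iso e.symm⟩

lemma hasLiftingProperty_coprod_inl {C : Type u} [Category.{v} C] {A F E E' : C}
    [HasBinaryCoproduct A F] {p : E ⟶ E'} (h : Function.Surjective fun l : F ⟶ E => l ≫ p) :
    HasLiftingProperty (coprod.inl : A ⟶ A ⨿ F) p where
  sq_hasLift {a b} sq := by
    obtain ⟨l, hl⟩ := h (coprod.inr ≫ b)
    replace hl : l ≫ p = coprod.inr ≫ b := hl
    exact ⟨⟨{ l := coprod.desc a l
              fac_left := coprod.inl_desc _ _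
              fac_right := by
                apply coprod.hom_ext
                · rw [coprod.inl_desc_assoc, sq.w]
                · rw [coprod.inr_desc_assoc, hl] }⟩⟩

namespace TwoMonad

section

variable {K : Type u} [Bicategory.{w, v} K] [Bicategory.Strict K] (T : TwoMonad K)

lemma isFullyFaithful_postcomp_free_iff (h₂ : ∀ A : K, HasCotensor (Fin 2) A) {A B : T.StrictAlg}
    (f : A ⟶ B) (Y : K) :
    IsFullyFaithful (postcomp (T.free.obj Y) f) ↔ IsFullyFaithful (postcomp Y f.f) := by
  obtain ⟨hA, hA', hA''⟩ := T.isIsoOfCategories_freeComparison h₂ Y A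
  obtain ⟨hB, hB', -⟩ := T.isIsoOfCategories_freeComparison h₂ Y B
  have sq := T.postcomp_comp_freeComparison Y f
  constructor
  · intro h
    have : (T.freeComparison Y A).EssSurj :=
      ⟨fun d => by obtain ⟨c, rfl⟩ := hA''.2 d; exact ⟨c, ⟨Iso.refl _⟩⟩⟩
    have : (T.freeComparison Y A).IsEquivalence := {}
    refine IsFullyFaithful.of_comp_left (F := T.freeComparison Y A) ?_
    rw [← sq]
    exact h.comp ⟨hB, hB'⟩
  · intro h
    exact IsFullyFaithful.of_comp ⟨hB, hB'⟩ (by rw [sq]; exact IsFullyFaithful.comp ⟨hA, hA'⟩ h)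

end

variable {K : Type u} [Bicategory.{v, v} K] [Bicategory.Strict K] [IsLocallyPresentable2Cat K]
  (T : TwoMonad K)

/-- The morphisms of algebras that are fully faithful in `K` are those with the right lifting
property against a small set of free maps. -/
lemma exists_small_rlp_iff_isFullyFaithful (hT : T.HasRank) :
    ∃ (I : MorphismProperty T.StrictAlg) (_ : MorphismProperty.IsSmall.{v} I) (κ : Cardinal.{v})
      (_ : Fact κ.IsRegular), (∀ ⦃A B⦄ (i : A ⟶ B), I i → IsCardinalPresentable A κ) ∧
        ∀ ⦃A B : T.StrictAlg⦄ (f : A ⟶ B),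
          I.rlp f ↔ ∀ Y : K, IsFullyFaithful (postcomp Y f.f) := by
  have := hasColimits_of_isLocallyPresentable2Cat K
  have := isLocallyPresentable_of_isLocallyPresentable2Cat K
  have : HasLimits K := hasLimits_of_isLocallyPresentable
  have h₂ (A : K) : HasCotensor (Fin 2) A := hasCotensor_of_isLocallyPresentable2Cat (Fin 2) A
  obtain ⟨κ₀, _, P, hP, hP', -⟩ := exists_generator_of_isLocallyPresentable2Cat K
  obtain ⟨Q, _, hQP, hPQ⟩ := hP.exists_small_le
  have hQ : DetectsIsos Q := detectsIsos_of_isStrongGenerator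
    (hP'.of_le_isoClosure hPQ (hQP.trans hP'.le_isCardinalPresentable)).isStrongGenerator
  let R : Subtype Q ⊕ Subtype Q → MorphismProperty K := Sum.elim
    (fun X _ _ f => (postcomp X.1 f).Full) (fun X _ _ f => (postcomp X.1 f).Faithful)
  have h (j) : ∃ (Y Y' : K) (m : Y ⟶ Y'), ∀ {A B : K} (p : A ⟶ B),
      HasLiftingProperty m p ↔ R j p := by
    obtain X | X := j
    · obtain ⟨Y, Y', m, hm⟩ := exists_hasLiftingProperty_iff_hasStrictLifts endsInclusion X.1
      exact ⟨Y, Y', m, fun p => (hm p).trans hasStrictLifts_endsInclusion_iff⟩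
    · obtain ⟨Y, Y', m, hm⟩ := exists_hasLiftingProperty_iff_hasStrictLifts parallelCollapse X.1
      exact ⟨Y, Y', m, fun p => (hm p).trans hasStrictLifts_parallelCollapse_iff⟩
  choose Z Z' m hm using h
  obtain ⟨κ₁, _, _⟩ := (T.isAccessible_forget hT).exists_cardinal
  obtain ⟨κ, _, hκ, hZ⟩ := exists_isCardinalPresentable_family Z κ₁
  have : Small.{v} (Subtype Q) := inferInstanceAs (ObjectProperty.Small.{v} Q)
  refine ⟨.ofHoms fun j => T.free.map (m j), inferInstance, κ, inferInstance, ?_, ?_⟩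
  · rintro _ _ _ ⟨j⟩
    have := hZ j
    have := T.forget.isCardinalAccessible_of_le hκ
    exact T.freeAdj.isCardinalPresentable_leftAdjoint_obj κ (Z j)
  · intro A B f
    have e : (MorphismProperty.ofHoms fun j => T.free.map (m j)).rlp f ↔ ∀ j, R j f.f := by
      refine Iff.trans ⟨fun h j => h _ ⟨j⟩, ?_⟩ (forall_congr' fun j =>
        (T.freeAdj.hasLiftingProperty_iff (m j) f).trans (hm j f.f))
      rintro h _ _ _ ⟨j⟩
      exact h j
    rw [e]
    exact ⟨fun h Y => hQ.isFullyFaithful_postcomp h₂ f.f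
      (fun X hX => ⟨h (.inl ⟨X, hX⟩), h (.inr ⟨X, hX⟩)⟩) Y,
      fun h j => by obtain X | X := j <;> [exact (h X.1).1; exact (h X.1).2]⟩

/-- A morphism `f : A ⟶ B` of algebras is factored by applying the small object argument, for the
generators of the fully faithful morphisms, to the map from the coproduct of `A` and the free
algebra on `B`. The second factor is fully faithful by construction, and it is surjective on maps
from free algebras as the counit at `B` factors through it. -/
lemma hasFactorization_trivialFibrationsOn (hT : T.HasRank) :
    (trivialFibrationsOn T.freeAlgebras).llp.HasFactorization
      (trivialFibrationsOn T.freeAlgebras) where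
  nonempty_mapFactorizationData {A B} f := by
    have := hasColimits_of_isLocallyPresentable2Cat K
    have := isLocallyPresentable_of_isLocallyPresentable2Cat K
    have : HasLimits K := hasLimits_of_isLocallyPresentable
    have h₂ (A : K) : HasCotensor (Fin 2) A := hasCotensor_of_isLocallyPresentable2Cat (Fin 2) A
    have := T.hasColimits_strictAlg hT
    obtain ⟨I, _, κ, _, hI, hI'⟩ := T.exists_small_rlp_iff_isFullyFaithful hT
    have := hasFactorization_of_isCardinalPresentable I κ hI
    have hI'' {A B : T.StrictAlg} (f : A ⟶ B) :
        I.rlp f ↔ ∀ Y : K, IsFullyFaithful (postcomp (T.free.obj Y) f) :=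
      (hI' f).trans (forall_congr' fun Y => (T.isFullyFaithful_postcomp_free_iff h₂ f Y).symm)
    let D := MorphismProperty.factorizationData I.rlp.llp I.rlp
      (coprod.desc f (T.freeAdj.counit.app B))
    have hle : trivialFibrationsOn T.freeAlgebras ≤ I.rlp := fun _ _ p hp =>
      (hI'' p).2 fun Y => (((trivialFibrationsOn_iff p).1 hp) _ ⟨Y, rfl⟩).1
    refine ⟨{ Z := D.Z, i := coprod.inl ≫ D.i, p := D.p, fac := ?_, hi := ?_, hp := ?_ }⟩
    · rw [Category.assoc, D.fac, coprod.inl_desc]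
    · refine MorphismProperty.comp_mem _ _ _ ?_ (MorphismProperty.antitone_llp hle _ D.hi)
      intro E E' p hp
      exact hasLiftingProperty_coprod_inl (((trivialFibrationsOn_iff p).1 hp) _ ⟨B.A, rfl⟩).2
    · rw [trivialFibrationsOn_iff]
      rintro _ ⟨Y, rfl⟩
      refine ⟨(hI'' _).1 D.hp Y, fun g => ⟨T.free.map (T.freeAdj.homEquiv _ _ g) ≫ coprod.inr ≫ D.i,
        ?_⟩⟩
      change (T.free.map (T.freeAdj.homEquiv _ _ g) ≫ coprod.inr ≫ D.i) ≫ D.p = g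
      rw [Category.assoc, Category.assoc, D.fac, coprod.inr_desc,
        ← T.freeAdj.homEquiv_counit, Equiv.symm_apply_apply]

end TwoMonad

end TwoCat

/-! ### The model structure on strict algebras -/

namespace TwoCat

lemma rlp_llp_rlp_eq {C : Type u} [Category.{v} C] (I : MorphismProperty C) :
    I.rlp.llp.rlp = I.rlp :=
  le_antisymm (MorphismProperty.antitone_rlp ((MorphismProperty.le_llp_iff_le_rlp _ _).2 le_rfl))
    ((MorphismProperty.le_llp_iff_le_rlp _ _).1 le_rfl)

section

variable {K : Type u} [Bicategory.{w, v} K] [Bicategory.Strict K] (S : ObjectProperty K)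

/-- The model structure whose weak equivalences and fibrations are the morphisms that the
representables at the objects in `S` send to equivalences and to isofibrations. -/
@[reducible]
def modelCategoryOn [HasFiniteLimits K] [HasFiniteColimits K]
    (hI : ∀ A : K, HasCotensor WalkingIso.{0} A)
    [(trivialFibrationsOn S).IsStableUnderBaseChange]
    [(trivialFibrationsOn S).llp.HasFactorization (trivialFibrationsOn S)]
    (h : (trivialFibrationsOn S).llp.rlp = trivialFibrationsOn S)
    (h' : (isofibrationsOn S).llp.rlp = isofibrationsOn S) : ModelCategory K :=
  letI : CategoryWithCofibrations K := ⟨(trivialFibrationsOn S).llp⟩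
  letI : CategoryWithFibrations K := ⟨isofibrationsOn S⟩
  letI : CategoryWithWeakEquivalences K := ⟨equivalencesOn S⟩
  have e : trivialFibrations K = trivialFibrationsOn S := inf_comm _ _
  have e' : trivialCofibrations K = (isofibrationsOn S).llp := (llp_isofibrationsOn hI).symm
  have : (weakEquivalences K).HasTwoOutOfThreeProperty :=
    inferInstanceAs (equivalencesOn S).HasTwoOutOfThreeProperty
  have : (cofibrations K).IsWeakFactorizationSystem (trivialFibrations K) := by
    rw [e]
    exact { rlp := h, llp := rfl, hasFactorization := ‹_› }
  have : (trivialCofibrations K).IsWeakFactorizationSystem (fibrations K) :=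
    { rlp := by rw [e']; exact h'
      llp := e'.symm
      hasFactorization := hasFactorization_isofibrationsOn hI }
  ModelCategory.mk' K

end

namespace TwoMonad

variable {K : Type u} [Bicategory.{v, v} K] [Bicategory.Strict K] [IsLocallyPresentable2Cat K]
  (T : TwoMonad K)

lemma isofibrationsOn_freeAlgebras_eq_rlp :
    isofibrationsOn T.freeAlgebras = ((trivialModelTrivialCofibrations K).map T.free).rlp := by
  rw [T.isofibrationsOn_freeAlgebras fun A => hasCotensor_of_isLocallyPresentable2Cat (Fin 2) A,
    rlp_map_of_adjunction T.freeAdj]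
  exact congrArg (MorphismProperty.inverseImage · T.forget) (rlp_llp_isofibrations K).symm

lemma trivialFibrationsOn_freeAlgebras_eq_rlp :
    trivialFibrationsOn T.freeAlgebras = ((trivialModelCofibrations K).map T.free).rlp := by
  have h₂ (A : K) : HasCotensor (Fin 2) A := hasCotensor_of_isLocallyPresentable2Cat (Fin 2) A
  rw [trivialFibrationsOn, T.equivalencesOn_freeAlgebras h₂, T.isofibrationsOn_freeAlgebras h₂,
    rlp_map_of_adjunction T.freeAdj]
  exact congrArg (MorphismProperty.inverseImage · T.forget)
    (rlp_llp_equivalences_inf_isofibrations K).symm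

end TwoMonad

end TwoCat

open TwoCat in
theorem mainTheorem1 {K : Type u} [Bicategory.{v, v, u} K] [Bicategory.Strict K]
    [TwoCat.IsLocallyPresentable2Cat K] (T : TwoCat.TwoMonad K) (hT : T.HasRank) :
    ∃ _ : ModelCategory T.StrictAlg,
      TwoCat.IsModelCatCategory T.StrictAlg ∧
      weakEquivalences T.StrictAlg = (TwoCat.equivalences K).inverseImage T.forget ∧
      fibrations T.StrictAlg = (TwoCat.isofibrations K).inverseImage T.forget ∧
      cofibrations T.StrictAlg =
        ((TwoCat.trivialModelCofibrations K).map T.free).rlp.llp ∧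
      trivialCofibrations T.StrictAlg =
        ((TwoCat.trivialModelTrivialCofibrations K).map T.free).rlp.llp := by
  have := hasColimits_of_isLocallyPresentable2Cat K
  have := isLocallyPresentable_of_isLocallyPresentable2Cat K
  have : HasLimits K := hasLimits_of_isLocallyPresentable
  have := T.hasColimits_strictAlg hT
  have : HasLimits T.StrictAlg := ⟨fun J _ => T.hasLimitsOfShape_strictAlg J⟩
  have h₂ (A : K) : HasCotensor (Fin 2) A := hasCotensor_of_isLocallyPresentable2Cat (Fin 2) A
  have hc (A : T.StrictAlg) : HasCotensor (Fin 2) A := T.hasCotensor_strictAlg h₂ A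
  have hI (A : T.StrictAlg) : HasCotensor WalkingIso.{0} A :=
    T.hasCotensor_strictAlg (fun A => hasCotensor_of_isLocallyPresentable2Cat WalkingIso.{0} A) A
  have eFib := T.isofibrationsOn_freeAlgebras_eq_rlp
  have eTF := T.trivialFibrationsOn_freeAlgebras_eq_rlp
  have : (trivialFibrationsOn T.freeAlgebras).IsStableUnderBaseChange := by
    rw [eTF]; infer_instance
  have := T.hasFactorization_trivialFibrationsOn hT
  -- By definition, the classes of `M` are those tested at the free algebras.
  let M : ModelCategory T.StrictAlg := modelCategoryOn T.freeAlgebras hI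
    (by rw [eTF, rlp_llp_rlp_eq]) (by rw [eFib, rlp_llp_rlp_eq])
  refine ⟨M, ⟨?_, hc, fun i p hi hp => isIsofibration_cornerFunctor hI hi hp, ?_⟩,
    T.equivalencesOn_freeAlgebras h₂, T.isofibrationsOn_freeAlgebras h₂,
    congrArg MorphismProperty.llp eTF, ?_⟩
  · exact fun A => T.hasTensor_strictAlg h₂
      (fun A => IsLocallyPresentable2Cat.hasTensor_of_small (Fin 2) A) A
  · intro A B C D i p hi hp h
    have hi' : (trivialFibrationsOn T.freeAlgebras).llp i := hi
    have hp' : isofibrationsOn T.freeAlgebras p := hp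
    obtain h | h := h
    · have := hasLiftingProperty_of_equivalencesOn hI hi' h hp'
      exact isEquivalence_cornerFunctor_of_precomp i p
        (isFullyFaithful_precomp_of_equivalences (equivalences_of_llp hI hi' h))
    · have hp : trivialFibrationsOn T.freeAlgebras p := ⟨h, hp'⟩
      have := hi' p hp
      exact isEquivalence_cornerFunctor_of_postcomp i p
        (T.detectsIsos_freeAlgebras.isFullyFaithful_postcomp hc p fun X hX =>
          ((trivialFibrationsOn_iff p).1 hp X hX).1)
  · exact (llp_isofibrationsOn hI).symm.trans (congrArg MorphismProperty.llp eFib)
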